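/- Let $\alpha_1,\alpha_2,\alpha_3>0$ with $\alpha_1+\alpha_2+\alpha_3=\pi$. Let $\tilde Q=\{(K,L,M)\in\mathbb Z^3: L+M\le 0,\ M+K\le 0,\ K+L\ge 0\}$ and $\tilde Q_H=\{(K,L,M)\in\tilde Q: K+L+M\in\{0,1\}\}$. For a real function $r$ on $D=\tilde Q$ or $D=\tilde Q_H$ consider the radius equations (each imposed whenever all vertices occurring in it lie in $D$): (Rkm) $(r_1+r_2)\big(r^2-r_2r_3+r(r_3-r_2)\cos\alpha\big)+(r_3+r_2)\big(r^2-r_2r_1+r(r_1-r_2)\cos\alpha\big)=0$, with $\alpha=\alpha_3$, $r=r(K,0,-K)$, $r_1=r(K+1,0,-K-1)$, $r_2=r(K,1,-K)$, $r_3=r(K-1,0,-K+1)$; and with $\alpha=\alpha_2$, $r=r(0,L,-L)$, $r_1=r(0,L+1,-L-1)$, $r_2=r(1,L,-L)$, $r_3=r(0,L-1,-L+1)$; (HexEq) $(L+M+1)\frac{r_4-r_1}{r_4+r_1}+(M+K+1)\frac{r_6-r_3}{r_6+r_3}+(K+L+1)\frac{r_2-r_5}{r_2+r_5}=c-1$,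 where $r_1=r(K+1,L,M)$, $r_2=r(K+1,L+1,M)$, $r_3=r(K,L+1,M)$, $r_4=r(K,L+1,M+1)$, $r_5=r(K,L,M+1)$, $r_6=r(K+1,L,M+1)$; a term with zero coefficient is dropped, and the other denominators are required to be nonzero; (TriEq) $r(r_1\sin\alpha_3+r_2\sin\alpha_1+r_3\sin\alpha_2)=r_1r_2\sin\alpha_2+r_2r_3\sin\alpha_3+r_3r_1\sin\alpha_1$, where $r=r(K,L,M)$, $r_1=r(K,L-1,M)$, $r_2=r(K,L,M-1)$, $r_3=r(K-1,L,M)$; on $D=\tilde Q$ the same equation is also imposed for $r=r(K,L,M)$, $r_1=r(K,L+1,M)$, $r_2=r(K,L,M+1)$, $r_3=r(K+1,L,M)$. Then for $c=2$ these equations with the initial data $$r(0,0,0)=0,\quad r(1,0,-1)=\frac{\sin\alpha_3}{\alpha_3},\quad r(0,1,-1)=\frac{\sin\alpha_2}{\alpha_2},\quad r(1,1,-1)=1$$ have exactly one solution on $\tilde Q$ and exactly one on $\tilde Q_H$; the latter is the restriction of the former, and $r(K,L,M)>0$ for all $(K,L,M)\in\tilde Q\setminus\{(0,0,0)\}$.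 -/

import Mathlib

namespace HexCirclePattern

/-- The sublattice `Q̃ = {(K,L,M) ∈ ℤ³ : L+M ≤ 0, M+K ≤ 0, K+L ≥ 0}` of circle centers. -/
def InQ (K L M : ℤ) : Prop := L + M ≤ 0 ∧ M + K ≤ 0 ∧ 0 ≤ K + L

/-- The hexagonal part `Q̃_H` of `Q̃`: the two layers `K+L+M = 0` and `K+L+M = 1`. -/
def InQH (K L M : ℤ) : Prop := InQ K L M ∧ (K + L + M = 0 ∨ K + L + M = 1)

/-- The border equation with angle `α`, for the radius `r` and neighbouring radii `r₁, r₂, r₃`. -/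
def BorderEq (α r r₁ r₂ r₃ : ℝ) : Prop :=
  (r₁ + r₂) * (r ^ 2 - r₂ * r₃ + r * (r₃ - r₂) * Real.cos α) +
    (r₃ + r₂) * (r ^ 2 - r₂ * r₁ + r * (r₁ - r₂) * Real.cos α) = 0

/-- The equation for four circles of radii `r, r₁, r₂, r₃` centered at the four circle
vertices of an elementary cube. -/
def TriEq (α₁ α₂ α₃ r r₁ r₂ r₃ : ℝ) : Prop :=
  r * (r₁ * Real.sin α₃ + r₂ * Real.sin α₁ + r₃ * Real.sin α₂) =
    r₁ * r₂ * Real.sin α₂ + r₂ * r₃ * Real.sin α₃ + r₃ * r₁ * Real.sin α₁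

/-- The six-radii equation based at `(K,L,M)`, with
`r₁ = r(K+1,L,M)`, `r₄ = r(K,L+1,M+1)`, `r₃ = r(K,L+1,M)`, `r₆ = r(K+1,L,M+1)`,
`r₅ = r(K,L,M+1)`, `r₂ = r(K+1,L+1,M)`.
A term with zero coefficient drops out; in the other terms the denominator must not vanish. -/
def HexEq (c : ℝ) (r : ℤ → ℤ → ℤ → ℝ) (K L M : ℤ) : Prop :=
  (L + M + 1 ≠ 0 → r K (L + 1) (M + 1) + r (K + 1) L M ≠ 0) ∧
  (M + K + 1 ≠ 0 → r (K + 1) L (M + 1) + r K (L + 1) M ≠ 0) ∧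
  (K + L + 1 ≠ 0 → r (K + 1) (L + 1) M + r K L (M + 1) ≠ 0) ∧
  ((L + M + 1 : ℤ) : ℝ) * ((r K (L + 1) (M + 1) - r (K + 1) L M) /
      (r K (L + 1) (M + 1) + r (K + 1) L M)) +
    ((M + K + 1 : ℤ) : ℝ) * ((r (K + 1) L (M + 1) - r K (L + 1) M) /
      (r (K + 1) L (M + 1) + r K (L + 1) M)) +
    ((K + L + 1 : ℤ) : ℝ) * ((r (K + 1) (L + 1) M - r K L (M + 1)) /
      (r (K + 1) (L + 1) M + r K L (M + 1))) = c - 1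

/-- All vertices that actually occur in the six-radii equation based at `(K,L,M)` lie in `D`. -/
def HexPatternIn (D : ℤ → ℤ → ℤ → Prop) (K L M : ℤ) : Prop :=
  (L + M + 1 ≠ 0 → D K (L + 1) (M + 1) ∧ D (K + 1) L M) ∧
  (M + K + 1 ≠ 0 → D (K + 1) L (M + 1) ∧ D K (L + 1) M) ∧
  (K + L + 1 ≠ 0 → D (K + 1) (L + 1) M ∧ D K L (M + 1))

/-- `r` solves the radius equations with parameter `c` on the vertex set `D`: every equation
whose pattern lies in `D` holds. Only the values of `r` on `D` matter. -/
structure IsRadiusSolution (α₁ α₂ α₃ c : ℝ) (D : ℤ → ℤ → ℤ → Prop)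
    (r : ℤ → ℤ → ℤ → ℝ) : Prop where
  /-- the border equation along the line `(K,0,-K)` -/
  border_I : ∀ K : ℤ, D K 0 (-K) → D (K + 1) 0 (-K - 1) → D K 1 (-K) → D (K - 1) 0 (-K + 1) →
    BorderEq α₃ (r K 0 (-K)) (r (K + 1) 0 (-K - 1)) (r K 1 (-K)) (r (K - 1) 0 (-K + 1))
  /-- the border equation along the line `(0,L,-L)` -/
  border_II : ∀ L : ℤ, D 0 L (-L) → D 0 (L + 1) (-L - 1) → D 1 L (-L) → D 0 (L - 1) (-L + 1) →
    BorderEq α₂ (r 0 L (-L)) (r 0 (L + 1) (-L - 1)) (r 1 L (-L)) (r 0 (L - 1) (-L + 1))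
  hex : ∀ K L M : ℤ, HexPatternIn D K L M → HexEq c r K L M
  tri : ∀ K L M : ℤ, D K L M → D K (L - 1) M → D K L (M - 1) → D (K - 1) L M →
    TriEq α₁ α₂ α₃ (r K L M) (r K (L - 1) M) (r K L (M - 1)) (r (K - 1) L M)

/-- The four-radii equation on the opposite pattern, formed by a vertex and its three
neighbours in the next layer. -/
def SatisfiesOppositeTri (α₁ α₂ α₃ : ℝ) (D : ℤ → ℤ → ℤ → Prop)
    (r : ℤ → ℤ → ℤ → ℝ) : Prop :=
  ∀ K L M : ℤ, D K L M → D K (L + 1) M → D K L (M + 1) → D (K + 1) L M →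
    TriEq α₁ α₂ α₃ (r K L M) (r K (L + 1) M) (r K L (M + 1)) (r (K + 1) L M)

/-- The normalized initial data for `c = 2`. -/
def HasInitialData (α₂ α₃ : ℝ) (r : ℤ → ℤ → ℤ → ℝ) : Prop :=
  r 0 0 0 = 0 ∧ r 1 0 (-1) = Real.sin α₃ / α₃ ∧ r 0 1 (-1) = Real.sin α₂ / α₂ ∧
    r 1 1 (-1) = 1

end HexCirclePattern

/-! In the coordinates a = -(L+M), b = -(M+K), c = K+L the lattice becomes the set of points of ℕ³
with even coordinate sum. The radii are complemented by nonzero complex phases at the odd points,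
giving a function w on ℕ³ that satisfies a Hirota equation on every elementary square, with unit
directions e^{-iα₃}, e^{iα₂}, 1, and a nonautonomous constraint: the sum of coordinate times centred
relative difference is 0 at even points and 1 at odd points. At odd points the constraint is the
six-radii equation; eliminating phases from the faces of a cube gives the four-radii equations.

The left side of the constraint solves the linearised Hirota equation (`Quad.low₁` and its
companions, `Hirota.transverse`), so it spreads from three corners of a square to the fourth
(`SpaceData.constraintAt_step`). Three-dimensional consistency (`SpaceData.verticalFaces`) reduces
existence to the planes a = 0 and b = 0, and reflection reduces each plane to its diagonal, where
only the border equation is needed (`DiagonalData.constraint_and_quads`). Off the diagonals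
positivity is automatic: in a plane a new radius is an old one times (1+t)/(1-t) with |t| < 1, in
space it is a quotient of expressions with positive coefficients.

What remains is positivity on the diagonals. The n-th border radius at angle t is written n·a(t).
These functions satisfy differential equations in t that are preserved by passing from n to n+1
(`BorderData.next`); asymptotics at the singular point t = 0 start the bounds 0 < a < 1 and the sign
of the derivative keeps them.

For uniqueness any solution is compared with the positive one just built: each equation used
determines its new radius because the relevant coefficient, evaluated at the positive solution, is
nonzero. No positivity of the other solution is needed. -/

namespace HexCirclePattern
-- Algebra of the Hirota equation and its linearisation.
section Algebra
variable {𝕜 : Type*} [Field 𝕜]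

/-- The Hirota equation on a quadrilateral. -/
def Hirota (m n w₀ w₁ w₂ w₁₂ : 𝕜) : Prop :=
  w₂ * (n * w₀ + m * w₁₂) = w₁ * (m * w₀ + n * w₁₂)

/-- `(x - y) / (x + y)` -/
def relDiff (x y : 𝕜) : 𝕜 := (x - y) / (x + y)

theorem Hirota.swap {m n w₀ w₁ w₂ w₁₂ : 𝕜} (h : Hirota m n w₀ w₁ w₂ w₁₂) :
    Hirota n m w₀ w₂ w₁ w₁₂ := Eq.symm h

/-- Two squares share the edge from `w₀` to `v`, with `p`, `q` on either side of `w₀` and `pv`, `qv`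
on either side of `v`. Each square gives `pv` or `qv` as `w₀` times a Möbius expression, so `w₀`
disappears from the ratio of the two. -/
theorem Hirota.step {m n w₀ p q v pv qv : 𝕜} (h₁ : Hirota m n w₀ p v pv)
    (h₂ : Hirota m n q w₀ qv v)
    (hp : m * v - n * p ≠ 0) (hq : n * q + m * v ≠ 0) :
    (pv - qv) * ((m ^ 2 - n ^ 2) * v * (p + q)) = (pv + qv) *
      (2 * m * n * (p * q - v ^ 2) + (m ^ 2 + n ^ 2) * v * (p - q)) := by
  unfold Hirota at h₁ h₂
  refine mul_left_cancel₀ (mul_ne_zero hp hq) ?_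
  linear_combination (((m ^ 2 - n ^ 2) * v * (p + q)) - (2 * m * n * (p * q - v ^ 2) + (m ^ 2 + n ^ 2) * v * (p - q))) * (n * q + m * v) * h₁ - (((m ^ 2 - n ^ 2) * v * (p + q)) + (2 * m * n * (p * q - v ^ 2) + (m ^ 2 + n ^ 2) * v * (p - q))) * (m * v - n * p) * h₂

/-- The common value of the weighted differences on both sides of an edge direction of a
Hirota quadrilateral. -/
def cellE (m n w₀ w₁ w₂ w₁₂ : 𝕜) : 𝕜 :=
  (n * w₀ + m * w₁₂) * (2 * m * n * w₁ - (m ^ 2 + n ^ 2) * w₂) -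
    (m ^ 2 - n ^ 2) * (w₀ * (n * w₂ - m * w₁))

theorem Hirota.cellE_swap {m n w₀ w₁ w₂ w₁₂ : 𝕜} (h : Hirota m n w₀ w₁ w₂ w₁₂) :
    cellE n m w₀ w₂ w₁ w₁₂ = - cellE m n w₀ w₁ w₂ w₁₂ := by
  unfold Hirota at h
  unfold cellE
  linear_combination (n ^ 2 - m ^ 2) * h

theorem Hirota.relDiff_step {m n w₀ p q v pv qv : 𝕜} (h₁ : Hirota m n w₀ p v pv)
    (h₂ : Hirota m n q w₀ qv v) (hp : m * v - n * p ≠ 0) (hq : n * q + m * v ≠ 0)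
    (hs : p + q ≠ 0) (hsv : pv + qv ≠ 0) :
    (m ^ 2 - n ^ 2) * (relDiff pv qv * v) =
      (2 * m * n * (p * q - v ^ 2) + (m ^ 2 + n ^ 2) * v * (p - q)) / (p + q) := by
  have key := h₁.step h₂ hp hq
  rw [relDiff, eq_div_iff hs]
  field_simp
  linear_combination key

theorem Hirota.lower {m n w₀ p q v pv qv : 𝕜} (h₁ : Hirota m n w₀ p v pv)
    (h₂ : Hirota m n q w₀ qv v)
    (hp : m * v - n * p ≠ 0) (hq : n * q + m * v ≠ 0) (hs : p + q ≠ 0)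
    (hsv : pv + qv ≠ 0) :
    (m ^ 2 - n ^ 2) * (relDiff pv qv * (v * (n * w₀ + m * pv)) +
      relDiff p q * (w₀ * (n * v - m * p))) = cellE m n w₀ p v pv := by
  have e := h₁.relDiff_step h₂ hp hq hs hsv
  have e2 : (m ^ 2 - n ^ 2) * (relDiff pv qv * (v * (n * w₀ + m * pv)) +
      relDiff p q * (w₀ * (n * v - m * p))) = (n * w₀ + m * pv) *
        ((m ^ 2 - n ^ 2) * (relDiff pv qv * v)) +
      (m ^ 2 - n ^ 2) * (relDiff p q * (w₀ * (n * v - m * p))) := by ring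
  rw [e2, e, relDiff, cellE]
  unfold Hirota at h₁
  field_simp
  linear_combination (2 * m ^ 2 * p - 2 * m * n * v) * h₁

theorem Hirota.upper {m n w₀ p q v pv qv : 𝕜} (h₁ : Hirota m n w₀ p v pv)
    (h₂ : Hirota m n q w₀ qv v)
    (hp : m * v - n * p ≠ 0) (hq : n * q + m * v ≠ 0) (hs : p + q ≠ 0)
    (hsv : pv + qv ≠ 0) :
    (m ^ 2 - n ^ 2) * (relDiff p q * (w₀ * (m * q + n * v)) +
      relDiff pv qv * (v * (n * w₀ - m * qv))) = cellE m n q w₀ qv v := by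
  have e := h₁.relDiff_step h₂ hp hq hs hsv
  have e2 : (m ^ 2 - n ^ 2) * (relDiff p q * (w₀ * (m * q + n * v)) +
      relDiff pv qv * (v * (n * w₀ - m * qv))) = (n * w₀ - m * qv) *
        ((m ^ 2 - n ^ 2) * (relDiff pv qv * v)) +
      (m ^ 2 - n ^ 2) * (relDiff p q * (w₀ * (m * q + n * v))) := by ring
  rw [e2, e, relDiff, cellE]
  unfold Hirota at h₂
  field_simp
  linear_combination (2 * m ^ 2 * q + 2 * m * n * v) * h₂

theorem transverse_aux {l n w₀ A B C α β γ t : 𝕜} (hA : A ≠ 0) (hB : B ≠ 0) (hC : C ≠ 0)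
    (hw : w₀ ≠ 0)
    (h : (l ^ 2 - n ^ 2) * (t * (w₀ * γ / C)) * (w₀ * α / A + w₀ * β / B) =
      2 * l * n * ((w₀ * α / A) * (w₀ * β / B) - (w₀ * γ / C) ^ 2) +
        (l ^ 2 + n ^ 2) * (w₀ * γ / C) * (w₀ * α / A - w₀ * β / B)) :
    (l ^ 2 - n ^ 2) * t * γ * C * (α * B + β * A) =
      2 * l * n * (α * β * C ^ 2 - γ ^ 2 * A * B) +
        (l ^ 2 + n ^ 2) * γ * C * (α * B - β * A) := by
  field_simp at h
  linear_combination h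

/-- The centred relative difference in a third direction `l` solves the linearised Hirota equation
of the square: such a difference is determined by values next to each corner, and all of these can
be written through the values at the lowest corner. -/
theorem Hirota.transverse {l m n w₀ w₁ w₂ w₁₂ p p₁ p₂ p₁₂ q q₁ q₂ q₁₂ : 𝕜}
    (h : Hirota m n w₀ w₁ w₂ w₁₂)
    (hp₁ : Hirota l m w₀ p w₁ p₁) (hq₁ : Hirota l m q w₀ q₁ w₁)
    (hp₂ : Hirota l n w₀ p w₂ p₂) (hq₂ : Hirota l n q w₀ q₂ w₂)
    (hp₁₂ : Hirota l n w₁ p₁ w₁₂ p₁₂) (hq₁₂ : Hirota l n q₁ w₁ q₁₂ w₁₂)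
    (a₁ : l * w₁ - m * p ≠ 0) (b₁ : m * q + l * w₁ ≠ 0)
    (a₂ : l * w₂ - n * p ≠ 0) (b₂ : n * q + l * w₂ ≠ 0)
    (a₁₂ : l * w₁₂ - n * p₁ ≠ 0) (b₁₂ : n * q₁ + l * w₁₂ ≠ 0)
    (c : n * w₁ - m * w₂ ≠ 0) (hlm : l ^ 2 - m ^ 2 ≠ 0) (hln : l ^ 2 - n ^ 2 ≠ 0)
    (hw₀ : w₀ ≠ 0) (hw₁ : w₁ ≠ 0)
    (s : p + q ≠ 0) (s₁ : p₁ + q₁ ≠ 0) (s₂ : p₂ + q₂ ≠ 0) (s₁₂ : p₁₂ + q₁₂ ≠ 0) :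
    (relDiff p₂ q₂ - relDiff p₁ q₁) * (w₂ * (n * w₀ + m * w₁₂)) =
      (relDiff p₁₂ q₁₂ - relDiff p q) * (w₀ * (n * w₂ - m * w₁)) := by
  have e₁ := hp₁.relDiff_step hq₁ a₁ b₁ s s₁
  have e₂ := hp₂.relDiff_step hq₂ a₂ b₂ s s₂
  have e₁₂ := hp₁₂.relDiff_step hq₁₂ a₁₂ b₁₂ s₁ s₁₂
  have e₀ : relDiff p q * (p + q) = p - q := by rw [relDiff]; field_simp
  rw [eq_div_iff s] at e₁ e₂
  rw [eq_div_iff s₁] at e₁₂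
  have f₁ : p₁ = w₀ * (l * p - m * w₁) / (l * w₁ - m * p) := by
    rw [eq_div_iff a₁]; unfold Hirota at hp₁; linear_combination hp₁
  have f₂ : q₁ = w₀ * (l * q + m * w₁) / (m * q + l * w₁) := by
    rw [eq_div_iff b₁]; unfold Hirota at hq₁; linear_combination hq₁
  have f₁₂ : w₁₂ = w₀ * (n * w₂ - m * w₁) / (n * w₁ - m * w₂) := by
    rw [eq_div_iff c]; unfold Hirota at h; linear_combination -h
  have f₃ : w₁₂ * (n * w₁ - m * w₂) = w₀ * (n * w₂ - m * w₁) := by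
    unfold Hirota at h; linear_combination -h
  rw [mul_assoc, f₁, f₂] at e₁₂
  generalize relDiff p₁₂ q₁₂ = t₁₂ at *
  generalize relDiff p₁ q₁ = t₁ at *
  generalize relDiff p₂ q₂ = t₂ at *
  generalize relDiff p q = t₀ at *
  have g := transverse_aux (t := t₁₂) (l := l) (n := n) a₁ b₁ c hw₀
    (γ := n * w₂ - m * w₁) (α := l * p - m * w₁) (β := l * q + m * w₁)
    (by rw [f₁₂] at e₁₂; linear_combination e₁₂)
  refine mul_left_cancel₀ (mul_ne_zero (mul_ne_zero (mul_ne_zero hlm hln) s)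
    (mul_ne_zero c hw₁)) ?_
  linear_combination (l ^ 2 - m ^ 2) * (l ^ 2 - n ^ 2) * (p + q) * w₁ * (t₂ - t₁) * w₂ * m * f₃ +
    (l ^ 2 - m ^ 2) * w₁ ^ 2 * w₀ * (n ^ 2 - m ^ 2) * e₂ -
    (l ^ 2 - n ^ 2) * w₁ * w₂ * w₀ * (n ^ 2 - m ^ 2) * e₁ - w₀ * g +
    (l ^ 2 - m ^ 2) * (l ^ 2 - n ^ 2) * (n * w₁ - m * w₂) * w₁ * w₀ * (n * w₂ - m * w₁) * e₀
end Algebra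

/-! ### Positivity, and nonvanishing of denominators on squares. -/

/-- `z` is a positive real number. -/
def IsPos (z : ℂ) : Prop := ∃ x : ℝ, 0 < x ∧ z = x

theorem IsPos.ne_zero {z : ℂ} (h : IsPos z) : z ≠ 0 := by
  obtain ⟨x, hx, rfl⟩ := h
  exact_mod_cast hx.ne'

theorem IsPos.add {z w : ℂ} (h : IsPos z) (h' : IsPos w ∨ w = 0) : IsPos (z + w) := by
  obtain ⟨x, hx, rfl⟩ := h
  rcases h' with ⟨y, hy, rfl⟩ | rfl
  · exact ⟨x + y, by positivity, by push_cast; rfl⟩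
  · exact ⟨x, hx, by simp⟩

/-- `m` and `n` are linearly independent over the reals. -/
def RealIndep (m n : ℂ) : Prop := ∀ x y : ℝ, m * x + n * y = 0 → x = 0 ∧ y = 0

theorem RealIndep.symm {m n : ℂ} (h : RealIndep m n) : RealIndep n m := fun x y e =>
  (h y x (by rw [add_comm]; exact e)).symm

theorem RealIndep.sq_sub_ne {m n : ℂ} (h : RealIndep m n) : m ^ 2 - n ^ 2 ≠ 0 := by
  intro e
  have e' : (m - n) * (m + n) = 0 := by linear_combination e
  rcases mul_eq_zero.1 e' with e | e
  · have := h 1 (-1) (by push_cast; linear_combination e)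
    simp at this
  · have := h 1 1 (by push_cast; linear_combination e)
    simp at this

theorem RealIndep.left_ne {m n : ℂ} (h : RealIndep m n) : m ≠ 0 := by
  rintro rfl
  simpa using (h 1 0 (by simp)).1

/-- A Hirota quadrilateral with positive radii at two opposite corners and nonzero values at the
other two. -/
structure Quad (m n w₀ w₁ w₂ w₁₂ : ℂ) : Prop where
  hirota : Hirota m n w₀ w₁ w₂ w₁₂
  pos : ((IsPos w₀ ∨ w₀ = 0) ∧ IsPos w₁₂ ∧ w₁ ≠ 0 ∧ w₂ ≠ 0) ∨
    (w₀ ≠ 0 ∧ w₁₂ ≠ 0 ∧ IsPos w₁ ∧ IsPos w₂)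

/-- The factor of the second difference in the linearized Hirota equation. -/
def facP (m n w₀ w₂ w₁₂ : ℂ) : ℂ := w₂ * (n * w₀ + m * w₁₂)

/-- The factor of the diagonal difference in the linearized Hirota equation. -/
def facQ (m n w₀ w₁ w₂ : ℂ) : ℂ := w₀ * (n * w₂ - m * w₁)

namespace Quad
variable {m n w₀ w₁ w₂ w₁₂ : ℂ}

theorem swap (h : Quad m n w₀ w₁ w₂ w₁₂) : Quad n m w₀ w₂ w₁ w₁₂ :=
  ⟨h.hirota.swap, h.pos.imp (fun h => ⟨h.1, h.2.1, h.2.2.2, h.2.2.1⟩)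
    fun h => ⟨h.1, h.2.1, h.2.2.2, h.2.2.1⟩⟩

theorem ne₁ (h : Quad m n w₀ w₁ w₂ w₁₂) : w₁ ≠ 0 := by
  rcases h.pos with h | h
  exacts [h.2.2.1, h.2.2.1.ne_zero]

theorem ne₂ (h : Quad m n w₀ w₁ w₂ w₁₂) : w₂ ≠ 0 := h.swap.ne₁

theorem ne₁₂ (h : Quad m n w₀ w₁ w₂ w₁₂) : w₁₂ ≠ 0 := by
  rcases h.pos with h | h
  exacts [h.2.1.ne_zero, h.2.1]

theorem add_ne (h : Quad m n w₀ w₁ w₂ w₁₂) (hmn : RealIndep m n) :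
    n * w₀ + m * w₁₂ ≠ 0 := by
  intro e
  rcases h.pos with ⟨h0, ⟨y, hy, rfl⟩, -⟩ | ⟨h0, -, h1, -⟩
  · rcases h0 with ⟨x, hx, rfl⟩ | rfl
    · exact hy.ne' (hmn y x (by linear_combination e)).1
    · exact hy.ne' (hmn y 0 (by push_cast; linear_combination e)).1
  · have e2 := h.hirota
    unfold Hirota at e2
    rw [e, mul_zero, eq_comm, mul_eq_zero] at e2
    have e3 := e2.resolve_left h1.ne_zero
    have e4 : (m ^ 2 - n ^ 2) * w₀ = 0 := by linear_combination m * e3 - n * e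
    exact mul_ne_zero hmn.sq_sub_ne h0 e4

theorem add_ne' (h : Quad m n w₀ w₁ w₂ w₁₂) (hmn : RealIndep m n) :
    m * w₀ + n * w₁₂ ≠ 0 := h.swap.add_ne hmn.symm

theorem sub_ne (h : Quad m n w₀ w₁ w₂ w₁₂) (hmn : RealIndep m n) (h0 : w₀ ≠ 0) :
    m * w₂ - n * w₁ ≠ 0 := by
  intro e
  rcases h.pos with ⟨-, -, h1, -⟩ | ⟨-, -, ⟨x, hx, rfl⟩, ⟨y, hy, rfl⟩⟩
  · have e2 := h.hirota
    unfold Hirota at e2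
    have e3 : w₀ * (m * w₁ - n * w₂) = 0 := by linear_combination w₁₂ * e - e2
    have e4 := (mul_eq_zero.1 e3).resolve_left h0
    have e5 : (m ^ 2 - n ^ 2) * w₁ = 0 := by linear_combination m * e4 + n * e
    exact mul_ne_zero hmn.sq_sub_ne h1 e5
  · exact hy.ne' (hmn y (-x) (by push_cast; linear_combination e)).1

theorem sub_ne' (h : Quad m n w₀ w₁ w₂ w₁₂) (hmn : RealIndep m n) (h0 : w₀ ≠ 0) :
    n * w₂ - m * w₁ ≠ 0 := by
  intro e
  have e2 := h.hirota
  unfold Hirota at e2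
  have : w₁₂ * (m * w₂ - n * w₁) = 0 := by linear_combination -w₀ * e + e2
  exact mul_ne_zero h.ne₁₂ (h.sub_ne hmn h0) this

variable {p q v pv qv : ℂ}

/-- By parity one of the two sums consists of radii and is positive. If the other vanished,
`Hirota.step` would make a nonzero factor or the value `pv` vanish. -/
theorem sum_ne (h₁ : Quad m n w₀ p v pv) (h₂ : Quad m n q w₀ qv v) (hmn : RealIndep m n)
    (h0 : w₀ ≠ 0) (hpar : (IsPos pv ∧ IsPos qv) ∨ (IsPos p ∧ (IsPos q ∨ q = 0))) :
    p + q ≠ 0 ∧ pv + qv ≠ 0 := by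
  have hv := h₁.ne₂
  have hp := h₁.ne₁
  have key := h₁.hirota.step h₂.hirota (h₁.sub_ne hmn h0) (h₂.add_ne hmn)
  rcases hpar with ⟨hpv, hqv⟩ | ⟨hp', hq⟩
  · have hs : pv + qv ≠ 0 := (hpv.add (Or.inl hqv)).ne_zero
    refine ⟨fun e => ?_, hs⟩
    have hq : q = -p := by linear_combination e
    subst hq
    have := mul_ne_zero hs (mul_ne_zero (h₁.sub_ne hmn h0) (h₁.sub_ne' hmn h0))
    apply this
    have e0 : (pv + qv) * (2 * m * n * (p * -p - v ^ 2) + (m ^ 2 + n ^ 2) * v * (p - -p)) = 0 := by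
      rw [← key]; ring
    linear_combination -e0 / 2
  · have hs : p + q ≠ 0 := (hp'.add hq).ne_zero
    refine ⟨hs, fun e => ?_⟩
    rw [e, zero_mul] at key
    have e1 := (mul_eq_zero.1 key).resolve_right
      (mul_ne_zero (mul_ne_zero hmn.sq_sub_ne hv) hs)
    exact h₁.ne₁₂ (by linear_combination (e + e1) / 2)

theorem lower (h₁ : Quad m n w₀ p v pv) (h₂ : Quad m n q w₀ qv v) (hmn : RealIndep m n)
    (h0 : w₀ ≠ 0) (hpar : (IsPos pv ∧ IsPos qv) ∨ (IsPos p ∧ (IsPos q ∨ q = 0))) :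
    (m ^ 2 - n ^ 2) * (relDiff pv qv * (v * (n * w₀ + m * pv)) +
      relDiff p q * (w₀ * (n * v - m * p))) = cellE m n w₀ p v pv :=
  h₁.hirota.lower h₂.hirota (h₁.sub_ne hmn h0) (h₂.add_ne hmn) (h₁.sum_ne h₂ hmn h0 hpar).1
    (h₁.sum_ne h₂ hmn h0 hpar).2

theorem upper (h₁ : Quad m n w₀ p v pv) (h₂ : Quad m n q w₀ qv v) (hmn : RealIndep m n)
    (h0 : w₀ ≠ 0) (hpar : (IsPos pv ∧ IsPos qv) ∨ (IsPos p ∧ (IsPos q ∨ q = 0))) :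
    (m ^ 2 - n ^ 2) * (relDiff p q * (qv * (n * q + m * v)) +
      relDiff pv qv * (q * (n * qv - m * w₀))) = cellE m n q w₀ qv v := by
  rw [← h₁.hirota.upper h₂.hirota (h₁.sub_ne hmn h0) (h₂.add_ne hmn) (h₁.sum_ne h₂ hmn h0 hpar).1
    (h₁.sum_ne h₂ hmn h0 hpar).2]
  have e := h₂.hirota
  unfold Hirota at e
  linear_combination (m ^ 2 - n ^ 2) * (relDiff p q + relDiff pv qv) * e

/-- Converse of `upper`: it lets the constraint produce a Hirota square not yet known. -/
theorem hirota_of_upper (h₂ : Quad m n q w₀ qv v) (hmn : RealIndep m n)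
    (hs : p + q ≠ 0) (hsv : pv + qv ≠ 0) (hq : q ≠ 0)
    (h : (m ^ 2 - n ^ 2) * (relDiff p q * (qv * (n * q + m * v)) +
      relDiff pv qv * (q * (n * qv - m * w₀))) = cellE m n q w₀ qv v) :
    Hirota m n w₀ p v pv := by
  have e := h₂.hirota
  have e₁ : relDiff p q * (p + q) = p - q := by rw [relDiff]; field_simp
  have e₂ : relDiff pv qv * (pv + qv) = pv - qv := by rw [relDiff]; field_simp
  rw [cellE] at h
  unfold Hirota at e ⊢
  refine mul_left_cancel₀ (mul_ne_zero hmn.sq_sub_ne (mul_ne_zero hq h₂.ne₂)) ?_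
  linear_combination (-(p + q) * (pv + qv) / 2) * h +
    ((m ^ 2 - n ^ 2) * (qv * (n * q + m * v)) * (pv + qv) / 2) * e₁ +
    ((m ^ 2 - n ^ 2) * (q * (n * qv - m * w₀)) * (p + q) / 2) * e₂ +
    (m ^ 2 * p * pv + m ^ 2 * p * qv + m ^ 2 * pv * q + n ^ 2 * q * qv) * e

/-- `low₁`, `up₁`, `low₂`, `up₂` express one quantity `cellE` by the centred differences D₁, D₂ at
the corners. With weights a, -(a+1), -b, b+1 their right sides cancel, leaving facP·(F(w₂) - F(w₁))
= facQ·(F(w₁₂) - F(w₀)) for F = a·D₁ + b·D₂, which is the linearised Hirota equation for F. -/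
theorem low₁ (h : Quad m n w₀ w₁ w₂ w₁₂) (h₂ : Quad m n q w₀ qv w₂) (hmn : RealIndep m n)
    (h0 : w₀ ≠ 0) (hpar : (IsPos w₁₂ ∧ IsPos qv) ∨ (IsPos w₁ ∧ (IsPos q ∨ q = 0))) :
    (m ^ 2 - n ^ 2) * (relDiff w₁₂ qv * facP m n w₀ w₂ w₁₂ + relDiff w₁ q * facQ m n w₀ w₁ w₂) =
      cellE m n w₀ w₁ w₂ w₁₂ := h.lower h₂ hmn h0 hpar

theorem up₁ (h : Quad m n w₀ w₁ w₂ w₁₂) (h₁ : Quad m n w₁ p w₁₂ pv) (hmn : RealIndep m n)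
    (hpar : (IsPos pv ∧ IsPos w₂) ∨ (IsPos p ∧ (IsPos w₀ ∨ w₀ = 0))) :
    (m ^ 2 - n ^ 2) * (relDiff p w₀ * facP m n w₀ w₂ w₁₂ + relDiff pv w₂ * facQ m n w₀ w₁ w₂) =
      cellE m n w₀ w₁ w₂ w₁₂ := h₁.upper h hmn h.ne₁ hpar

theorem low₂ (h : Quad m n w₀ w₁ w₂ w₁₂) (h₂ : Quad n m q w₀ qv w₁) (hmn : RealIndep m n)
    (h0 : w₀ ≠ 0) (hpar : (IsPos w₁₂ ∧ IsPos qv) ∨ (IsPos w₂ ∧ (IsPos q ∨ q = 0))) :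
    (m ^ 2 - n ^ 2) * (relDiff w₁₂ qv * facP m n w₀ w₂ w₁₂ - relDiff w₂ q * facQ m n w₀ w₁ w₂) =
      cellE m n w₀ w₁ w₂ w₁₂ := by
  have e := h.swap.lower h₂ hmn.symm h0 hpar
  rw [h.hirota.cellE_swap] at e
  have e' := h.hirota
  unfold Hirota at e'
  unfold facP facQ
  linear_combination (m ^ 2 - n ^ 2) * relDiff w₁₂ qv * e' - e

theorem up₂ (h : Quad m n w₀ w₁ w₂ w₁₂) (h₁ : Quad n m w₂ p w₁₂ pv) (hmn : RealIndep m n)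
    (hpar : (IsPos pv ∧ IsPos w₁) ∨ (IsPos p ∧ (IsPos w₀ ∨ w₀ = 0))) :
    (m ^ 2 - n ^ 2) * (relDiff p w₀ * facP m n w₀ w₂ w₁₂ - relDiff pv w₁ * facQ m n w₀ w₁ w₂) =
      cellE m n w₀ w₁ w₂ w₁₂ := by
  have e := h₁.upper h.swap hmn.symm h.ne₂ hpar
  rw [h.hirota.cellE_swap] at e
  have e' := h.hirota
  unfold Hirota at e'
  unfold facP facQ
  linear_combination (m ^ 2 - n ^ 2) * relDiff p w₀ * e' - e

theorem hirota_of_up₂ (h : Quad m n w₀ w₁ w₂ w₁₂) (hmn : RealIndep m n)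
    (hs : p + w₀ ≠ 0) (hsv : pv + w₁ ≠ 0) (h0 : w₀ ≠ 0)
    (e : (m ^ 2 - n ^ 2) * (relDiff p w₀ * facP m n w₀ w₂ w₁₂ -
      relDiff pv w₁ * facQ m n w₀ w₁ w₂) = cellE m n w₀ w₁ w₂ w₁₂) :
    Hirota n m w₂ p w₁₂ pv := by
  refine h.swap.hirota_of_upper hmn.symm hs hsv h0 ?_
  rw [h.hirota.cellE_swap]
  have e' := h.hirota
  unfold Hirota at e'
  unfold facP facQ at e
  linear_combination (m ^ 2 - n ^ 2) * relDiff p w₀ * e' - e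

theorem facP_ne (h : Quad m n w₀ w₁ w₂ w₁₂) (hmn : RealIndep m n) :
    facP m n w₀ w₂ w₁₂ ≠ 0 := mul_ne_zero h.ne₂ (h.add_ne hmn)

theorem facQ_ne (h : Quad m n w₀ w₁ w₂ w₁₂) (hmn : RealIndep m n) (h0 : w₀ ≠ 0) :
    facQ m n w₀ w₁ w₂ ≠ 0 := mul_ne_zero h0 (h.sub_ne' hmn h0)

end Quad

/-! ### Radii in a coordinate plane. -/

theorem abs_relDiff_lt {x y : ℝ} (hx : 0 < x) (hy : 0 < y) : |relDiff x y| < 1 := by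
  have : 0 < x + y := by positivity
  rw [relDiff, abs_lt, lt_div_iff₀ this, div_lt_iff₀ this]
  constructor <;> linarith

/-- Radii of a planar pattern: `radii R j a` is the radius at `(a, a + 2 j)`, determined by the
radii `R a` at `(a, a)`, the values `j` at `(0, 2 j)` and the four-radii equation. -/
noncomputable def radii (R : ℕ → ℝ) : ℕ → ℕ → ℝ
  | 0, a => R a
  | j + 1, 0 => j + 1
  | j + 1, a + 1 =>
    radii R j (a + 1) *
      (1 + (1 - (a + 1) * relDiff (radii R j (a + 2)) (radii R (j + 1) a)) / (a + 2 * j + 2)) /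
      (1 - (1 - (a + 1) * relDiff (radii R j (a + 2)) (radii R (j + 1) a)) / (a + 2 * j + 2))
termination_by j a => (j, a)

section Radii
variable {R : ℕ → ℝ}

/-- The numerator is below a+2 in absolute value. The quotient t is the relative difference
prescribed by the six-radii equation; |t| < 1 makes the factor (1+t)/(1-t) of the next radius
positive. -/
theorem radii_aux (a j : ℕ) {x : ℝ} (hx : |x| < 1) :
    |(1 - (a + 1) * x) / (a + 2 * j + 2 : ℝ)| < 1 := by
  have h : (0 : ℝ) < a + 2 * j + 2 := by positivity
  rw [abs_div, abs_of_pos h, div_lt_one h]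
  rw [abs_lt] at hx ⊢
  have ha : (0 : ℝ) ≤ a := by positivity
  have hj : (0 : ℝ) ≤ j := by positivity
  constructor <;> nlinarith

theorem radii_pos (hR : ∀ n, 0 < R (n + 1)) : ∀ j a, (j ≠ 0 ∨ a ≠ 0) → 0 < radii R j a
  | 0, 0, h => by simp at h
  | 0, a + 1, _ => by rw [radii]; exact hR a
  | j + 1, 0, _ => by rw [radii]; positivity
  | j + 1, a + 1, _ => by
    have h1 := radii_pos hR j (a + 2) (Or.inr (by omega))
    have h2 := radii_pos hR (j + 1) a (Or.inl (by omega))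
    have h3 := radii_pos hR j (a + 1) (Or.inr (by omega))
    have h4 := abs_lt.1 (radii_aux a j (abs_relDiff_lt h1 h2))
    rw [radii]
    refine div_pos (mul_pos h3 ?_) ?_ <;> linarith [h4.1, h4.2]
termination_by j a => (j, a)

theorem radii_hex (hR0 : R 0 = 0) (hR : ∀ n, 0 < R (n + 1)) (j a : ℕ) :
    a * relDiff (radii R j (a + 1)) (radii R (j + 1) (a - 1)) +
      (a + 2 * j + 1) * relDiff (radii R (j + 1) a) (radii R j a) = 1 := by
  cases a with
  | zero =>
    have : radii R j 0 = j := by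
      cases j with
      | zero => simp [radii, hR0]
      | succ j => rw [radii]; push_cast; rfl
    rw [this, radii, relDiff, relDiff]
    have : (j : ℝ) + 1 + j ≠ 0 := by positivity
    field_simp
    push_cast
    ring
  | succ a =>
    have h1 := radii_pos hR j (a + 2) (Or.inr (by omega))
    have h2 := radii_pos hR (j + 1) a (Or.inl (by omega))
    have h3 := radii_pos hR j (a + 1) (Or.inr (by omega))
    have h4 := abs_lt.1 (radii_aux a j (abs_relDiff_lt h1 h2))
    rw [Nat.add_sub_cancel, show a + 1 + 1 = a + 2 from rfl]
    have key : ((a : ℝ) + 1 + 2 * j + 1) * relDiff (radii R (j + 1) (a + 1)) (radii R j (a + 1)) =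
      1 - (a + 1) * relDiff (radii R j (a + 2)) (radii R (j + 1) a) := by
      have hk : (a : ℝ) + 2 * j + 2 ≠ 0 := by positivity
      rw [radii]
      set t := (1 - (a + 1) * relDiff (radii R j (a + 2)) (radii R (j + 1) a)) / (a + 2 * j + 2)
        with ht
      have h5 : 1 - t ≠ 0 := by linarith [h4.2]
      have h6 : relDiff (radii R j (a + 1) * (1 + t) / (1 - t)) (radii R j (a + 1)) = t := by
        generalize radii R j (a + 1) = y at *
        have : y * (1 + t) / (1 - t) + y = 2 * y / (1 - t) := by field_simp; ring
        rw [relDiff, this]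
        field_simp
        ring
      rw [h6, ht]
      field_simp
      ring
    push_cast
    linarith
end Radii

/-! ### Phases in a coordinate plane: Hirota squares and constraint by induction from the diagonal.
-/

/-- Phases of a planar pattern: `phases μ R j a` is the phase at `(a, a + 2 j + 1)`. -/
noncomputable def phases (μ : ℂ) (R : ℕ → ℝ) : ℕ → ℕ → ℂ
  | 0, 0 => μ
  -- Along the diagonal the phase comes from the Hirota square at (a, a+1), further out from the
  -- square at (a, a+2j+2).
  | 0, a + 1 => phases μ R 0 a * (μ * radii R 1 a - μ⁻¹ * R (a + 1)) /
      (μ * R (a + 1) - μ⁻¹ * radii R 1 a)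
  | j + 1, a => phases μ R j (a + 1) *
      (μ⁻¹ * radii R (j + 1) a + μ * radii R (j + 1) (a + 1)) /
      (μ * radii R (j + 1) a + μ⁻¹ * radii R (j + 1) (a + 1))

/-- The phase at `(a, a + 2 j - 1)`. -/
noncomputable def lowerPhases (μ : ℂ) (R : ℕ → ℝ) : ℕ → ℕ → ℂ
  -- The point (a, a-1) lies below the diagonal; reflection in the diagonal fixes radii and inverts
  -- phases.
  | 0, a => (phases μ R 0 (a - 1))⁻¹
  | j + 1, a => phases μ R j a

/-- Radii along the diagonal of a planar pattern satisfying the border equation. -/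
structure DiagonalData (θ : ℝ) (μ : ℂ) (R : ℕ → ℝ) : Prop where
  indep : RealIndep μ⁻¹ μ
  cos : μ ^ 2 + μ⁻¹ ^ 2 = 2 * (Real.cos θ : ℂ)
  zero : R 0 = 0
  pos : ∀ n, 0 < R (n + 1)
  border : ∀ n, BorderEq θ (R (n + 1)) (R (n + 2)) (radii R 1 n) (R n)

namespace DiagonalData
variable {θ : ℝ} {μ : ℂ} {R : ℕ → ℝ}

theorem mu_ne (h : DiagonalData θ μ R) : μ ≠ 0 := h.indep.symm.left_ne

theorem rpos (h : DiagonalData θ μ R) (j a : ℕ) : IsPos (radii R (j + 1) a) :=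
  ⟨_, radii_pos h.pos _ _ (Or.inl (by omega)), rfl⟩

theorem rpos' (h : DiagonalData θ μ R) (j a : ℕ) : IsPos (radii R j (a + 1)) :=
  ⟨_, radii_pos h.pos _ _ (Or.inr (by omega)), rfl⟩

theorem rnonneg (h : DiagonalData θ μ R) (j a : ℕ) :
    IsPos (radii R j a) ∨ (radii R j a : ℂ) = 0 := by
  cases a with
  | zero =>
    cases j with
    | zero => right; rw [radii, h.zero]; simp
    | succ j => exact Or.inl (h.rpos j _)
  | succ a => exact Or.inl (h.rpos' j _)

theorem comb_ne (h : DiagonalData θ μ R) {x y : ℝ} (hy : 0 < x ∨ 0 < y) :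
    μ⁻¹ * x + μ * y ≠ 0 := fun e => by
  have := h.indep x y e
  rcases hy with h | h <;> linarith [this.1, this.2]

theorem phases_ne (h : DiagonalData θ μ R) : ∀ j a, phases μ R j a ≠ 0
  | 0, 0 => by rw [phases]; exact h.mu_ne
  | 0, a + 1 => by
    rw [phases]
    have h1 := radii_pos h.pos 1 a (Or.inl one_ne_zero)
    have h2 := h.pos a
    refine div_ne_zero (mul_ne_zero (h.phases_ne 0 a) fun e => ?_) fun e => ?_
    · have := h.indep (-R (a + 1)) (radii R 1 a) (by push_cast; linear_combination e)
      linarith [this.2]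
    · have := h.indep (-radii R 1 a) (R (a + 1)) (by push_cast; linear_combination e)
      linarith [this.2]
  | j + 1, a => by
    rw [phases]
    have h1 := radii_pos h.pos (j + 1) a (Or.inl (by omega))
    refine div_ne_zero (mul_ne_zero (h.phases_ne j _) (h.comb_ne (Or.inl h1))) ?_
    rw [add_comm]
    exact h.comb_ne (Or.inr h1)

theorem lowerPhases_ne (h : DiagonalData θ μ R) (j a : ℕ) : lowerPhases μ R j a ≠ 0 := by
  cases j
  · exact inv_ne_zero (h.phases_ne _ _)
  · exact h.phases_ne _ _

theorem hirota_odd_zero (h : DiagonalData θ μ R) (a : ℕ) :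
    Hirota μ⁻¹ μ (phases μ R 0 a) (radii R 0 (a + 1)) (radii R 1 a) (phases μ R 0 (a + 1)) := by
  have h1 : μ * R (a + 1) - μ⁻¹ * radii R 1 a ≠ 0 := fun e => by
    have := h.indep (-radii R 1 a) (R (a + 1)) (by push_cast; linear_combination e)
    linarith [this.2, h.pos a]
  rw [phases, Hirota]
  simp only [radii.eq_1]
  have e : phases μ R 0 a * (μ * radii R 1 a - μ⁻¹ * R (a + 1)) /
      (μ * R (a + 1) - μ⁻¹ * radii R 1 a) * (μ * R (a + 1) - μ⁻¹ * radii R 1 a) =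
      phases μ R 0 a * (μ * radii R 1 a - μ⁻¹ * R (a + 1)) := div_mul_cancel₀ _ h1
  linear_combination -e

theorem quad_odd_zero (h : DiagonalData θ μ R) (a : ℕ) :
    Quad μ⁻¹ μ (phases μ R 0 a) (radii R 0 (a + 1)) (radii R 1 a) (phases μ R 0 (a + 1)) :=
  ⟨h.hirota_odd_zero a, Or.inr ⟨h.phases_ne _ _, h.phases_ne _ _, h.rpos' _ _, h.rpos _ _⟩⟩

/-- The border equation enters here. By the reflection symmetry a diagonal square prescribes the
square of a phase, and the border equation makes this prescription compatible with the recursion for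
the phases. -/
theorem hirota_even_zero (h : DiagonalData θ μ R) (a : ℕ) :
    Hirota μ⁻¹ μ (radii R 0 a) (lowerPhases μ R 0 (a + 1)) (phases μ R 0 a)
      (radii R 0 (a + 1)) := by
  have hμ := h.mu_ne
  have hx := h.phases_ne 0
  simp only [lowerPhases, Nat.add_sub_cancel, Hirota, radii.eq_1]
  suffices H : phases μ R 0 a ^ 2 * (μ * R a + μ⁻¹ * R (a + 1)) = μ⁻¹ * R a + μ * R (a + 1) by
    have := hx a
    field_simp at H ⊢
    linear_combination H
  induction a with
  | zero =>
    rw [phases, h.zero]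
    field_simp
    simp
  | succ a ih =>
    have h1 : μ * R (a + 1) - μ⁻¹ * radii R 1 a ≠ 0 := fun e => by
      have := h.indep (-radii R 1 a) (R (a + 1)) (by push_cast; linear_combination e)
      linarith [this.2, h.pos a]
    have h2 : μ * R a + μ⁻¹ * R (a + 1) ≠ 0 := by
      rw [add_comm]; exact h.comb_ne (Or.inl (h.pos a))
    have hb := h.border a
    unfold BorderEq at hb
    have hb' := congrArg ((↑) : ℝ → ℂ) hb
    push_cast at hb'
    have e : phases μ R 0 (a + 1) * (μ * R (a + 1) - μ⁻¹ * radii R 1 a) =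
      phases μ R 0 a * (μ * radii R 1 a - μ⁻¹ * R (a + 1)) := by
      rw [phases]; exact div_mul_cancel₀ _ h1
    have hc := h.cos
    rw [Complex.ofReal_cos] at hc
    have hi : μ * μ⁻¹ = 1 := mul_inv_cancel₀ hμ
    refine mul_left_cancel₀ (mul_ne_zero (pow_ne_zero 2 h1) h2) ?_
    generalize μ⁻¹ = ν at *
    generalize Complex.cos (θ : ℂ) = c at *
    generalize phases μ R 0 (a + 1) = y at *
    generalize phases μ R 0 a = x at *
    linear_combination (y * (μ * R (a + 1) - ν * radii R 1 a) +
        x * (μ * radii R 1 a - ν * R (a + 1))) * (μ * R a + ν * R (a + 1)) *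
        (μ * R (a + 1) + ν * R (a + 2)) * e +
      (μ * radii R 1 a - ν * R (a + 1)) ^ 2 * (μ * R (a + 1) + ν * R (a + 2)) * ih -
      R (a + 1) * (μ ^ 2 - ν ^ 2) / 2 * (2 * hb' +
        (2 * (R (a + 2) + radii R 1 a) * (R (a + 1) ^ 2 - radii R 1 a * R a) +
          2 * (R a + radii R 1 a) * (R (a + 1) ^ 2 - radii R 1 a * R (a + 2))) * hi +
        ((R (a + 2) + radii R 1 a) * R (a + 1) * (R a - radii R 1 a) +
          (R a + radii R 1 a) * R (a + 1) * (R (a + 2) - radii R 1 a)) * hc)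

theorem quad_even (h : DiagonalData θ μ R) (j a : ℕ) :
    Quad μ⁻¹ μ (radii R j a) (lowerPhases μ R j (a + 1)) (phases μ R j a)
      (radii R j (a + 1)) := by
  refine ⟨?_, Or.inl ⟨h.rnonneg _ _, h.rpos' _ _, h.lowerPhases_ne _ _, h.phases_ne _ _⟩⟩
  cases j with
  | zero => exact h.hirota_even_zero a
  | succ j =>
    have h1 : μ * radii R (j + 1) a + μ⁻¹ * radii R (j + 1) (a + 1) ≠ 0 := by
      rw [add_comm]; exact h.comb_ne (Or.inl (radii_pos h.pos _ _ (Or.inl (by omega))))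
    rw [lowerPhases, phases, Hirota, div_mul_cancel₀ _ h1]

/-- The constraint on phases at `(a, a + 2 j)`. -/
def EvenConstraint (μ : ℂ) (R : ℕ → ℝ) (j : ℕ) : Prop := ∀ a : ℕ,
  (a : ℂ) * relDiff (lowerPhases μ R j (a + 1)) (phases μ R j (a - 1)) +
    (a + 2 * j) * relDiff (phases μ R j a) (lowerPhases μ R j a) = 0

/-- The Hirota equation on the quadrilateral with corner `(a, a + 2 j + 1)`. -/
def OddQuads (μ : ℂ) (R : ℕ → ℝ) (j : ℕ) : Prop := ∀ a : ℕ,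
  Quad μ⁻¹ μ (phases μ R j a) (radii R j (a + 1)) (radii R (j + 1) a) (phases μ R j (a + 1))

theorem hex (h : DiagonalData θ μ R) (j a : ℕ) :
    (a : ℂ) * relDiff (radii R j (a + 1) : ℂ) (radii R (j + 1) (a - 1)) +
      (a + 2 * j + 1) * relDiff (radii R (j + 1) a : ℂ) (radii R j a) = 1 := by
  have := radii_hex h.zero h.pos j a
  unfold relDiff at *
  exact_mod_cast this

/-- On the diagonal the two weights agree and reflection inverts the phases, so the two terms
cancel. -/
theorem evenConstraint_zero (h : DiagonalData θ μ R) : EvenConstraint μ R 0 := by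
  intro a
  cases a with
  | zero => simp
  | succ a =>
    have h1 := h.phases_ne 0 a
    have h2 := h.phases_ne 0 (a + 1)
    simp only [lowerPhases, Nat.add_sub_cancel, relDiff]
    have e1 : ((phases μ R 0 (a + 1))⁻¹ - phases μ R 0 a) / ((phases μ R 0 (a + 1))⁻¹ + phases μ R 0 a) =
      (1 - phases μ R 0 (a + 1) * phases μ R 0 a) / (1 + phases μ R 0 (a + 1) * phases μ R 0 a) := by
      rw [← mul_div_mul_left _ _ h2]; congr 1 <;> field_simp
    have e2 : (phases μ R 0 (a + 1) - (phases μ R 0 a)⁻¹) / (phases μ R 0 (a + 1) + (phases μ R 0 a)⁻¹) =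
      (phases μ R 0 (a + 1) * phases μ R 0 a - 1) / (phases μ R 0 (a + 1) * phases μ R 0 a + 1) := by
      rw [← mul_div_mul_right _ _ h1]; congr 1 <;> field_simp
    rw [e1, e2, add_comm (1 : ℂ)]
    push_cast
    ring

/-- In the square at the odd point (a, a+2j+1) the constraint is known at three corners; since
`facP` is nonzero, the linearised equation yields it at the fourth, (a, a+2j+2). -/
theorem evenConstraint_succ (h : DiagonalData θ μ R) {j : ℕ} (ho : OddQuads μ R j)
    (he : EvenConstraint μ R j) : EvenConstraint μ R (j + 1) := by
  intro a
  have hi := h.indep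
  have hq := ho a
  have h0 := h.phases_ne j a
  have hE := h.quad_even
  have U1 := hq.up₁ (hE j (a + 1)) hi (Or.inl ⟨h.rpos' _ _, h.rpos _ _⟩)
  have U2 := hq.up₂ (hE (j + 1) a).swap hi (Or.inl ⟨h.rpos _ _, h.rpos' _ _⟩)
  have L2 := hq.low₂ (hE j a).swap hi h0 (Or.inr ⟨h.rpos _ _, h.rnonneg _ _⟩)
  have L1 : (a : ℂ) * ((μ⁻¹ ^ 2 - μ ^ 2) * (relDiff (phases μ R j (a + 1)) (phases μ R (j + 1) (a - 1)) *
      facP μ⁻¹ μ (phases μ R j a) (radii R (j + 1) a) (phases μ R j (a + 1)) +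
        relDiff (radii R j (a + 1) : ℂ) (radii R (j + 1) (a - 1)) *
      facQ μ⁻¹ μ (phases μ R j a) (radii R j (a + 1)) (radii R (j + 1) a))) =
      a * cellE μ⁻¹ μ (phases μ R j a) (radii R j (a + 1)) (radii R (j + 1) a) (phases μ R j (a + 1)) := by
    cases a with
    | zero => simp
    | succ a =>
      congr 1
      exact hq.low₁ (hE (j + 1) a) hi h0 (Or.inr ⟨h.rpos' _ _, Or.inl (h.rpos _ _)⟩)
  have F0 := h.hex j a
  have F1 := he (a + 1)
  have F12 := h.hex j (a + 1)
  simp only [Nat.add_sub_cancel] at F1 F12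
  push_cast at F1 F12
  refine mul_left_cancel₀ (mul_ne_zero hi.sq_sub_ne (hq.facP_ne hi)) ?_
  simp only [lowerPhases]
  push_cast
  linear_combination L1 - (a + 1) * U1 + (a + 2 * j + 2) * U2 - (a + 2 * j + 1) * L2 +
    (μ⁻¹ ^ 2 - μ ^ 2) * facP μ⁻¹ μ (phases μ R j a) (radii R (j + 1) a) (phases μ R j (a + 1)) * F1 +
    (μ⁻¹ ^ 2 - μ ^ 2) * facQ μ⁻¹ μ (phases μ R j a) (radii R j (a + 1)) (radii R (j + 1) a) *
      (F12 - F0)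

/-- In the square at (a, a+2j+2) the constraint now holds at all four corners, so the linearised
equation is used backwards: it supplies the one missing square identity, and `hirota_of_up₂` turns
that into the next odd square. -/
theorem oddQuads_succ (h : DiagonalData θ μ R) {j : ℕ} (ho : OddQuads μ R j)
    (he : EvenConstraint μ R (j + 1)) : OddQuads μ R (j + 1) := by
  intro a
  have hi := h.indep
  have hE := h.quad_even
  -- The identity in the first direction needs the odd square at a-1, hence an inner induction on a;
  -- for a = 0 its weight is zero.
  have aux (a : ℕ) (hprev : ∀ b, a = b + 1 → Quad μ⁻¹ μ (phases μ R (j + 1) b)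
      (radii R (j + 1) (b + 1)) (radii R (j + 1 + 1) b) (phases μ R (j + 1) (b + 1))) :
      Quad μ⁻¹ μ (phases μ R (j + 1) a) (radii R (j + 1) (a + 1)) (radii R (j + 1 + 1) a)
        (phases μ R (j + 1) (a + 1)) := by
    have hq := hE (j + 1) a
    have h0 := (h.rpos j a).ne_zero
    have U1 := hq.up₁ (ho (a + 1)) hi (Or.inr ⟨h.rpos' _ _, Or.inl (h.rpos _ _)⟩)
    have L2 := hq.low₂ (ho a).swap hi h0 (Or.inl ⟨h.rpos _ _, h.rpos' _ _⟩)
    have L1 : (a : ℂ) * ((μ⁻¹ ^ 2 - μ ^ 2) * (relDiff (radii R (j + 1) (a + 1) : ℂ)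
          (radii R (j + 1 + 1) (a - 1)) *
        facP μ⁻¹ μ (radii R (j + 1) a) (phases μ R (j + 1) a) (radii R (j + 1) (a + 1)) +
          relDiff (lowerPhases μ R (j + 1) (a + 1)) (phases μ R (j + 1) (a - 1)) *
        facQ μ⁻¹ μ (radii R (j + 1) a) (lowerPhases μ R (j + 1) (a + 1)) (phases μ R (j + 1) a))) =
        a * cellE μ⁻¹ μ (radii R (j + 1) a) (lowerPhases μ R (j + 1) (a + 1))
          (phases μ R (j + 1) a) (radii R (j + 1) (a + 1)) := by
      cases a with
      | zero => simp
      | succ a =>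
        congr 1
        exact hq.low₁ (hprev a rfl) hi h0 (Or.inl ⟨h.rpos _ _, h.rpos _ _⟩)
    have F0 := he a
    have F1 := h.hex j (a + 1)
    have F2 := h.hex (j + 1) a
    have F12 := he (a + 1)
    simp only [Nat.add_sub_cancel] at F1 F12
    push_cast at F0 F1 F2 F12
    refine ⟨(hq.hirota_of_up₂ hi ((h.rpos _ _).add (Or.inl (h.rpos _ _))).ne_zero
      ((hE (j + 1) (a + 1)).swap.sum_ne (ho (a + 1)).swap hi.symm (h.rpos _ _).ne_zero
        (Or.inl ⟨h.rpos _ _, h.rpos' _ _⟩)).1 h0 ?_).swap,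
      Or.inr ⟨h.phases_ne _ _, h.phases_ne _ _, h.rpos _ _, h.rpos _ _⟩⟩
    have hk : (a : ℂ) + 2 * j + 3 ≠ 0 := by exact_mod_cast (by omega : a + 2 * j + 3 ≠ 0)
    refine mul_left_cancel₀ hk ?_
    simp only [lowerPhases] at *
    linear_combination -L1 + (a + 1) * U1 + (a + 2 * j + 2) * L2 +
      (μ⁻¹ ^ 2 - μ ^ 2) * facP μ⁻¹ μ (radii R (j + 1) a) (phases μ R (j + 1) a)
        (radii R (j + 1) (a + 1)) * (F2 - F1) -
      (μ⁻¹ ^ 2 - μ ^ 2) * facQ μ⁻¹ μ (radii R (j + 1) a) (phases μ R j (a + 1))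
        (phases μ R (j + 1) a) * (F12 - F0)
  induction a with
  | zero => exact aux 0 fun b hb => by omega
  | succ a ih =>
    exact aux (a + 1) fun b hb => by
      obtain rfl : a = b := by omega
      exact ih

theorem constraint_and_quads (h : DiagonalData θ μ R) (j : ℕ) :
    EvenConstraint μ R j ∧ OddQuads μ R j := by
  induction j with
  | zero => exact ⟨h.evenConstraint_zero, h.quad_odd_zero⟩
  | succ j ih =>
    have := h.evenConstraint_succ ih.2 ih.1
    exact ⟨this, h.oddQuads_succ ih.2 this⟩

/-- On the axis the constraint has a single term, so consecutive phases are equal. -/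
theorem phases_axis (h : DiagonalData θ μ R) (j : ℕ) : phases μ R j 0 = μ := by
  induction j with
  | zero => rw [phases]
  | succ j ih =>
    have h1 := (h.constraint_and_quads (j + 1)).1 0
    have h2 := ((h.quad_even (j + 1) 0).swap.sum_ne ((h.constraint_and_quads j).2 0).swap
      h.indep.symm (h.rpos _ _).ne_zero (Or.inl ⟨h.rpos _ _, h.rpos' _ _⟩)).1
    have hk : (2 : ℂ) * (j + 1) ≠ 0 := by exact_mod_cast (by omega : 2 * (j + 1) ≠ 0)
    push_cast at h1
    rw [zero_mul, zero_add, zero_add, mul_eq_zero, or_iff_right hk, relDiff, lowerPhases,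
      div_eq_zero_iff, or_iff_left h2] at h1
    exact (sub_eq_zero.1 h1).trans ih

end DiagonalData

/-! ### The whole quarter plane, by reflection in the diagonal. -/

/-- The full planar pattern: radii at even points, phases (normalized to be `1` on the second
axis) at odd points. -/
noncomputable def plane (μ : ℂ) (R : ℕ → ℝ) (a c : ℕ) : ℂ :=
  if a ≤ c then
    if Even (a + c) then radii R ((c - a) / 2) a else μ⁻¹ * phases μ R ((c - a) / 2) a
  else if Even (a + c) then radii R ((a - c) / 2) c else μ⁻¹ * (phases μ R ((a - c) / 2) c)⁻¹

section Plane
variable (μ : ℂ) (R : ℕ → ℝ) (a j : ℕ)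

theorem plane_even_right : plane μ R a (a + 2 * j) = radii R j a := by
  rw [plane, if_pos (by omega), if_pos ⟨a + j, by ring⟩]
  congr 2; omega

theorem plane_odd_right : plane μ R a (a + 2 * j + 1) = μ⁻¹ * phases μ R j a := by
  rw [plane, if_pos (by omega), if_neg]
  · congr 2; omega
  · rw [Nat.not_even_iff_odd]; exact ⟨a + j, by ring⟩

theorem plane_even_left : plane μ R (a + 2 * j) a = radii R j a := by
  rcases Nat.eq_zero_or_pos j with rfl | hj
  · exact plane_even_right μ R a 0
  rw [plane, if_neg (by omega), if_pos ⟨a + j, by ring⟩]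
  congr 2; omega

theorem plane_odd_left : plane μ R (a + 2 * j + 1) a = μ⁻¹ * (phases μ R j a)⁻¹ := by
  rw [plane, if_neg (by omega), if_neg]
  · congr 3; omega
  · rw [Nat.not_even_iff_odd]; exact ⟨a + j, by ring⟩

theorem plane_lower_right : plane μ R (a + 1) (a + 2 * j) = μ⁻¹ * lowerPhases μ R j (a + 1) := by
  cases j with
  | zero => exact plane_odd_left μ R a 0
  | succ j =>
    rw [show a + 2 * (j + 1) = (a + 1) + 2 * j + 1 by ring, plane_odd_right, lowerPhases]

theorem plane_lower_left : plane μ R (a + 2 * j) (a + 1) =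
    μ⁻¹ * (lowerPhases μ R j (a + 1))⁻¹ := by
  cases j with
  | zero => rw [lowerPhases, inv_inv]; exact plane_odd_right μ R a 0
  | succ j =>
    rw [show a + 2 * (j + 1) = (a + 1) + 2 * j + 1 by ring, plane_odd_left, lowerPhases]

theorem plane_lower_right' (h : 0 < a + j) : plane μ R a (a + 2 * j - 1) =
    μ⁻¹ * lowerPhases μ R j a := by
  cases j with
  | zero =>
    obtain ⟨a, rfl⟩ := Nat.exists_eq_add_of_lt h
    simp only [zero_add, Nat.add_zero] at *
    exact plane_lower_right μ R a 0
  | succ j => exact plane_odd_right μ R a j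

theorem plane_lower_left' (h : 0 < a + j) : plane μ R (a + 2 * j - 1) a =
    μ⁻¹ * (lowerPhases μ R j a)⁻¹ := by
  cases j with
  | zero =>
    obtain ⟨a, rfl⟩ := Nat.exists_eq_add_of_lt h
    simp only [zero_add, Nat.add_zero] at *
    exact plane_lower_left μ R a 0
  | succ j => exact plane_odd_left μ R a j

theorem radii_zero (h : R 0 = 0) : radii R j 0 = j := by
  cases j with
  | zero => simp [radii, h]
  | succ j => rw [radii]; push_cast; rfl

end Plane

theorem exists_offset (a c : ℕ) : ∃ k j, (a = k ∧ c = k + 2 * j) ∨ (a = k ∧ c = k + 2 * j + 1) ∨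
    (a = k + 2 * j ∧ c = k) ∨ (a = k + 2 * j + 1 ∧ c = k) := by
  rcases le_total a c with h | h
  · obtain ⟨d, rfl⟩ := Nat.exists_eq_add_of_le h
    rcases Nat.even_or_odd' d with ⟨j, rfl | rfl⟩
    exacts [⟨a, j, Or.inl ⟨rfl, rfl⟩⟩, ⟨a, j, Or.inr (Or.inl ⟨rfl, rfl⟩)⟩]
  · obtain ⟨d, rfl⟩ := Nat.exists_eq_add_of_le h
    rcases Nat.even_or_odd' d with ⟨j, rfl | rfl⟩
    exacts [⟨c, j, Or.inr (Or.inr (Or.inl ⟨rfl, rfl⟩))⟩, ⟨c, j, Or.inr (Or.inr (Or.inr ⟨rfl, rfl⟩))⟩]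

/-- A planar pattern with directions `m` and `1`. -/
structure PlanePattern (m : ℂ) (w : ℕ → ℕ → ℂ) : Prop where
  origin : w 0 0 = 0
  pos : ∀ a c, Even (a + c) → a + c ≠ 0 → IsPos (w a c)
  ne : ∀ a c, ¬ Even (a + c) → w a c ≠ 0
  hirota : ∀ a c, Hirota m 1 (w a c) (w (a + 1) c) (w a (c + 1)) (w (a + 1) (c + 1))
  constraint : ∀ a c : ℕ, (a : ℂ) * relDiff (w (a + 1) c) (w (a - 1) c) +
    c * relDiff (w a (c + 1)) (w a (c - 1)) = if Even (a + c) then 0 else 1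
  axis₁ : ∀ k, w (2 * k) 0 = k
  axis₂ : ∀ k, w 0 (2 * k) = k
  axis₁' : ∀ k, w (2 * k + 1) 0 = m
  axis₂' : ∀ k, w 0 (2 * k + 1) = 1

theorem relDiff_mul {k : ℂ} (hk : k ≠ 0) (x y : ℂ) : relDiff (k * x) (k * y) = relDiff x y := by
  rw [relDiff, relDiff, ← mul_sub, ← mul_add, mul_div_mul_left _ _ hk]

theorem relDiff_inv {x y : ℂ} (hx : x ≠ 0) (hy : y ≠ 0) : relDiff x⁻¹ y⁻¹ = - relDiff x y := by
  rw [relDiff, relDiff, ← mul_div_mul_left _ _ (mul_ne_zero hx hy), ← neg_div]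
  congr 1
  · field_simp; ring
  · field_simp; ring

theorem DiagonalData.planePattern {θ : ℝ} {μ : ℂ} {R : ℕ → ℝ} (h : DiagonalData θ μ R) :
    PlanePattern (μ⁻¹ ^ 2) (plane μ R) where
  origin := by rw [plane_even_right μ R 0 0, radii, h.zero]; simp
  pos a c he h0 := by
    obtain ⟨k, j, ⟨rfl, rfl⟩ | ⟨rfl, rfl⟩ | ⟨rfl, rfl⟩ | ⟨rfl, rfl⟩⟩ := exists_offset a c
    · rw [plane_even_right]
      exact ⟨_, radii_pos h.pos _ _ (by omega), rfl⟩
    · exact absurd he (by rw [Nat.not_even_iff_odd]; exact ⟨a + j, by ring⟩)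
    · rw [plane_even_left]
      exact ⟨_, radii_pos h.pos _ _ (by omega), rfl⟩
    · exact absurd he (by rw [Nat.not_even_iff_odd]; exact ⟨c + j, by ring⟩)
  ne a c he := by
    have hμ := inv_ne_zero h.mu_ne
    obtain ⟨k, j, ⟨rfl, rfl⟩ | ⟨rfl, rfl⟩ | ⟨rfl, rfl⟩ | ⟨rfl, rfl⟩⟩ := exists_offset a c
    · exact absurd ⟨a + j, by ring⟩ he
    · rw [plane_odd_right]; exact mul_ne_zero hμ (h.phases_ne _ _)
    · exact absurd ⟨c + j, by ring⟩ he
    · rw [plane_odd_left]; exact mul_ne_zero hμ (inv_ne_zero (h.phases_ne _ _))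
  hirota a c := by
    have hμ := h.mu_ne
    have hp := h.phases_ne
    have hl := h.lowerPhases_ne
    obtain ⟨k, j, ⟨rfl, rfl⟩ | ⟨rfl, rfl⟩ | ⟨rfl, rfl⟩ | ⟨rfl, rfl⟩⟩ := exists_offset a c
    · have e := (h.quad_even j a).hirota
      rw [plane_even_right, plane_lower_right, plane_odd_right,
        show a + 2 * j + 1 = (a + 1) + 2 * j by ring, plane_even_right]
      unfold Hirota at e ⊢
      field_simp at e ⊢
      linear_combination e
    · have e := ((h.constraint_and_quads j).2 a).hirota
      rw [plane_odd_right, show a + 2 * j + 1 = (a + 1) + 2 * j by ring, plane_even_right,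
        show a + 1 + 2 * j + 1 = a + 2 * (j + 1) by ring, plane_even_right,
        show a + 2 * (j + 1) = (a + 1) + 2 * j + 1 by ring, plane_odd_right]
      unfold Hirota at e ⊢
      field_simp at e ⊢
      linear_combination e
    · have e := (h.quad_even j c).hirota
      rw [plane_even_left, plane_lower_left, plane_odd_left,
        show c + 2 * j + 1 = (c + 1) + 2 * j by ring, plane_even_left]
      have h1 := hp j c
      have h2 := hl j (c + 1)
      unfold Hirota at e ⊢
      field_simp at e ⊢
      linear_combination e
    · have e := ((h.constraint_and_quads j).2 c).hirota
      rw [plane_odd_left, show c + 2 * j + 1 = (c + 1) + 2 * j by ring, plane_even_left,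
        show c + 1 + 2 * j + 1 = c + 2 * (j + 1) by ring, plane_even_left,
        show c + 2 * (j + 1) = (c + 1) + 2 * j + 1 by ring, plane_odd_left]
      have h1 := hp j c
      have h2 := hp j (c + 1)
      unfold Hirota at e ⊢
      field_simp at e ⊢
      linear_combination -e
  constraint a c := by
    have hμ := inv_ne_zero h.mu_ne
    have hp := h.phases_ne
    have hl := h.lowerPhases_ne
    obtain ⟨k, j, ⟨rfl, rfl⟩ | ⟨rfl, rfl⟩ | ⟨rfl, rfl⟩ | ⟨rfl, rfl⟩⟩ := exists_offset a c
    · rw [if_pos ⟨a + j, by ring⟩, ← (h.constraint_and_quads j).1 a]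
      congr 1
      · rw [plane_lower_right]
        cases a with
        | zero => simp
        | succ a =>
          rw [Nat.add_sub_cancel, show a + 1 + 2 * j = a + 2 * j + 1 by ring, plane_odd_right,
            relDiff_mul hμ]
      · rw [plane_odd_right]
        rcases Nat.eq_zero_or_pos (a + j) with h0 | h0
        · obtain ⟨rfl, rfl⟩ : a = 0 ∧ j = 0 := by omega
          simp
        · rw [plane_lower_right' _ _ _ _ h0, relDiff_mul hμ]
          push_cast; rfl
    · rw [if_neg (by rw [Nat.not_even_iff_odd]; exact ⟨a + j, by ring⟩), ← h.hex j a]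
      congr 1
      · rw [show a + 2 * j + 1 = (a + 1) + 2 * j by ring, plane_even_right]
        cases a with
        | zero => simp
        | succ a =>
          rw [Nat.add_sub_cancel, show a + 1 + 1 + 2 * j = a + 2 * (j + 1) by ring,
            plane_even_right]
      · rw [show a + 2 * j + 1 + 1 = a + 2 * (j + 1) by ring, plane_even_right,
          Nat.add_sub_cancel, plane_even_right]
        push_cast; rfl
    · rw [if_pos ⟨c + j, by ring⟩, ← neg_zero, ← (h.constraint_and_quads j).1 c, neg_add, add_comm]
      congr 1
      · rw [plane_lower_left]
        cases c with
        | zero => simp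
        | succ c =>
          rw [Nat.add_sub_cancel, show c + 1 + 2 * j = c + 2 * j + 1 by ring, plane_odd_left,
            relDiff_mul hμ, relDiff_inv (hl _ _) (hp _ _), mul_neg]
      · rw [plane_odd_left]
        rcases Nat.eq_zero_or_pos (c + j) with h0 | h0
        · obtain ⟨rfl, rfl⟩ : c = 0 ∧ j = 0 := by omega
          simp
        · rw [plane_lower_left' _ _ _ _ h0, relDiff_mul hμ, relDiff_inv (hp _ _) (hl _ _)]
          push_cast; ring
    · rw [if_neg (by rw [Nat.not_even_iff_odd]; exact ⟨c + j, by ring⟩), ← h.hex j c, add_comm]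
      congr 1
      · rw [show c + 2 * j + 1 = (c + 1) + 2 * j by ring, plane_even_left]
        cases c with
        | zero => simp
        | succ c =>
          rw [Nat.add_sub_cancel, show c + 1 + 1 + 2 * j = c + 2 * (j + 1) by ring,
            plane_even_left]
      · rw [show c + 2 * j + 1 + 1 = c + 2 * (j + 1) by ring, plane_even_left,
          Nat.add_sub_cancel, plane_even_left]
        push_cast; rfl
  axis₁ k := by
    have := plane_even_left μ R 0 k
    rw [zero_add] at this
    rw [this, radii_zero _ _ h.zero]
    simp
  axis₂ k := by
    have := plane_even_right μ R 0 k
    rw [zero_add] at this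
    rw [this, radii_zero _ _ h.zero]
    simp
  axis₁' k := by
    have := plane_odd_left μ R 0 k
    rw [zero_add] at this
    rw [this, h.phases_axis, sq]
  axis₂' k := by
    have := plane_odd_right μ R 0 k
    rw [zero_add] at this
    rw [this, h.phases_axis, inv_mul_cancel₀ h.mu_ne]


/-! ### Three-dimensional consistency and the pattern on ℕ³. -/

section CubeAlgebra
variable {m n w₀ w₁ w₂ w₃ w₁₂ w₁₃ w₂₃ w₁₂₃ : ℂ}

/-- The relation between the four alternate corners of a cube containing the lowest one, for
directions `m`, `n` and `1`. -/
def CubeRel (m n w₀ w₁₂ w₁₃ w₂₃ : ℂ) : Prop :=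
  n * (1 - m ^ 2) * (w₁₂ * w₂₃ - w₀ * w₁₃) + (n ^ 2 - m ^ 2) * (w₁₂ * w₀ - w₁₃ * w₂₃) +
    m * (n ^ 2 - 1) * (w₁₂ * w₁₃ - w₀ * w₂₃) = 0

theorem CubeRel.swap (h : CubeRel m n w₀ w₁₂ w₁₃ w₂₃) : CubeRel n m w₀ w₁₂ w₂₃ w₁₃ := by
  unfold CubeRel at *
  linear_combination -h

theorem CubeRel.of_faces (h₁₃ : Hirota m 1 w₀ w₁ w₃ w₁₃) (h₂₃ : Hirota n 1 w₀ w₂ w₃ w₂₃)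
    (h₁₂ : Hirota m n w₀ w₁ w₂ w₁₂) (h₀ : w₀ ≠ 0) (h₃ : w₃ ≠ 0) (h₂ : w₂ ≠ 0) :
    CubeRel m n w₀ w₁₂ w₁₃ w₂₃ := by
  unfold Hirota CubeRel at *
  refine mul_left_cancel₀ (mul_ne_zero (mul_ne_zero h₀ h₃) h₂) ?_
  linear_combination w₂ * (n * w₀ + w₂₃) * (m * w₀ + n * w₁₂) * h₁₃ -
    w₁ * (m * w₀ + w₁₃) * (m * w₀ + n * w₁₂) * h₂₃ - (m * w₀ + w₁₃) * w₃ * (w₀ + n * w₂₃) * h₁₂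

theorem CubeRel.hirota_bottom (h : CubeRel m n w₀ w₁₂ w₁₃ w₂₃) (h₁₃ : Hirota m 1 w₀ w₁ w₃ w₁₃)
    (h₂₃ : Hirota n 1 w₀ w₂ w₃ w₂₃) (h₃ : w₃ ≠ 0) (hA : m * w₀ + w₁₃ ≠ 0)
    (hB : w₀ + n * w₂₃ ≠ 0) : Hirota m n w₀ w₁ w₂ w₁₂ := by
  unfold Hirota CubeRel at *
  refine mul_left_cancel₀ (mul_ne_zero (mul_ne_zero hA h₃) hB) ?_
  linear_combination w₂ * (n * w₀ + w₂₃) * (m * w₀ + n * w₁₂) * h₁₃ -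
    w₁ * (m * w₀ + w₁₃) * (m * w₀ + n * w₁₂) * h₂₃ - w₀ * w₃ * w₂ * h

/-- Consistency around the cube: the value `w₁₂₃` defined by the top face also satisfies the side
face through `w₂`. -/
theorem CubeRel.hirota_side (h : CubeRel m n w₀ w₁₂ w₁₃ w₂₃) (h₂₃ : Hirota n 1 w₀ w₂ w₃ w₂₃)
    (h₁₂ : Hirota m n w₃ w₁₃ w₂₃ w₁₂₃) (hG : m * w₂₃ - n * w₁₃ ≠ 0) (hB : n * w₀ + w₂₃ ≠ 0) :
    Hirota m 1 w₂ w₁₂ w₂₃ w₁₂₃ := by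
  unfold Hirota CubeRel at *
  refine mul_left_cancel₀ (mul_ne_zero hG hB) ?_
  linear_combination w₃ * w₂₃ * h - (m * w₂₃ - n * w₁₃) * (w₂₃ - m * w₁₂) * h₂₃ +
    (n * w₀ + w₂₃) * (m * w₂₃ - w₁₂) * h₁₂

/-- The relation between the other four corners. -/
theorem cubeRel_upper (h₁₃ : Hirota m 1 w₀ w₁ w₃ w₁₃) (h₂₃ : Hirota n 1 w₀ w₂ w₃ w₂₃)
    (h₁₂ : Hirota m n w₃ w₁₃ w₂₃ w₁₂₃) (h₀ : w₀ ≠ 0) (h₃ : w₃ ≠ 0) :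
    n * (1 - m ^ 2) * (w₁₂₃ * w₂ - w₁ * w₃) + (n ^ 2 - m ^ 2) * (w₁ * w₂ - w₃ * w₁₂₃) +
      m * (n ^ 2 - 1) * (w₁₂₃ * w₁ - w₂ * w₃) = 0 := by
  unfold Hirota at h₁₃ h₂₃ h₁₂
  refine mul_left_cancel₀ (mul_ne_zero h₀ h₃) ?_
  linear_combination (m * w₃ - w₁) * (n * w₃ + m * w₁₂₃) * h₂₃ -
    (n * w₃ - w₂) * (m * w₃ + n * w₁₂₃) * h₁₃ - (m * w₃ - w₁) * (n * w₃ - w₂) * h₁₂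

end CubeAlgebra

section Space
variable (m₁ m₂ : ℂ) (s₁ s₂ s₃ : ℝ) (u v : ℕ → ℕ → ℂ)

/-- The pattern on `ℕ³` with given values on two coordinate planes. -/
noncomputable def space : ℕ → ℕ → ℕ → ℂ
  | 0, b, c => v b c
  | a + 1, 0, c => u (a + 1) c
  | a + 1, b + 1, c =>
    -- At a radius this is `CubeRel` solved for the new corner, with positive coefficients; at a
    -- phase it is the horizontal Hirota equation. Only smaller a+b occurs, though c may increase.
    if Even (a + b + c) then
      (s₃ * space a b c * space (a + 1) b (c + 1) +
        s₁ * space (a + 1) b (c + 1) * space a (b + 1) (c + 1) +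
        s₂ * space a b c * space a (b + 1) (c + 1)) /
      (s₃ * space a (b + 1) (c + 1) + s₁ * space a b c + s₂ * space (a + 1) b (c + 1))
    else
      space a b c * (m₂ * space a (b + 1) c - m₁ * space (a + 1) b c) /
        (m₂ * space (a + 1) b c - m₁ * space a (b + 1) c)
termination_by a b _ => a + b

/-- Compatible planar patterns in directions `(m₁, 1)` and `(m₂, 1)`. -/
structure SpaceData : Prop where
  left : PlanePattern m₁ u
  right : PlanePattern m₂ v
  indep₁₂ : RealIndep m₁ m₂
  indep₁₃ : RealIndep m₁ 1
  indep₂₃ : RealIndep m₂ 1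
  pos₁ : 0 < s₁
  pos₂ : 0 < s₂
  pos₃ : 0 < s₃
  -- The coefficients of `CubeRel` are proportional to three positive reals, so it becomes a real
  -- equation between radii.
  ratio : ∃ k : ℂ, k ≠ 0 ∧ k * s₃ = m₂ * (1 - m₁ ^ 2) ∧ k * s₂ = m₁ * (m₂ ^ 2 - 1) ∧
    k * s₁ = m₂ ^ 2 - m₁ ^ 2

namespace SpaceData
variable {m₁ m₂ : ℂ} {s₁ s₂ s₃ : ℝ} {u v : ℕ → ℕ → ℂ}

local notation "ω" => space m₁ m₂ s₁ s₂ s₃ u v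

/-- The two planes share the c-axis, where the normalisation gives both the value k at 2k and 1 at
2k+1. -/
theorem left_eq (h : SpaceData m₁ m₂ s₁ s₂ s₃ u v) (a c : ℕ) : ω a 0 c = u a c := by
  cases a with
  | succ a => rw [space]
  | zero =>
    rw [space]
    rcases Nat.even_or_odd' c with ⟨k, rfl | rfl⟩
    · rw [h.left.axis₂, h.right.axis₂]
    · rw [h.left.axis₂', h.right.axis₂']

theorem right_eq (b c : ℕ) : ω 0 b c = v b c := by rw [space]

theorem origin (h : SpaceData m₁ m₂ s₁ s₂ s₃ u v) : ω 0 0 0 = 0 := by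
  rw [right_eq, h.right.origin]

theorem pos_or_ne (h : SpaceData m₁ m₂ s₁ s₂ s₃ u v) : ∀ a b c : ℕ,
    (Even (a + b + c) → a + b + c ≠ 0 → IsPos (ω a b c)) ∧ (¬ Even (a + b + c) → ω a b c ≠ 0)
  | 0, b, c => by
    rw [space, Nat.zero_add]
    exact ⟨h.right.pos b c, h.right.ne b c⟩
  | a + 1, 0, c => by
    rw [space, Nat.add_zero]
    exact ⟨h.left.pos _ c, h.left.ne _ c⟩
  | a + 1, b + 1, c => by
    have par : Even (a + 1 + (b + 1) + c) ↔ Even (a + b + c) := by grind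
    rw [par, space]
    refine ⟨fun he _ => ?_, fun he => ?_⟩
    · rw [if_pos he]
      obtain ⟨x, hx, ex⟩ := (h.pos_or_ne (a + 1) b (c + 1)).1 (by grind) (by omega)
      obtain ⟨y, hy, ey⟩ := (h.pos_or_ne a (b + 1) (c + 1)).1 (by grind) (by omega)
      have : ∃ z : ℝ, 0 ≤ z ∧ ω a b c = z := by
        by_cases h0 : a + b + c = 0
        · obtain ⟨rfl, rfl, rfl⟩ : a = 0 ∧ b = 0 ∧ c = 0 := by omega
          exact ⟨0, le_rfl, by rw [h.origin]; simp⟩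
        · obtain ⟨z, hz, ez⟩ := (h.pos_or_ne a b c).1 he h0
          exact ⟨z, hz.le, ez⟩
      obtain ⟨z, hz, ez⟩ := this
      have h1 := h.pos₁
      have h2 := h.pos₂
      have h3 := h.pos₃
      rw [ex, ey, ez]
      exact ⟨(s₃ * z * x + s₁ * x * y + s₂ * z * y) / (s₃ * y + s₁ * z + s₂ * x), by positivity,
        by push_cast; rfl⟩
    · rw [if_neg he]
      obtain ⟨x, hx, ex⟩ := (h.pos_or_ne (a + 1) b c).1 (by grind) (by omega)
      obtain ⟨y, hy, ey⟩ := (h.pos_or_ne a (b + 1) c).1 (by grind) (by omega)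
      rw [ex, ey]
      refine div_ne_zero (mul_ne_zero ((h.pos_or_ne a b c).2 he) fun e => ?_) fun e => ?_
      · have := h.indep₁₂ (-x) y (by push_cast; linear_combination e)
        linarith [this.2]
      · have := h.indep₁₂ (-y) x (by push_cast; linear_combination e)
        linarith [this.2]
termination_by a b _ => a + b

theorem pos (h : SpaceData m₁ m₂ s₁ s₂ s₃ u v) {a b c : ℕ} (he : Even (a + b + c))
    (h0 : a + b + c ≠ 0) : IsPos (ω a b c) := (h.pos_or_ne a b c).1 he h0

theorem nonneg (h : SpaceData m₁ m₂ s₁ s₂ s₃ u v) {a b c : ℕ} (he : Even (a + b + c)) :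
    IsPos (ω a b c) ∨ ω a b c = 0 := by
  by_cases h0 : a + b + c = 0
  · obtain ⟨rfl, rfl, rfl⟩ : a = 0 ∧ b = 0 ∧ c = 0 := by omega
    exact Or.inr h.origin
  · exact Or.inl (h.pos he h0)

theorem ne (h : SpaceData m₁ m₂ s₁ s₂ s₃ u v) {a b c : ℕ} (h0 : a + b + c ≠ 0) :
    ω a b c ≠ 0 := by
  by_cases he : Even (a + b + c)
  · exact (h.pos he h0).ne_zero
  · exact (h.pos_or_ne a b c).2 he

theorem quad_of_hirota (h : SpaceData m₁ m₂ s₁ s₂ s₃ u v) {m n : ℂ}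
    {a b c a₁ b₁ c₁ a₂ b₂ c₂ a₃ b₃ c₃ : ℕ}
    (h₁ : a₁ + b₁ + c₁ = a + b + c + 1) (h₂ : a₂ + b₂ + c₂ = a + b + c + 1)
    (h₃ : a₃ + b₃ + c₃ = a + b + c + 2)
    (hh : Hirota m n (ω a b c) (ω a₁ b₁ c₁) (ω a₂ b₂ c₂) (ω a₃ b₃ c₃)) :
    Quad m n (ω a b c) (ω a₁ b₁ c₁) (ω a₂ b₂ c₂) (ω a₃ b₃ c₃) := by
  refine ⟨hh, ?_⟩
  by_cases he : Even (a + b + c)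
  · exact Or.inl ⟨h.nonneg he, h.pos (by grind) (by omega), h.ne (by omega), h.ne (by omega)⟩
  · have : a + b + c ≠ 0 := fun e => he (by simp [e])
    exact Or.inr ⟨h.ne this, h.ne (by omega), h.pos (by grind) (by omega),
      h.pos (by grind) (by omega)⟩

theorem cubeRel_iff (h : SpaceData m₁ m₂ s₁ s₂ s₃ u v) {w₀ w₁₂ w₁₃ w₂₃ : ℂ} :
    CubeRel m₁ m₂ w₀ w₁₂ w₁₃ w₂₃ ↔ s₃ * (w₁₂ * w₂₃ - w₀ * w₁₃) + s₁ * (w₁₂ * w₀ - w₁₃ * w₂₃) +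
      s₂ * (w₁₂ * w₁₃ - w₀ * w₂₃) = 0 := by
  obtain ⟨k, hk, e₃, e₂, e₁⟩ := h.ratio
  rw [CubeRel, ← e₁, ← e₂, ← e₃]
  constructor <;> intro e
  · refine mul_left_cancel₀ hk ?_
    linear_combination e
  · linear_combination k * e

theorem cubeRel_even (h : SpaceData m₁ m₂ s₁ s₂ s₃ u v) {a b c : ℕ} (he : Even (a + b + c)) :
    CubeRel m₁ m₂ (ω a b c) (ω (a + 1) (b + 1) c) (ω (a + 1) b (c + 1)) (ω a (b + 1) (c + 1)) := by
  rw [h.cubeRel_iff, space, if_pos he]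
  obtain ⟨x, hx, ex⟩ := h.pos (a := a + 1) (b := b) (c := c + 1) (by grind) (by omega)
  obtain ⟨y, hy, ey⟩ := h.pos (a := a) (b := b + 1) (c := c + 1) (by grind) (by omega)
  have : ∃ z : ℝ, 0 ≤ z ∧ ω a b c = z := by
    rcases h.nonneg he with ⟨z, hz, ez⟩ | ez
    · exact ⟨z, hz.le, ez⟩
    · exact ⟨0, le_rfl, by rw [ez]; simp⟩
  obtain ⟨z, hz, ez⟩ := this
  have h1 := h.pos₁
  have h2 := h.pos₂
  have h3 := h.pos₃
  rw [ex, ey, ez]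
  have hd : (s₃ * y + s₁ * z + s₂ * x : ℂ) ≠ 0 := by
    have : 0 < s₃ * y + s₁ * z + s₂ * x := by positivity
    exact_mod_cast this.ne'
  linear_combination div_mul_cancel₀ (s₃ * z * x + s₁ * x * y + s₂ * z * y : ℂ) hd

/-- The Hirota equations on the vertical faces above `(a, b)`. -/
def VerticalFaces (w : ℕ → ℕ → ℕ → ℂ) (m₁ m₂ : ℂ) (a b : ℕ) : Prop := ∀ c,
  Hirota m₁ 1 (w a b c) (w (a + 1) b c) (w a b (c + 1)) (w (a + 1) b (c + 1)) ∧
  Hirota m₂ 1 (w a b c) (w a (b + 1) c) (w a b (c + 1)) (w a (b + 1) (c + 1))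

theorem hirota_horizontal (h : SpaceData m₁ m₂ s₁ s₂ s₃ u v) {a b : ℕ}
    (hv : VerticalFaces ω m₁ m₂ a b) (c : ℕ) :
    Hirota m₁ m₂ (ω a b c) (ω (a + 1) b c) (ω a (b + 1) c) (ω (a + 1) (b + 1) c) := by
  by_cases he : Even (a + b + c)
  · have q₁ := h.quad_of_hirota (by omega) (by omega) (by omega) (hv c).1
    have q₂ := h.quad_of_hirota (by omega) (by omega) (by omega) (hv c).2
    have hA := q₁.add_ne' h.indep₁₃
    have hB := q₂.add_ne h.indep₂₃
    rw [one_mul] at hA hB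
    exact (h.cubeRel_even he).hirota_bottom (hv c).1 (hv c).2 (h.ne (by omega)) hA hB
  · obtain ⟨x, hx, ex⟩ := h.pos (a := a + 1) (b := b) (c := c) (by grind) (by omega)
    obtain ⟨y, hy, ey⟩ := h.pos (a := a) (b := b + 1) (c := c) (by grind) (by omega)
    have hd : m₂ * x - m₁ * y ≠ 0 := fun e => by
      have := h.indep₁₂ (-y) x (by push_cast; linear_combination e)
      linarith [this.2]
    have e : ω (a + 1) (b + 1) c * (m₂ * x - m₁ * y) = ω a b c * (m₂ * y - m₁ * x) := by
      rw [space, if_neg he, ex, ey, div_mul_cancel₀ _ hd]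
    rw [Hirota, ex, ey]
    linear_combination -e

theorem cubeRel (h : SpaceData m₁ m₂ s₁ s₂ s₃ u v) {a b : ℕ}
    (hv : VerticalFaces ω m₁ m₂ a b) (c : ℕ) :
    CubeRel m₁ m₂ (ω a b c) (ω (a + 1) (b + 1) c) (ω (a + 1) b (c + 1)) (ω a (b + 1) (c + 1)) := by
  by_cases he : Even (a + b + c)
  · exact h.cubeRel_even he
  · have : a + b + c ≠ 0 := fun e => he (by simp [e])
    exact CubeRel.of_faces (hv c).1 (hv c).2 (h.hirota_horizontal hv c) (h.ne this)
      (h.ne (by omega)) (h.ne (by omega))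

/-- Induction on a+b: each cube carries the Hirota equation from its two vertical faces at the
lowest corner to the opposite ones, starting from the coordinate planes. -/
theorem verticalFaces (h : SpaceData m₁ m₂ s₁ s₂ s₃ u v) : ∀ a b, VerticalFaces ω m₁ m₂ a b := by
  have side₁ (a b : ℕ) (hv : VerticalFaces ω m₁ m₂ a b) (c : ℕ) :
      Hirota m₁ 1 (ω a (b + 1) c) (ω (a + 1) (b + 1) c) (ω a (b + 1) (c + 1))
        (ω (a + 1) (b + 1) (c + 1)) := by
    have hh := h.hirota_horizontal hv (c + 1)
    have q := h.quad_of_hirota (by omega) (by omega) (by omega) hh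
    have q₂ := h.quad_of_hirota (by omega) (by omega) (by omega) (hv c).2
    have hB := q₂.add_ne' h.indep₂₃
    rw [one_mul] at hB
    exact (h.cubeRel hv c).hirota_side (hv c).2 hh (q.sub_ne h.indep₁₂ (h.ne (by omega))) hB
  have side₂ (a b : ℕ) (hv : VerticalFaces ω m₁ m₂ a b) (c : ℕ) :
      Hirota m₂ 1 (ω (a + 1) b c) (ω (a + 1) (b + 1) c) (ω (a + 1) b (c + 1))
        (ω (a + 1) (b + 1) (c + 1)) := by
    have hh := h.hirota_horizontal hv (c + 1)
    have q := h.quad_of_hirota (by omega) (by omega) (by omega) hh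
    have q₂ := h.quad_of_hirota (by omega) (by omega) (by omega) (hv c).1
    have hB := q₂.add_ne' h.indep₁₃
    rw [one_mul] at hB
    exact (h.cubeRel hv c).swap.hirota_side (hv c).1 hh.swap
      (q.swap.sub_ne h.indep₁₂.symm (h.ne (by omega))) hB
  intro a b
  induction hn : a + b generalizing a b with
  | zero =>
    obtain ⟨rfl, rfl⟩ : a = 0 ∧ b = 0 := by omega
    intro c
    refine ⟨?_, by simpa only [right_eq] using h.right.hirota 0 c⟩
    simpa only [h.left_eq] using h.left.hirota 0 c
  | succ n ih =>
    intro c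
    constructor
    · cases b with
      | zero => simpa only [h.left_eq] using h.left.hirota a c
      | succ b => exact side₁ a b (ih a b (by omega)) c
    · cases a with
      | zero => simpa only [right_eq] using h.right.hirota b c
      | succ a => exact side₂ a b (ih a b (by omega)) c

theorem quad₁₂ (h : SpaceData m₁ m₂ s₁ s₂ s₃ u v) (a b c : ℕ) :
    Quad m₁ m₂ (ω a b c) (ω (a + 1) b c) (ω a (b + 1) c) (ω (a + 1) (b + 1) c) :=
  h.quad_of_hirota (by omega) (by omega) (by omega) (h.hirota_horizontal (h.verticalFaces a b) c)

theorem quad₁₃ (h : SpaceData m₁ m₂ s₁ s₂ s₃ u v) (a b c : ℕ) :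
    Quad m₁ 1 (ω a b c) (ω (a + 1) b c) (ω a b (c + 1)) (ω (a + 1) b (c + 1)) :=
  h.quad_of_hirota (by omega) (by omega) (by omega) (h.verticalFaces a b c).1

theorem quad₂₃ (h : SpaceData m₁ m₂ s₁ s₂ s₃ u v) (a b c : ℕ) :
    Quad m₂ 1 (ω a b c) (ω a (b + 1) c) (ω a b (c + 1)) (ω a (b + 1) (c + 1)) :=
  h.quad_of_hirota (by omega) (by omega) (by omega) (h.verticalFaces a b c).2

theorem lower_rel (h : SpaceData m₁ m₂ s₁ s₂ s₃ u v) (a b c : ℕ) :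
    s₃ * (ω (a + 1) (b + 1) c * ω a (b + 1) (c + 1) - ω a b c * ω (a + 1) b (c + 1)) +
      s₁ * (ω (a + 1) (b + 1) c * ω a b c - ω (a + 1) b (c + 1) * ω a (b + 1) (c + 1)) +
      s₂ * (ω (a + 1) (b + 1) c * ω (a + 1) b (c + 1) - ω a b c * ω a (b + 1) (c + 1)) = 0 :=
  h.cubeRel_iff.1 (h.cubeRel (h.verticalFaces a b) c)

theorem upper_rel (h : SpaceData m₁ m₂ s₁ s₂ s₃ u v) (a b c : ℕ) (h0 : a + b + c ≠ 0) :
    s₃ * (ω (a + 1) (b + 1) (c + 1) * ω a (b + 1) c - ω (a + 1) b c * ω a b (c + 1)) +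
      s₁ * (ω (a + 1) b c * ω a (b + 1) c - ω a b (c + 1) * ω (a + 1) (b + 1) (c + 1)) +
      s₂ * (ω (a + 1) (b + 1) (c + 1) * ω (a + 1) b c - ω a (b + 1) c * ω a b (c + 1)) = 0 := by
  obtain ⟨k, hk, e₃, e₂, e₁⟩ := h.ratio
  have e := cubeRel_upper (h.quad₁₃ a b c).hirota (h.quad₂₃ a b c).hirota
    (h.quad₁₂ a b (c + 1)).hirota (h.ne h0) (h.ne (by omega))
  rw [← e₁, ← e₂, ← e₃] at e
  refine mul_left_cancel₀ hk ?_
  linear_combination e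

end SpaceData
end Space
-- The constraint on ℕ³.
section Space
variable {m₁ m₂ : ℂ} {s₁ s₂ s₃ : ℝ} {u v : ℕ → ℕ → ℂ}

local notation "ω" => space m₁ m₂ s₁ s₂ s₃ u v

/-- The constraint at `(a, b, c)`. -/
def ConstraintAt (w : ℕ → ℕ → ℕ → ℂ) (a b c : ℕ) : Prop :=
  (a : ℂ) * relDiff (w (a + 1) b c) (w (a - 1) b c) + b * relDiff (w a (b + 1) c) (w a (b - 1) c) +
    c * relDiff (w a b (c + 1)) (w a b (c - 1)) = if Even (a + b + c) then 0 else 1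

namespace SpaceData

theorem quad_lower₁ (h : SpaceData m₁ m₂ s₁ s₂ s₃ u v) {a b c : ℕ} (h0 : a + b + c ≠ 0) :
    (a : ℂ) * ((m₁ ^ 2 - m₂ ^ 2) *
      (relDiff (ω (a + 1) (b + 1) c) (ω (a - 1) (b + 1) c) *
        facP m₁ m₂ (ω a b c) (ω a (b + 1) c) (ω (a + 1) (b + 1) c) +
      relDiff (ω (a + 1) b c) (ω (a - 1) b c) *
        facQ m₁ m₂ (ω a b c) (ω (a + 1) b c) (ω a (b + 1) c))) =
    a * cellE m₁ m₂ (ω a b c) (ω (a + 1) b c) (ω a (b + 1) c) (ω (a + 1) (b + 1) c) := by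
  cases a with
  | zero => simp
  | succ a =>
    refine congrArg _ ((h.quad₁₂ (a + 1) b c).low₁ (h.quad₁₂ a b c) h.indep₁₂ (h.ne h0) ?_)
    by_cases he : Even (a + 1 + b + c)
    · exact Or.inl ⟨h.pos (by grind) (by omega), h.pos (by grind) (by omega)⟩
    · exact Or.inr ⟨h.pos (by grind) (by omega), h.nonneg (by grind)⟩

theorem quad_lower₂ (h : SpaceData m₁ m₂ s₁ s₂ s₃ u v) {a b c : ℕ} (h0 : a + b + c ≠ 0) :
    (b : ℂ) * ((m₁ ^ 2 - m₂ ^ 2) *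
      (relDiff (ω (a + 1) (b + 1) c) (ω (a + 1) (b - 1) c) *
        facP m₁ m₂ (ω a b c) (ω a (b + 1) c) (ω (a + 1) (b + 1) c) -
      relDiff (ω a (b + 1) c) (ω a (b - 1) c) *
        facQ m₁ m₂ (ω a b c) (ω (a + 1) b c) (ω a (b + 1) c))) =
    b * cellE m₁ m₂ (ω a b c) (ω (a + 1) b c) (ω a (b + 1) c) (ω (a + 1) (b + 1) c) := by
  cases b with
  | zero => simp
  | succ b =>
    refine congrArg _ ((h.quad₁₂ a (b + 1) c).low₂ (h.quad₁₂ a b c).swap h.indep₁₂ (h.ne h0) ?_)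
    by_cases he : Even (a + (b + 1) + c)
    · exact Or.inl ⟨h.pos (by grind) (by omega), h.pos (by grind) (by omega)⟩
    · exact Or.inr ⟨h.pos (by grind) (by omega), h.nonneg (by grind)⟩

theorem quad_upper₁ (h : SpaceData m₁ m₂ s₁ s₂ s₃ u v) (a b c : ℕ) :
    (m₁ ^ 2 - m₂ ^ 2) *
      (relDiff (ω (a + 2) b c) (ω a b c) *
        facP m₁ m₂ (ω a b c) (ω a (b + 1) c) (ω (a + 1) (b + 1) c) +
      relDiff (ω (a + 2) (b + 1) c) (ω a (b + 1) c) *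
        facQ m₁ m₂ (ω a b c) (ω (a + 1) b c) (ω a (b + 1) c)) =
    cellE m₁ m₂ (ω a b c) (ω (a + 1) b c) (ω a (b + 1) c) (ω (a + 1) (b + 1) c) := by
  refine (h.quad₁₂ a b c).up₁ (h.quad₁₂ (a + 1) b c) h.indep₁₂ ?_
  by_cases he : Even (a + b + c)
  · exact Or.inr ⟨h.pos (by grind) (by omega), h.nonneg (by grind)⟩
  · exact Or.inl ⟨h.pos (by grind) (by omega), h.pos (by grind) (by omega)⟩

theorem quad_upper₂ (h : SpaceData m₁ m₂ s₁ s₂ s₃ u v) (a b c : ℕ) :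
    (m₁ ^ 2 - m₂ ^ 2) *
      (relDiff (ω a (b + 2) c) (ω a b c) *
        facP m₁ m₂ (ω a b c) (ω a (b + 1) c) (ω (a + 1) (b + 1) c) -
      relDiff (ω (a + 1) (b + 2) c) (ω (a + 1) b c) *
        facQ m₁ m₂ (ω a b c) (ω (a + 1) b c) (ω a (b + 1) c)) =
    cellE m₁ m₂ (ω a b c) (ω (a + 1) b c) (ω a (b + 1) c) (ω (a + 1) (b + 1) c) := by
  refine (h.quad₁₂ a b c).up₂ (h.quad₁₂ a (b + 1) c).swap h.indep₁₂ ?_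
  by_cases he : Even (a + b + c)
  · exact Or.inr ⟨h.pos (by grind) (by omega), h.nonneg (by grind)⟩
  · exact Or.inl ⟨h.pos (by grind) (by omega), h.pos (by grind) (by omega)⟩

theorem quad_transverse (h : SpaceData m₁ m₂ s₁ s₂ s₃ u v) {a b c : ℕ} (h0 : a + b + c ≠ 0) :
    (c : ℂ) * ((relDiff (ω a (b + 1) (c + 1)) (ω a (b + 1) (c - 1)) -
      relDiff (ω (a + 1) b (c + 1)) (ω (a + 1) b (c - 1))) *
        facP m₁ m₂ (ω a b c) (ω a (b + 1) c) (ω (a + 1) (b + 1) c)) =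
    c * ((relDiff (ω (a + 1) (b + 1) (c + 1)) (ω (a + 1) (b + 1) (c - 1)) -
      relDiff (ω a b (c + 1)) (ω a b (c - 1))) *
        facQ m₁ m₂ (ω a b c) (ω (a + 1) b c) (ω a (b + 1) c)) := by
  cases c with
  | zero => simp
  | succ c =>
    congr 1
    have i₁ := h.indep₁₃.symm
    have i₂ := h.indep₂₃.symm
    have par₁ : ∀ a b, (IsPos (ω (a + 1) b (c + 1 + 1)) ∧ IsPos (ω (a + 1) b c)) ∨
        (IsPos (ω a b (c + 1 + 1)) ∧ (IsPos (ω a b c) ∨ ω a b c = 0)) := fun a b => by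
      by_cases he : Even (a + b + c)
      · exact Or.inr ⟨h.pos (by grind) (by omega), h.nonneg (by grind)⟩
      · exact Or.inl ⟨h.pos (by grind) (by omega), h.pos (by grind) (by omega)⟩
    have par₂ : ∀ a b, (IsPos (ω a (b + 1) (c + 1 + 1)) ∧ IsPos (ω a (b + 1) c)) ∨
        (IsPos (ω a b (c + 1 + 1)) ∧ (IsPos (ω a b c) ∨ ω a b c = 0)) := fun a b => by
      by_cases he : Even (a + b + c)
      · exact Or.inr ⟨h.pos (by grind) (by omega), h.nonneg (by grind)⟩
      · exact Or.inl ⟨h.pos (by grind) (by omega), h.pos (by grind) (by omega)⟩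
    have S₁ := (h.quad₁₃ a b (c + 1)).swap.sum_ne (h.quad₁₃ a b c).swap i₁ (h.ne h0) (par₁ a b)
    have S₂ := (h.quad₂₃ a b (c + 1)).swap.sum_ne (h.quad₂₃ a b c).swap i₂ (h.ne h0) (par₂ a b)
    have S₁₂ := (h.quad₂₃ (a + 1) b (c + 1)).swap.sum_ne (h.quad₂₃ (a + 1) b c).swap i₂
      (h.ne (by omega)) (par₂ (a + 1) b)
    have b₁ := (h.quad₁₃ a b c).swap.add_ne i₁
    have b₂ := (h.quad₂₃ a b c).swap.add_ne i₂
    have b₁₂ := (h.quad₂₃ (a + 1) b c).swap.add_ne i₂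
    exact (h.quad₁₂ a b (c + 1)).hirota.transverse
      (h.quad₁₃ a b (c + 1)).swap.hirota (h.quad₁₃ a b c).swap.hirota
      (h.quad₂₃ a b (c + 1)).swap.hirota (h.quad₂₃ a b c).swap.hirota
      (h.quad₂₃ (a + 1) b (c + 1)).swap.hirota (h.quad₂₃ (a + 1) b c).swap.hirota
      ((h.quad₁₃ a b (c + 1)).swap.sub_ne i₁ (h.ne h0)) b₁
      ((h.quad₂₃ a b (c + 1)).swap.sub_ne i₂ (h.ne h0)) b₂
      ((h.quad₂₃ (a + 1) b (c + 1)).swap.sub_ne i₂ (h.ne (by omega))) b₁₂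
      ((h.quad₁₂ a b (c + 1)).swap.sub_ne h.indep₁₂.symm (h.ne h0))
      i₁.sq_sub_ne i₂.sq_sub_ne (h.ne h0) (h.ne (by omega)) S₁.1 S₁.2 S₂.2 S₁₂.2

/-- The linearised equation for the full sum: the two horizontal terms come from the four identities
of the square, the vertical one from transversality. Dividing by `facQ` requires a nonzero value at
the lowest corner. -/
theorem constraintAt_step (h : SpaceData m₁ m₂ s₁ s₂ s₃ u v) {a b c : ℕ} (h0 : a + b + c ≠ 0)
    (F₀ : ConstraintAt ω a b c) (F₁ : ConstraintAt ω (a + 1) b c)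
    (F₂ : ConstraintAt ω a (b + 1) c) : ConstraintAt ω (a + 1) (b + 1) c := by
  have L₁ := h.quad_lower₁ h0
  have L₂ := h.quad_lower₂ h0
  have U₁ := h.quad_upper₁ a b c
  have U₂ := h.quad_upper₂ a b c
  have T := h.quad_transverse h0
  have hQ := (h.quad₁₂ a b c).facQ_ne h.indep₁₂ (h.ne h0)
  have e₁ : Even (a + 1 + b + c) ↔ ¬ Even (a + b + c) := by grind
  have e₂ : Even (a + (b + 1) + c) ↔ ¬ Even (a + b + c) := by grind
  have e₃ : Even (a + 1 + (b + 1) + c) ↔ Even (a + b + c) := by grind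
  unfold ConstraintAt at *
  simp only [e₁, e₂, e₃] at F₁ F₂ ⊢
  generalize (if Even (a + b + c) then (0 : ℂ) else 1) = ε at *
  generalize (if ¬ Even (a + b + c) then (0 : ℂ) else 1) = ε' at *
  simp only [Nat.add_sub_cancel, Nat.add_assoc, Nat.reduceAdd] at *
  push_cast at *
  refine mul_left_cancel₀ (mul_ne_zero h.indep₁₂.sq_sub_ne hQ) ?_
  generalize facQ m₁ m₂ (ω a b c) (ω (a + 1) b c) (ω a (b + 1) c) = Q at *
  generalize facP m₁ m₂ (ω a b c) (ω a (b + 1) c) (ω (a + 1) (b + 1) c) = P at *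
  linear_combination (m₁ ^ 2 - m₂ ^ 2) * Q * F₀ + (m₁ ^ 2 - m₂ ^ 2) * P * (F₂ - F₁) - L₁ +
    (a + 1) * U₁ - (b + 1) * U₂ + L₂ - (m₁ ^ 2 - m₂ ^ 2) * T

/-- At the origin w and hence `facQ` vanish, so this square is checked directly: after rescaling,
the two relative differences have the same denominator and opposite numerators. -/
theorem constraintAt_origin (h : SpaceData m₁ m₂ s₁ s₂ s₃ u v) : ConstraintAt ω 1 1 0 := by
  have a₁ : ω 1 0 0 = m₁ := by rw [h.left_eq]; exact h.left.axis₁' 0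
  have b₁ : ω 0 1 0 = m₂ := by rw [right_eq]; exact h.right.axis₁' 0
  have a₂ : ω 2 0 0 = 1 := by rw [h.left_eq]; simpa using h.left.axis₁ 1
  have b₂ : ω 0 2 0 = 1 := by rw [right_eq]; simpa using h.right.axis₁ 1
  have q₁ := h.quad₁₂ 1 0 0
  have q₂ := h.quad₁₂ 0 1 0
  obtain ⟨ρ, hρ, eρ⟩ := h.pos (a := 1) (b := 1) (c := 0) (by decide) (by omega)
  have q₁ := q₁.hirota
  have q₂ := q₂.hirota
  simp only [zero_add, Nat.reduceAdd, a₁, b₁, a₂, b₂, eρ, Hirota] at q₁ q₂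
  have hY : m₂ - m₁ * ρ ≠ 0 := fun e => by
    have := h.indep₁₂ (-ρ) 1 (by push_cast; linear_combination e)
    linarith [this.2]
  have hX : m₂ * ρ - m₁ ≠ 0 := fun e => by
    have := h.indep₁₂ (-1) ρ (by push_cast; linear_combination e)
    linarith [this.1]
  have e₁ : (m₂ - m₁ * ρ) * ω 2 1 0 = m₁ * (m₂ * ρ - m₁) := by linear_combination -q₁
  have e₂ : (m₂ * ρ - m₁) * ω 1 2 0 = m₂ * (m₂ - m₁ * ρ) := by linear_combination -q₂
  simp only [ConstraintAt, Nat.reduceAdd, Nat.sub_self, a₁, b₁]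
  rw [← relDiff_mul hY (ω 2 1 0), ← relDiff_mul hX (ω 1 2 0), e₁, e₂, if_pos (by decide)]
  simp only [relDiff]
  rw [show m₂ * (m₂ - m₁ * ρ) + (m₂ * ρ - m₁) * m₁ =
    m₁ * (m₂ * ρ - m₁) + (m₂ - m₁ * ρ) * m₂ by ring]
  push_cast
  ring

theorem constraintAt (h : SpaceData m₁ m₂ s₁ s₂ s₃ u v) : ∀ a b c : ℕ, ConstraintAt ω a b c
  | 0, b, c => by
    have := h.right.constraint b c
    unfold ConstraintAt
    simp only [right_eq]
    simpa using this
  | a + 1, 0, c => by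
    have := h.left.constraint (a + 1) c
    unfold ConstraintAt
    simp only [h.left_eq]
    simpa using this
  | a + 1, b + 1, c => by
    by_cases h0 : a + b + c = 0
    · obtain ⟨rfl, rfl, rfl⟩ : a = 0 ∧ b = 0 ∧ c = 0 := by omega
      exact h.constraintAt_origin
    · exact h.constraintAt_step h0 (h.constraintAt a b c) (h.constraintAt (a + 1) b c)
        (h.constraintAt a (b + 1) c)
termination_by a b _ => a + b

end SpaceData
end Space

/-! ### From border sequences to the pattern of radii. -/

/-- The coefficient of `r₁` in the border equation. -/
noncomputable def borderCoeff (α r r₂ r₃ : ℝ) : ℝ :=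
  r ^ 2 - 2 * r₂ * r₃ - r₂ ^ 2 + 2 * r * r₃ * Real.cos α

/-- A positive sequence of radii on a border line with the normalized initial values. -/
structure BorderSequence (θ : ℝ) (R : ℕ → ℝ) : Prop where
  zero : R 0 = 0
  one : R 1 = Real.sin θ / θ
  pos : ∀ n, 0 < R (n + 1)
  border : ∀ n, BorderEq θ (R (n + 1)) (R (n + 2)) (radii R 1 n) (R n)
  coeff : ∀ n, borderCoeff θ (R (n + 1)) (radii R 1 n) (R n) ≠ 0

/-- A solution of the radius equations in nonnegative coordinates
`a = -(L + M)`, `b = -(M + K)`, `c = K + L`. -/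
structure RadiusPattern (α₁ α₂ α₃ : ℝ) (ρ : ℕ → ℕ → ℕ → ℝ) : Prop where
  origin : ρ 0 0 0 = 0
  pos : ∀ a b c, Even (a + b + c) → a + b + c ≠ 0 → 0 < ρ a b c
  hex : ∀ a b c : ℕ, ¬ Even (a + b + c) →
    (a : ℝ) * relDiff (ρ (a + 1) b c) (ρ (a - 1) b c) +
      b * relDiff (ρ a (b + 1) c) (ρ a (b - 1) c) +
      c * relDiff (ρ a b (c + 1)) (ρ a b (c - 1)) = 1
  lower : ∀ a b c, Even (a + b + c) → TriEq α₁ α₂ α₃ (ρ (a + 1) (b + 1) c)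
    (ρ a (b + 1) (c + 1)) (ρ a b c) (ρ (a + 1) b (c + 1))
  upper : ∀ a b c, ¬ Even (a + b + c) → TriEq α₁ α₂ α₃ (ρ a b (c + 1))
    (ρ (a + 1) b c) (ρ (a + 1) (b + 1) (c + 1)) (ρ a (b + 1) c)
  border₁ : ∀ n, BorderEq α₃ (ρ (n + 1) 0 (n + 1)) (ρ (n + 2) 0 (n + 2)) (ρ n 0 (n + 2)) (ρ n 0 n)
  border₂ : ∀ n, BorderEq α₂ (ρ 0 (n + 1) (n + 1)) (ρ 0 (n + 2) (n + 2)) (ρ 0 n (n + 2)) (ρ 0 n n)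
  coeff₁ : ∀ n, borderCoeff α₃ (ρ (n + 1) 0 (n + 1)) (ρ n 0 (n + 2)) (ρ n 0 n) ≠ 0
  coeff₂ : ∀ n, borderCoeff α₂ (ρ 0 (n + 1) (n + 1)) (ρ 0 n (n + 2)) (ρ 0 n n) ≠ 0
  init₁ : ρ 1 0 1 = Real.sin α₃ / α₃
  init₂ : ρ 0 1 1 = Real.sin α₂ / α₂
  init₃ : ρ 0 0 2 = 1

/-- The point of the unit circle with argument `t`. -/
noncomputable def circlePt (t : ℝ) : ℂ := Complex.exp (t * Complex.I)

theorem circlePt_neg (t : ℝ) : circlePt (-t) = (circlePt t)⁻¹ := by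
  rw [circlePt, circlePt, ← Complex.exp_neg]; congr 1; push_cast; ring

theorem circlePt_ne (t : ℝ) : circlePt t ≠ 0 := Complex.exp_ne_zero _

theorem circlePt_half_sq (t : ℝ) : circlePt (t / 2) ^ 2 = circlePt t := by
  rw [circlePt, circlePt, ← Complex.exp_nat_mul]; congr 1; push_cast; ring

theorem circlePt_add (s t : ℝ) : circlePt (s + t) = circlePt s * circlePt t := by
  rw [circlePt, circlePt, circlePt, ← Complex.exp_add]; congr 1; push_cast; ring

theorem circlePt_eq (t : ℝ) : circlePt t = Real.cos t + Real.sin t * Complex.I := by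
  rw [circlePt, Complex.exp_mul_I]; push_cast; rfl

theorem circlePt_sub_inv (t : ℝ) :
    circlePt t - (circlePt t)⁻¹ = 2 * Complex.I * (Real.sin t : ℂ) := by
  rw [← circlePt_neg, circlePt_eq, circlePt_eq, Real.cos_neg, Real.sin_neg]; push_cast; ring

theorem circlePt_add_inv (t : ℝ) :
    circlePt t + (circlePt t)⁻¹ = 2 * (Real.cos t : ℂ) := by
  rw [← circlePt_neg, circlePt_eq, circlePt_eq, Real.cos_neg, Real.sin_neg]; push_cast; ring

theorem realIndep_circlePt {s t : ℝ} (h : Real.sin (t - s) ≠ 0) :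
    RealIndep (circlePt s) (circlePt t) := by
  intro x y e
  rw [circlePt_eq, circlePt_eq] at e
  have e₁ := congrArg Complex.re e
  have e₂ := congrArg Complex.im e
  simp [-Complex.ofReal_cos, -Complex.ofReal_sin] at e₁ e₂
  rw [Real.sin_sub] at h
  constructor <;> refine (mul_eq_zero.1 ?_).resolve_right h
  · linear_combination Real.sin t * e₁ - Real.cos t * e₂
  · linear_combination Real.cos s * e₂ - Real.sin s * e₁

/-- The border equation sees the angle only through its cosine, so both signs are allowed. The two
planes use opposite signs, which puts the direction 1 between the other two. -/
theorem BorderSequence.diagonalData {θ t : ℝ} {R : ℕ → ℝ} (h : BorderSequence θ R)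
    (ht : t = θ ∨ t = -θ) (hs : Real.sin θ ≠ 0) : DiagonalData θ (circlePt (t / 2)) R where
  indep := by
    rw [← circlePt_neg]
    refine realIndep_circlePt ?_
    rw [sub_neg_eq_add, add_halves]
    rcases ht with rfl | rfl <;> simpa using hs
  cos := by
    rw [inv_pow, circlePt_half_sq, circlePt_add_inv]
    rcases ht with rfl | rfl <;> simp
  zero := h.zero
  pos := h.pos
  border := h.border

theorem spaceData {α₁ α₂ α₃ : ℝ} {R R' : ℕ → ℝ} (hα₁ : 0 < α₁) (hα₂ : 0 < α₂) (hα₃ : 0 < α₃)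
    (hsum : α₁ + α₂ + α₃ = Real.pi) (h : BorderSequence α₃ R) (h' : BorderSequence α₂ R') :
    SpaceData (circlePt (-α₃)) (circlePt α₂) (Real.sin α₁) (Real.sin α₂) (Real.sin α₃)
      (plane (circlePt (α₃ / 2)) R) (plane (circlePt (-α₂ / 2)) R') := by
  have s₁ := Real.sin_pos_of_pos_of_lt_pi hα₁ (by linarith)
  have s₂ := Real.sin_pos_of_pos_of_lt_pi hα₂ (by linarith)
  have s₃ := Real.sin_pos_of_pos_of_lt_pi hα₃ (by linarith)
  have e : Real.sin (α₂ + α₃) = Real.sin α₁ := by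
    rw [← Real.sin_pi_sub]; congr 1; linarith
  have one : circlePt 0 = 1 := by simp [circlePt]
  refine ⟨?_, ?_, ?_, ?_, ?_, s₁, s₂, s₃, ?_⟩
  · have := (h.diagonalData (Or.inl rfl) s₃.ne').planePattern
    rwa [inv_pow, circlePt_half_sq, ← circlePt_neg] at this
  · have := (h'.diagonalData (Or.inr rfl) s₂.ne').planePattern
    rwa [inv_pow, circlePt_half_sq, ← circlePt_neg, neg_neg] at this
  · exact realIndep_circlePt (by rw [sub_neg_eq_add, e]; exact s₁.ne')
  · rw [← one]
    exact realIndep_circlePt (by simpa using s₃.ne')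
  · rw [← one]
    exact realIndep_circlePt (by simpa using s₂.ne')
  -- The factor is k = 2i·m₁m₂, since m₂(1 - m₁²) = m₁m₂(m₁⁻¹ - m₁) = 2i·m₁m₂·sin α₃, and similarly
  -- for the other two coefficients.
  · refine ⟨2 * Complex.I * (circlePt (-α₃) * circlePt α₂), mul_ne_zero (by simp)
      (mul_ne_zero (circlePt_ne _) (circlePt_ne _)), ?_, ?_, ?_⟩
    · have := circlePt_sub_inv α₃
      have h0 := circlePt_ne α₃
      rw [circlePt_neg]
      field_simp at this ⊢
      linear_combination -circlePt α₂ * this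
    · have := circlePt_sub_inv α₂
      have h0 := circlePt_ne α₂
      field_simp at this ⊢
      linear_combination -circlePt (-α₃) * this
    · have := circlePt_sub_inv (α₂ + α₃)
      rw [e, circlePt_add] at this
      have h2 := circlePt_ne α₂
      have h3 := circlePt_ne α₃
      rw [circlePt_neg]
      field_simp at this ⊢
      linear_combination -this

theorem SpaceData.radiusPattern {α₁ α₂ α₃ : ℝ} {R R' : ℕ → ℝ} {m₁ m₂ μ μ' : ℂ}
    (hd : SpaceData m₁ m₂ (Real.sin α₁) (Real.sin α₂) (Real.sin α₃) (plane μ R) (plane μ' R'))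
    (h : BorderSequence α₃ R) (h' : BorderSequence α₂ R') :
    ∃ ρ : ℕ → ℕ → ℕ → ℝ, RadiusPattern α₁ α₂ α₃ ρ := by
  set w := space m₁ m₂ (Real.sin α₁) (Real.sin α₂) (Real.sin α₃) (plane μ R) (plane μ' R') with hw
  have key (a b c : ℕ) (he : Even (a + b + c)) : w a b c = ((w a b c).re : ℂ) := by
    rcases hd.nonneg he with ⟨x, -, e⟩ | e
    · rw [← hw] at e; rw [e, Complex.ofReal_re]
    · rw [← hw] at e; rw [e]; simp
  have key₁ (a j : ℕ) : (w a 0 (a + 2 * j)).re = radii R j a := by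
    rw [hw, hd.left_eq, plane_even_right, Complex.ofReal_re]
  have key₂ (a j : ℕ) : (w 0 a (a + 2 * j)).re = radii R' j a := by
    rw [hw, SpaceData.right_eq, plane_even_right, Complex.ofReal_re]
  refine ⟨fun a b c => (w a b c).re, ?_, ?_, ?_, ?_, ?_, ?_, ?_, ?_, ?_, ?_, ?_, ?_⟩
  · rw [hw, hd.origin, Complex.zero_re]
  · intro a b c he h0
    obtain ⟨x, hx, e⟩ := hd.pos he h0
    rw [← hw] at e
    rw [e]; exact hx
  · intro a b c he
    have F := hd.constraintAt a b c
    rw [← hw, ConstraintAt, if_neg he] at F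
    have T₁ : (a : ℂ) * relDiff (w (a + 1) b c) (w (a - 1) b c) =
        ((a * relDiff (w (a + 1) b c).re (w (a - 1) b c).re : ℝ) : ℂ) := by
      cases a with
      | zero => simp
      | succ a =>
        rw [key (a + 1 + 1) b c (by grind), key (a + 1 - 1) b c (by grind)]
        simp [relDiff]
    have T₂ : (b : ℂ) * relDiff (w a (b + 1) c) (w a (b - 1) c) =
        ((b * relDiff (w a (b + 1) c).re (w a (b - 1) c).re : ℝ) : ℂ) := by
      cases b with
      | zero => simp
      | succ b =>
        rw [key a (b + 1 + 1) c (by grind), key a (b + 1 - 1) c (by grind)]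
        simp [relDiff]
    have T₃ : (c : ℂ) * relDiff (w a b (c + 1)) (w a b (c - 1)) =
        ((c * relDiff (w a b (c + 1)).re (w a b (c - 1)).re : ℝ) : ℂ) := by
      cases c with
      | zero => simp
      | succ c =>
        rw [key a b (c + 1 + 1) (by grind), key a b (c + 1 - 1) (by grind)]
        simp [relDiff]
    rw [T₁, T₂, T₃] at F
    exact_mod_cast F
  · intro a b c he
    have := hd.lower_rel a b c
    rw [← hw, key (a + 1) (b + 1) c (by grind), key a (b + 1) (c + 1) (by grind), key a b c he,
      key (a + 1) b (c + 1) (by grind)] at this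
    norm_cast at this
    unfold TriEq
    linear_combination this
  · intro a b c he
    have := hd.upper_rel a b c (fun e => he (by simp [e]))
    rw [← hw, key (a + 1) (b + 1) (c + 1) (by grind), key a (b + 1) c (by grind),
      key (a + 1) b c (by grind), key a b (c + 1) (by grind)] at this
    norm_cast at this
    unfold TriEq
    linear_combination -this
  · intro n
    have := h.border n
    have e := key₁ (n + 1) 0
    have e' := key₁ (n + 2) 0
    have e'' := key₁ n 0
    simp only [mul_zero, add_zero, radii.eq_1] at e e' e''
    simpa only [e, e', e'', key₁ n 1] using this
  · intro n
    have := h'.border n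
    have e := key₂ (n + 1) 0
    have e' := key₂ (n + 2) 0
    have e'' := key₂ n 0
    simp only [mul_zero, add_zero, radii.eq_1] at e e' e''
    simpa only [e, e', e'', key₂ n 1] using this
  · intro n
    have := h.coeff n
    have e := key₁ (n + 1) 0
    have e'' := key₁ n 0
    simp only [mul_zero, add_zero, radii.eq_1] at e e''
    simpa only [e, e'', key₁ n 1] using this
  · intro n
    have := h'.coeff n
    have e := key₂ (n + 1) 0
    have e'' := key₂ n 0
    simp only [mul_zero, add_zero, radii.eq_1] at e e''
    simpa only [e, e'', key₂ n 1] using this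
  · have := key₁ 1 0
    rw [radii, h.one] at this
    exact this
  · have := key₂ 1 0
    rw [radii, h'.one] at this
    exact this
  · have := key₁ 0 1
    rw [radii] at this
    simpa using this

/-! ### Comparison and asymptotics for singular differential equations. -/

open Filter Topology Set

/-- If f(t) > 0, then f starts below the constant f(t)/2 and cannot cross it upwards. -/
theorem le_zero_of_deriv_neg {f f' : ℝ → ℝ} {η : ℝ} (h0 : Tendsto f (𝓝[>] 0) (𝓝 0))
    (hf : ∀ t ∈ Ioo 0 η, HasDerivAt f (f' t) t) (hneg : ∀ t ∈ Ioo 0 η, 0 < f t → f' t < 0) :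
    ∀ t ∈ Ioo 0 η, f t ≤ 0 := by
  intro t ht
  by_contra! hpos
  have ev : ∀ᶠ s in 𝓝[>] (0 : ℝ), f s < f t / 2 := h0.eventually_lt_const (by linarith)
  obtain ⟨s, hs, hs0, hst⟩ := (ev.and (Ioo_mem_nhdsGT ht.1)).exists
  have hsub : ∀ x ∈ Icc s t, x ∈ Ioo 0 η := fun x hx => ⟨hs0.trans_le hx.1, hx.2.trans_lt ht.2⟩
  have := image_le_of_deriv_right_lt_deriv_boundary (a := s) (b := t) (f := f) (f' := f')
    (B := fun _ => f t / 2) (B' := fun _ => 0)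
    (fun x hx => (hf x (hsub x hx)).continuousAt.continuousWithinAt)
    (fun x hx => (hf x (hsub x ⟨hx.1, hx.2.le⟩)).hasDerivWithinAt) hs.le
    (fun x => hasDerivAt_const x _)
    (fun x hx e => hneg x (hsub x ⟨hx.1, hx.2.le⟩) (by rw [e]; linarith)) (x := t) ⟨hst.le, le_rfl⟩
  linarith

/-- A function that is eventually positive at the left end and has positive derivative at each of
its zeros is positive. -/
theorem pos_of_deriv_pos {f f' : ℝ → ℝ} {η : ℝ} (h0 : ∀ᶠ t in 𝓝[>] (0 : ℝ), 0 < f t)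
    (hf : ∀ t ∈ Ioo 0 η, HasDerivAt f (f' t) t) (hpos : ∀ t ∈ Ioo 0 η, f t = 0 → 0 < f' t) :
    ∀ t ∈ Ioo 0 η, 0 < f t := by
  have nonneg : ∀ t ∈ Ioo 0 η, 0 ≤ f t := by
    intro t ht
    obtain ⟨s, hs, hs0, hst⟩ := (h0.and (Ioo_mem_nhdsGT ht.1)).exists
    have hsub : ∀ x ∈ Icc s t, x ∈ Ioo 0 η := fun x hx => ⟨hs0.trans_le hx.1, hx.2.trans_lt ht.2⟩
    have := image_le_of_deriv_right_lt_deriv_boundary (a := s) (b := t) (f := fun x => -f x)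
      (f' := fun x => -f' x) (B := fun _ => 0) (B' := fun _ => 0)
      (fun x hx => (hf x (hsub x hx)).neg.continuousAt.continuousWithinAt)
      (fun x hx => (hf x (hsub x ⟨hx.1, hx.2.le⟩)).neg.hasDerivWithinAt) (by linarith)
      (fun x => hasDerivAt_const x _)
      (fun x hx e => by
        have := hpos x (hsub x ⟨hx.1, hx.2.le⟩) (by simpa using e)
        linarith) (x := t) ⟨hst.le, le_rfl⟩
    simpa using this
  intro t ht
  refine (nonneg t ht).lt_of_ne fun e => ?_
  -- A touching zero would be an interior minimum with vanishing derivative.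
  have hmin : IsLocalMin f t := by
    filter_upwards [Ioo_mem_nhds ht.1 ht.2] with x hx
    rw [← e]; exact nonneg x hx
  have := hmin.hasDerivAt_eq_zero (hf t ht)
  linarith [hpos t ht e.symm]

theorem tendsto_sin_div : Tendsto (fun t : ℝ => Real.sin t / t) (𝓝[>] 0) (𝓝 1) := by
  have := (Real.hasDerivAt_sin 0).tendsto_slope
  simp only [Real.cos_zero] at this
  refine (this.mono_left (nhdsWithin_mono _ fun x hx => (ne_of_gt hx))).congr fun t => ?_
  simp [slope, div_eq_inv_mul]

theorem tendsto_of_abs_sub_le {f : ℝ → ℝ} {l : ℝ}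
    (h : ∀ t : ℝ, 0 < t → t ≤ 1 → |f t - l| ≤ t) : Tendsto f (𝓝[>] 0) (𝓝 l) := by
  rw [tendsto_iff_dist_tendsto_zero]
  refine squeeze_zero' (Eventually.of_forall fun _ => dist_nonneg) ?_
    ((tendsto_id (α := ℝ)).mono_left nhdsWithin_le_nhds)
  filter_upwards [Ioo_mem_nhdsGT (zero_lt_one (α := ℝ))] with t ht
  exact h t ht.1 ht.2.le

theorem tendsto_one_sub_cos : Tendsto (fun t : ℝ => (1 - Real.cos t) / t ^ 2) (𝓝[>] 0)
    (𝓝 (1 / 2)) := by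
  refine tendsto_of_abs_sub_le fun t h0 h1 => ?_
  have := Real.cos_bound (x := t) (by rw [abs_of_pos h0]; exact h1)
  rw [abs_of_pos h0] at this
  have e : (1 - Real.cos t) / t ^ 2 - 1 / 2 = -(Real.cos t - (1 - t ^ 2 / 2)) / t ^ 2 := by
    field_simp; ring
  rw [e, abs_div, abs_neg, abs_of_pos (by positivity : (0:ℝ) < t ^ 2), div_le_iff₀ (by positivity)]
  have h4 : t ^ 4 ≤ t ^ 3 := pow_le_pow_of_le_one h0.le h1 (by norm_num)
  have : (0:ℝ) < t ^ 3 := by positivity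
  nlinarith

theorem tendsto_one_sub_sin : Tendsto (fun t : ℝ => (1 - Real.sin t / t) / t ^ 2) (𝓝[>] 0)
    (𝓝 (1 / 6)) := by
  refine tendsto_of_abs_sub_le fun t h0 h1 => ?_
  have := Real.sin_bound (x := t) (by rw [abs_of_pos h0]; exact h1)
  rw [abs_of_pos h0] at this
  have e : (1 - Real.sin t / t) / t ^ 2 - 1 / 6 = -(Real.sin t - (t - t ^ 3 / 6)) / t ^ 3 := by
    field_simp; ring
  rw [e, abs_div, abs_neg, abs_of_pos (by positivity : (0:ℝ) < t ^ 3), div_le_iff₀ (by positivity)]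
  have : (0:ℝ) < t ^ 4 := by positivity
  nlinarith

theorem tendsto_zero_of_div_sq {f : ℝ → ℝ} {l : ℝ}
    (h : Tendsto (fun t => f t / t ^ 2) (𝓝[>] 0) (𝓝 l)) : Tendsto f (𝓝[>] 0) (𝓝 0) := by
  have h2 : Tendsto (fun t : ℝ => t ^ 2) (𝓝[>] 0) (𝓝 0) := by
    have := (continuous_pow 2 (M := ℝ)).tendsto 0
    simp only [ne_eq, OfNat.ofNat_ne_zero, not_false_eq_true, zero_pow] at this
    exact this.mono_left nhdsWithin_le_nhds
  have := h.mul h2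
  rw [mul_zero] at this
  refine this.congr' ?_
  filter_upwards [self_mem_nhdsWithin] with t ht
  have : t ≠ 0 := ne_of_gt ht
  field_simp

/-- Quadratic asymptotics at the singular point of the linear equation `sin t * δ' = g - b * δ`. -/
theorem tendsto_div_sq_of_deriv {δ g b : ℝ → ℝ} {η γ β : ℝ} (hη : 0 < η) (hπ : η ≤ Real.pi)
    (h0 : Tendsto δ (𝓝[>] 0) (𝓝 0)) (hg : Tendsto (fun t => g t / t ^ 2) (𝓝[>] 0) (𝓝 γ))
    (hb : Tendsto b (𝓝[>] 0) (𝓝 β)) (hβ : 0 < β)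
    (hδ : ∀ t ∈ Ioo 0 η, HasDerivAt δ ((g t - b t * δ t) / Real.sin t) t) :
    Tendsto (fun t => δ t / t ^ 2) (𝓝[>] 0) (𝓝 (γ / (β + 2))) := by
  set κ := γ / (β + 2) with hκ
  have eκ : γ = κ * (β + 2) := by rw [hκ]; field_simp
  have h2 : Tendsto (fun t : ℝ => t ^ 2) (𝓝[>] 0) (𝓝 0) := by
    have := (continuous_pow 2 (M := ℝ)).tendsto 0
    simp only [ne_eq, OfNat.ofNat_ne_zero, not_false_eq_true, zero_pow] at this
    exact this.mono_left nhdsWithin_le_nhds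
  have bracket (k : ℝ) : Tendsto (fun t => g t / t ^ 2 - (b t + 2 * (Real.sin t / t)) * k)
      (𝓝[>] 0) (𝓝 ((κ - k) * (β + 2))) := by
    have := hg.sub ((hb.add (tendsto_sin_div.const_mul 2)).mul_const k)
    convert this using 2
    rw [eκ]; ring
  -- The difference δ - k·t² solves the same equation with g replaced by t² times the bracket, whose
  -- sign near 0 is that of κ - k. Barriers with k = κ ± ε then enclose δ.
  have eqn (k t : ℝ) (ht : t ∈ Ioo 0 η) : HasDerivAt (fun t => δ t - k * t ^ 2)
      ((t ^ 2 * (g t / t ^ 2 - (b t + 2 * (Real.sin t / t)) * k) - b t * (δ t - k * t ^ 2)) /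
        Real.sin t) t := by
    have hs : Real.sin t ≠ 0 :=
      (Real.sin_pos_of_pos_of_lt_pi ht.1 (ht.2.trans_le hπ)).ne'
    have ht0 : t ≠ 0 := ht.1.ne'
    refine ((hδ t ht).sub ((hasDerivAt_pow 2 t).const_mul k)).congr_deriv ?_
    field_simp
    ring
  have hlim (k : ℝ) : Tendsto (fun t => δ t - k * t ^ 2) (𝓝[>] 0) (𝓝 0) := by
    simpa using h0.sub (h2.const_mul k)
  have hbpos := hb.eventually_const_lt hβ
  have upper (ε : ℝ) (hε : 0 < ε) : ∀ᶠ t in 𝓝[>] (0 : ℝ), δ t / t ^ 2 ≤ κ + ε := by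
    have ev := (bracket (κ + ε)).eventually_lt_const (u := 0) (by nlinarith)
    obtain ⟨ζ, hζ, hsub⟩ := mem_nhdsGT_iff_exists_Ioo_subset.1 (ev.and hbpos)
    have hm : 0 < min ζ η := lt_min hζ hη
    have := le_zero_of_deriv_neg (η := min ζ η) (hlim (κ + ε))
      (fun t ht => eqn (κ + ε) t ⟨ht.1, ht.2.trans_le (min_le_right _ _)⟩) fun t ht hpos => by
        have hs := Real.sin_pos_of_pos_of_lt_pi ht.1 ((ht.2.trans_le (min_le_right _ _)).trans_le hπ)
        obtain ⟨h1, h3⟩ := hsub ⟨ht.1, ht.2.trans_le (min_le_left _ _)⟩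
        refine div_neg_of_neg_of_pos ?_ hs
        have := mul_pos h3 hpos
        have : 0 < t ^ 2 := by have := ht.1; positivity
        nlinarith
    filter_upwards [Ioo_mem_nhdsGT hm] with t ht
    have h4 := this t ht
    have : 0 < t ^ 2 := by have := ht.1; positivity
    rw [div_le_iff₀ this]
    linarith
  have lower (ε : ℝ) (hε : 0 < ε) : ∀ᶠ t in 𝓝[>] (0 : ℝ), κ - ε ≤ δ t / t ^ 2 := by
    have ev := (bracket (κ - ε)).eventually_const_lt (u := 0) (by nlinarith)
    obtain ⟨ζ, hζ, hsub⟩ := mem_nhdsGT_iff_exists_Ioo_subset.1 (ev.and hbpos)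
    have hm : 0 < min ζ η := lt_min hζ hη
    have := le_zero_of_deriv_neg (η := min ζ η) (by have h := (hlim (κ - ε)).neg; rw [neg_zero] at h; exact h)
      (fun t ht => (eqn (κ - ε) t ⟨ht.1, ht.2.trans_le (min_le_right _ _)⟩).neg) fun t ht hpos => by
        have hs := Real.sin_pos_of_pos_of_lt_pi ht.1 ((ht.2.trans_le (min_le_right _ _)).trans_le hπ)
        obtain ⟨h1, h3⟩ := hsub ⟨ht.1, ht.2.trans_le (min_le_left _ _)⟩
        rw [neg_lt_zero]
        refine div_pos ?_ hs
        have := mul_pos h3 hpos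
        have : 0 < t ^ 2 := by have := ht.1; positivity
        simp only [Pi.neg_apply] at *
        nlinarith
    filter_upwards [Ioo_mem_nhdsGT hm] with t ht
    have h4 := this t ht
    have : 0 < t ^ 2 := by have := ht.1; positivity
    rw [le_div_iff₀ this]
    simp only [Pi.neg_apply] at h4
    linarith
  rw [tendsto_order]
  constructor
  · intro x hx
    filter_upwards [lower ((κ - x) / 2) (by linarith)] with t ht
    linarith
  · intro x hx
    filter_upwards [upper ((x - κ) / 2) (by linarith)] with t ht
    linarith


/-! ### Border radii as functions of the angle. -/

/-- The border radii divided by their index, as functions of the angle: `a` is the current term,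
`y` the previous radius and `q` the sum of products of consecutive terms. -/
structure BorderData (n : ℝ) (a y q : ℝ → ℝ) : Prop where
  a_pos : ∀ t ∈ Ioo 0 Real.pi, 0 < a t
  a_lt : ∀ t ∈ Ioo 0 Real.pi, a t < 1
  q_pos : ∀ t ∈ Ioo 0 Real.pi, 0 < q t
  q_lt : ∀ t ∈ Ioo 0 Real.pi, q t < n
  -- Read as a quadratic in the previous radius `y t`; its other root is the next border radius,
  -- which Vieta's formulas give in `next_add` and `next_mul`.
  quad : ∀ t ∈ Ioo 0 Real.pi, (1 - a t ^ 2) * y t ^ 2 - 2 * a t * (q t - n * Real.cos t) * y t +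
    n ^ 2 * a t ^ 2 - q t ^ 2 = 0
  deriv_a : ∀ t ∈ Ioo 0 Real.pi,
    HasDerivAt a ((-a t * (q t - n * Real.cos t) + (1 - a t ^ 2) * y t) / Real.sin t) t
  deriv_q : ∀ t ∈ Ioo 0 Real.pi,
    HasDerivAt q ((Real.cos t * q t - n * a t ^ 2) / Real.sin t) t
  deriv_y : ∀ t ∈ Ioo 0 Real.pi, HasDerivAt y
    ((y t * (q t - (n - 1) * Real.cos t) + a t * y t ^ 2 - n * (n - 1) * a t) / Real.sin t) t
  lim : ∃ k : ℝ, 0 < k ∧ Tendsto (fun t => (1 - a t) / t ^ 2) (𝓝[>] 0) (𝓝 k) ∧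
    Tendsto (fun t => (q t - n * Real.cos t) / t ^ 2) (𝓝[>] 0) (𝓝 (2 * n * k))
  lim_y : Tendsto y (𝓝[>] 0) (𝓝 (n - 1))

theorem borderData_one :
    BorderData 1 (fun t => Real.sin t / t) (fun _ => 0) (fun t => Real.sin t / t) where
  a_pos t ht := div_pos (Real.sin_pos_of_pos_of_lt_pi ht.1 ht.2) ht.1
  a_lt t ht := by rw [div_lt_one ht.1]; exact Real.sin_lt ht.1
  q_pos t ht := div_pos (Real.sin_pos_of_pos_of_lt_pi ht.1 ht.2) ht.1
  q_lt t ht := by rw [div_lt_one ht.1]; exact Real.sin_lt ht.1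
  quad t ht := by ring
  deriv_a t ht := by
    have h0 := ht.1.ne'
    have hs := (Real.sin_pos_of_pos_of_lt_pi ht.1 ht.2).ne'
    refine ((Real.hasDerivAt_sin t).div (hasDerivAt_id t) h0).congr_deriv ?_
    simp only [id]
    field_simp
    ring
  deriv_q t ht := by
    have h0 := ht.1.ne'
    have hs := (Real.sin_pos_of_pos_of_lt_pi ht.1 ht.2).ne'
    refine ((Real.hasDerivAt_sin t).div (hasDerivAt_id t) h0).congr_deriv ?_
    simp only [id]
    field_simp
  deriv_y t ht := (hasDerivAt_const t _).congr_deriv (by simp)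
  lim := by
    refine ⟨1 / 6, by norm_num, tendsto_one_sub_sin, ?_⟩
    have := tendsto_one_sub_cos.sub tendsto_one_sub_sin
    convert this using 2
    · ring
    · norm_num
  lim_y := by simp

/-- The next border radius. -/
noncomputable def nextRadius (n : ℝ) (a y q : ℝ → ℝ) (t : ℝ) : ℝ :=
  2 * a t * (q t - n * Real.cos t) / (1 - a t ^ 2) - y t

/-- The next normalized term. -/
noncomputable def nextTerm (n : ℝ) (a y q : ℝ → ℝ) (t : ℝ) : ℝ :=
  nextRadius n a y q t / (n + 1)

namespace BorderData
variable {n : ℝ} {a y q : ℝ → ℝ}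

theorem one_sub_pos (h : BorderData n a y q) {t : ℝ} (ht : t ∈ Ioo 0 Real.pi) :
    0 < 1 - a t ^ 2 := by
  nlinarith [h.a_pos t ht, h.a_lt t ht]

theorem next_add (h : BorderData n a y q) {t : ℝ} (ht : t ∈ Ioo 0 Real.pi) :
    (1 - a t ^ 2) * (nextRadius n a y q t + y t) = 2 * a t * (q t - n * Real.cos t) := by
  have := (h.one_sub_pos ht).ne'
  rw [nextRadius]; field_simp; ring

theorem next_mul (h : BorderData n a y q) {t : ℝ} (ht : t ∈ Ioo 0 Real.pi) :
    (1 - a t ^ 2) * (nextRadius n a y q t * y t) = n ^ 2 * a t ^ 2 - q t ^ 2 := by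
  linear_combination y t * h.next_add ht - h.quad t ht

theorem next_quad (h : BorderData n a y q) {t : ℝ} (ht : t ∈ Ioo 0 Real.pi) :
    (1 - a t ^ 2) * nextRadius n a y q t ^ 2 - 2 * a t * (q t - n * Real.cos t) *
      nextRadius n a y q t + n ^ 2 * a t ^ 2 - q t ^ 2 = 0 := by
  linear_combination nextRadius n a y q t * h.next_add ht - h.next_mul ht

theorem deriv_next (h : BorderData n a y q) {t : ℝ} (ht : t ∈ Ioo 0 Real.pi) :
    HasDerivAt (nextRadius n a y q) ((-nextRadius n a y q t *
      (q t - (n + 1) * Real.cos t) - a t * nextRadius n a y q t ^ 2 + n * (n + 1) * a t) /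
        Real.sin t) t := by
  have hs := (Real.sin_pos_of_pos_of_lt_pi ht.1 ht.2).ne'
  have hd := (h.one_sub_pos ht).ne'
  have hsq := Real.sin_sq_add_cos_sq t
  have := ((((h.deriv_a t ht).const_mul 2).mul ((h.deriv_q t ht).sub
    ((Real.hasDerivAt_cos t).const_mul n))).div
      (((h.deriv_a t ht).pow 2).const_sub 1) hd).sub (h.deriv_y t ht)
  refine this.congr_deriv ?_
  rw [nextRadius]
  simp only [Pi.mul_apply, Pi.sub_apply, Pi.pow_apply]
  generalize Real.sin t = s at *
  generalize Real.cos t = c at *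
  field_simp
  linear_combination (2 * a t * n * (1 - a t ^ 2)) * hsq

theorem nextRadius_eq (hn : 1 ≤ n) (t : ℝ) :
    nextRadius n a y q t = (n + 1) * nextTerm n a y q t := by
  have : n + 1 ≠ 0 := by linarith
  rw [nextTerm]; field_simp

theorem deriv_nextTerm (h : BorderData n a y q) (hn : 1 ≤ n) {t : ℝ} (ht : t ∈ Ioo 0 Real.pi) :
    HasDerivAt (nextTerm n a y q)
      ((-nextTerm n a y q t * (q t + a t * nextTerm n a y q t - (n + 1) * Real.cos t) +
        (1 - nextTerm n a y q t ^ 2) * (n * a t)) / Real.sin t) t := by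
  have hs := (Real.sin_pos_of_pos_of_lt_pi ht.1 ht.2).ne'
  have h1 : n + 1 ≠ 0 := by linarith
  refine ((h.deriv_next ht).div_const (n + 1)).congr_deriv ?_
  rw [nextRadius_eq hn]
  field_simp
  ring

/-- The same relation read as a quadratic in the radius n·a: it is the invariant `quad` at index
n+1. -/
theorem next_quad' (h : BorderData n a y q) (hn : 1 ≤ n) {t : ℝ} (ht : t ∈ Ioo 0 Real.pi) :
    (1 - nextTerm n a y q t ^ 2) * (n * a t) ^ 2 - 2 * nextTerm n a y q t *
      (q t + a t * nextTerm n a y q t - (n + 1) * Real.cos t) * (n * a t) +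
      (n + 1) ^ 2 * nextTerm n a y q t ^ 2 - (q t + a t * nextTerm n a y q t) ^ 2 = 0 := by
  have := h.next_quad ht
  rw [nextRadius_eq hn] at this
  linear_combination this

theorem next_add' (h : BorderData n a y q) (hn : 1 ≤ n) {t : ℝ} (ht : t ∈ Ioo 0 Real.pi) :
    (1 - a t ^ 2) * ((n + 1) * nextTerm n a y q t + y t) =
      2 * a t * (q t - n * Real.cos t) := by
  rw [← nextRadius_eq hn]; exact h.next_add ht

theorem deriv_nextSum (h : BorderData n a y q) (hn : 1 ≤ n) {t : ℝ} (ht : t ∈ Ioo 0 Real.pi) :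
    HasDerivAt (fun t => q t + a t * nextTerm n a y q t)
      ((Real.cos t * (q t + a t * nextTerm n a y q t) - (n + 1) * nextTerm n a y q t ^ 2) /
        Real.sin t) t := by
  have hs := (Real.sin_pos_of_pos_of_lt_pi ht.1 ht.2).ne'
  have e := h.next_add' hn ht
  refine ((h.deriv_q t ht).add ((h.deriv_a t ht).mul (h.deriv_nextTerm hn ht))).congr_deriv ?_
  field_simp
  linear_combination nextTerm n a y q t * e

theorem deriv_nextPrev (h : BorderData n a y q) (hn : 1 ≤ n) {t : ℝ} (ht : t ∈ Ioo 0 Real.pi) :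
    HasDerivAt (fun t => n * a t)
      ((n * a t * (q t + a t * nextTerm n a y q t - (n + 1 - 1) * Real.cos t) +
        nextTerm n a y q t * (n * a t) ^ 2 - (n + 1) * (n + 1 - 1) * nextTerm n a y q t) /
        Real.sin t) t := by
  have hs := (Real.sin_pos_of_pos_of_lt_pi ht.1 ht.2).ne'
  have e := h.next_add' hn ht
  refine ((h.deriv_a t ht).const_mul n).congr_deriv ?_
  field_simp
  linear_combination n * e

theorem tendsto_nextTerm (h : BorderData n a y q) (hn : 1 ≤ n) :
    Tendsto (nextTerm n a y q) (𝓝[>] 0) (𝓝 1) := by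
  obtain ⟨k, hk, h1, h2⟩ := h.lim
  have h3 : Tendsto a (𝓝[>] 0) (𝓝 1) := by
    simpa using (tendsto_zero_of_div_sq h1).const_sub 1
  have h4 := ((((h3.const_mul 2).mul h2).div (h1.mul (h3.const_add 1))
    (by positivity)).sub h.lim_y).div_const (n + 1)
  have e : ((2 * 1 * (2 * n * k)) / (k * (1 + 1)) - (n - 1)) / (n + 1) = 1 := by
    have : n + 1 ≠ 0 := by linarith
    field_simp
    ring
  rw [e] at h4
  refine h4.congr' ?_
  filter_upwards [Ioo_mem_nhdsGT Real.pi_pos] with t ht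
  have h0 := ht.1.ne'
  have hd := (h.one_sub_pos ht).ne'
  have e1 : 1 - a t ^ 2 = (1 - a t) * (1 + a t) := by ring
  simp only [Pi.div_apply]
  rw [nextTerm, nextRadius]
  rw [e1] at hd ⊢
  have := left_ne_zero_of_mul hd
  have := right_ne_zero_of_mul hd
  field_simp

/-- The function 1 - A, with A the next term, satisfies the singular equation with β = 2n+1 and γ =
2nk + 1/2 - k > 0, so its quadratic coefficient is positive. -/
theorem lim_next (h : BorderData n a y q) (hn : 1 ≤ n) :
    ∃ k : ℝ, 0 < k ∧ Tendsto (fun t => (1 - nextTerm n a y q t) / t ^ 2) (𝓝[>] 0) (𝓝 k) ∧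
    Tendsto (fun t => (q t + a t * nextTerm n a y q t - (n + 1) * Real.cos t) / t ^ 2) (𝓝[>] 0)
      (𝓝 (2 * (n + 1) * k)) := by
  have hA := h.tendsto_nextTerm hn
  obtain ⟨k, hk, h1, h2⟩ := h.lim
  have h3 : Tendsto a (𝓝[>] 0) (𝓝 1) := by
    simpa using (tendsto_zero_of_div_sq h1).const_sub 1
  have hg := hA.mul ((h2.add tendsto_one_sub_cos).sub h1)
  have hb := (h3.mul hA).add ((hA.const_add 1).mul (h3.const_mul n))
  have hp : 0 < 1 * (2 * n * k + 1 / 2 - k) := by nlinarith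
  have lim := tendsto_div_sq_of_deriv (δ := fun t => 1 - nextTerm n a y q t)
    (g := fun t => nextTerm n a y q t * (q t + a t - (n + 1) * Real.cos t))
    (b := fun t => a t * nextTerm n a y q t + (1 + nextTerm n a y q t) * (n * a t))
    Real.pi_pos le_rfl (by simpa using hA.const_sub 1)
    (hg.congr fun t => by ring) hb (by nlinarith) fun t ht => by
      have hs := (Real.sin_pos_of_pos_of_lt_pi ht.1 ht.2).ne'
      refine ((h.deriv_nextTerm hn ht).const_sub 1).congr_deriv ?_
      field_simp
      ring
  refine ⟨_, div_pos hp (by nlinarith), lim, ?_⟩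
  have h5 := ((h2.add tendsto_one_sub_cos).sub (h1.mul hA)).sub lim
  have e : 2 * n * k + 1 / 2 - k * 1 - 1 * (2 * n * k + 1 / 2 - k) /
      (1 * 1 + (1 + 1) * (n * 1) + 2) = 2 * (n + 1) * (1 * (2 * n * k + 1 / 2 - k) /
      (1 * 1 + (1 + 1) * (n * 1) + 2)) := by
    have : 1 * 1 + (1 + 1) * (n * 1) + 2 ≠ 0 := by linarith
    field_simp
    ring
  rw [e] at h5
  exact h5.congr fun t => by ring

/-- At a zero of the next term its derivative is n·a / sin t > 0. -/
theorem nextTerm_pos (h : BorderData n a y q) (hn : 1 ≤ n) :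
    ∀ t ∈ Ioo 0 Real.pi, 0 < nextTerm n a y q t := by
  refine pos_of_deriv_pos ((h.tendsto_nextTerm hn).eventually_const_lt one_pos)
    (fun t ht => h.deriv_nextTerm hn ht) fun t ht e => ?_
  have hs := Real.sin_pos_of_pos_of_lt_pi ht.1 ht.2
  have := h.a_pos t ht
  rw [e]
  refine div_pos ?_ hs
  simp only [neg_zero, zero_mul, zero_add, ne_eq, OfNat.ofNat_ne_zero, not_false_eq_true, zero_pow,
    sub_zero, one_mul]
  positivity

theorem nextTerm_lt (h : BorderData n a y q) (hn : 1 ≤ n) {t : ℝ} (ht : t ∈ Ioo 0 Real.pi) :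
    nextTerm n a y q t < 1 := by
  obtain ⟨k, hk, h1, -⟩ := h.lim_next hn
  rw [← sub_pos]
  refine pos_of_deriv_pos (f := fun t => 1 - nextTerm n a y q t) ?_
    (fun t ht => (h.deriv_nextTerm hn ht).const_sub 1) (fun t ht e => ?_) t ht
  · filter_upwards [h1.eventually_const_lt hk, self_mem_nhdsWithin] with t h2 ht
    have : (0 : ℝ) < t ^ 2 := pow_pos ht 2
    simpa using (div_pos_iff_of_pos_right this).1 h2
  · have hs := Real.sin_pos_of_pos_of_lt_pi ht.1 ht.2
    have e1 : nextTerm n a y q t = 1 := by linarith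
    have hq := h.next_quad' hn ht
    rw [e1] at hq ⊢
    have ha := h.a_pos t ht
    have ha' := h.a_lt t ht
    have hq1 := h.q_pos t ht
    have hq2 := h.q_lt t ht
    rw [← neg_div]
    refine div_pos ?_ hs
    -- Where the next term equals 1, the quadratic reads 2na(q + a - (n+1)cos t) = (n+1)² - (q+a)²,
    -- and q + a < n+1. The first bracket divided by sin t is the derivative of 1 - A.
    have : 0 < (q t + a t * 1 - (n + 1) * Real.cos t) * (n * a t) := by nlinarith
    have := (pos_iff_pos_of_mul_pos this).2 (by positivity)
    nlinarith

theorem next (h : BorderData n a y q) (hn : 1 ≤ n) :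
    BorderData (n + 1) (nextTerm n a y q) (fun t => n * a t)
      (fun t => q t + a t * nextTerm n a y q t) where
  a_pos := h.nextTerm_pos hn
  a_lt _ ht := h.nextTerm_lt hn ht
  q_pos t ht := add_pos (h.q_pos t ht) (mul_pos (h.a_pos t ht) (h.nextTerm_pos hn t ht))
  q_lt t ht := by
    nlinarith [h.q_lt t ht, h.a_pos t ht, h.a_lt t ht, h.nextTerm_pos hn t ht, h.nextTerm_lt hn ht]
  quad _ ht := h.next_quad' hn ht
  deriv_a _ ht := h.deriv_nextTerm hn ht
  deriv_q _ ht := h.deriv_nextSum hn ht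
  deriv_y _ ht := h.deriv_nextPrev hn ht
  lim := h.lim_next hn
  lim_y := by
    obtain ⟨k, -, h1, -⟩ := h.lim
    have h3 : Tendsto a (𝓝[>] 0) (𝓝 1) := by
      simpa using (tendsto_zero_of_div_sq h1).const_sub 1
    simpa using h3.const_mul n

/-- The border equation in normalized form. -/
theorem borderEq (h : BorderData n a y q) {t : ℝ} (ht : t ∈ Ioo 0 Real.pi) :
    BorderEq t (n * a t) (nextRadius n a y q t) (q t / a t) (y t) := by
  have h1 := h.next_add ht
  have h2 := h.next_mul ht
  have h3 := (h.one_sub_pos ht).ne'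
  have h4 := (h.a_pos t ht).ne'
  obtain ⟨S, hS⟩ : ∃ S, q t = a t * S := ⟨q t / a t, by field_simp⟩
  rw [hS, mul_div_cancel_left₀ _ h4]
  rw [hS] at h1 h2
  unfold BorderEq
  generalize nextRadius n a y q t = x at *
  refine mul_left_cancel₀ (mul_ne_zero (pow_ne_zero 2 h4) h3) ?_
  linear_combination (n ^ 2 * a t ^ 4 - (a t * S) ^ 2) * h1 -
    2 * a t * (a t * S - n * a t ^ 2 * Real.cos t) * h2

/-- With R = n·a, a vanishing coefficient and `quad` would give (1-a²)(R² + 2Ry cos t + y²) = 0, but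
the second factor is (R sin t)² + (R cos t + y)² > 0. -/
theorem borderCoeff_ne (h : BorderData n a y q) (hn : 1 ≤ n) {t : ℝ} (ht : t ∈ Ioo 0 Real.pi) :
    borderCoeff t (n * a t) (q t / a t) (y t) ≠ 0 := by
  have h2 := h.quad t ht
  have h3 := h.one_sub_pos ht
  have h4 := (h.a_pos t ht)
  obtain ⟨S, hS⟩ : ∃ S, q t = a t * S := ⟨q t / a t, by field_simp⟩
  rw [hS, mul_div_cancel_left₀ _ h4.ne']
  rw [hS] at h2
  unfold borderCoeff
  intro e
  have hs := Real.sin_pos_of_pos_of_lt_pi ht.1 ht.2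
  have : (n * a t) ^ 2 + 2 * (n * a t) * Real.cos t * y t + y t ^ 2 =
      (n * a t * Real.sin t) ^ 2 + (n * a t * Real.cos t + y t) ^ 2 := by
    linear_combination -(n * a t) ^ 2 * Real.sin_sq_add_cos_sq t
  have hp : 0 < (n * a t) ^ 2 + 2 * (n * a t) * Real.cos t * y t + y t ^ 2 := by
    rw [this]; positivity
  have := mul_pos h3 hp
  refine this.ne' ?_
  linear_combination h2 - a t ^ 2 * e

end BorderData

/-- The functions `a, y, q` of `BorderData` for the index `k + 1`. -/
noncomputable def borderState : ℕ → (ℝ → ℝ) × (ℝ → ℝ) × (ℝ → ℝ)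
  | 0 => (fun t => Real.sin t / t, fun _ => 0, fun t => Real.sin t / t)
  | k + 1 =>
    let s := borderState k
    (nextTerm (k + 1) s.1 s.2.1 s.2.2, fun t => (k + 1) * s.1 t,
      fun t => s.2.2 t + s.1 t * nextTerm (k + 1) s.1 s.2.1 s.2.2 t)

theorem borderData_state (k : ℕ) :
    BorderData (k + 1) (borderState k).1 (borderState k).2.1 (borderState k).2.2 := by
  induction k with
  | zero => simpa [borderState] using borderData_one
  | succ k ih =>
    push_cast
    exact ih.next (by have : (0 : ℝ) ≤ k := k.cast_nonneg; linarith)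

/-- The radii on a border line with angle `θ`. -/
noncomputable def borderRadius (θ : ℝ) : ℕ → ℝ
  | 0 => 0
  | k + 1 => (k + 1) * (borderState k).1 θ

theorem borderState_prev (θ : ℝ) (k : ℕ) : (borderState k).2.1 θ = borderRadius θ k := by
  cases k <;> simp [borderState, borderRadius]

theorem borderRadius_succ_succ (θ : ℝ) (k : ℕ) : borderRadius θ (k + 2) =
    nextRadius (k + 1) (borderState k).1 (borderState k).2.1 (borderState k).2.2 θ := by
  rw [BorderData.nextRadius_eq (by have : (0 : ℝ) ≤ k := k.cast_nonneg; linarith), borderRadius,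
    borderState]
  push_cast
  ring

/-- Next to the diagonal the radius is q/a: in this form the six-radii recursion becomes the
additive recursion of q. -/
theorem radii_borderRadius {θ : ℝ} (hθ : θ ∈ Ioo 0 Real.pi) (k : ℕ) :
    radii (borderRadius θ) 1 k = (borderState k).2.2 θ / (borderState k).1 θ := by
  have hd := borderData_state
  induction k with
  | zero =>
    rw [radii, borderState, div_self]
    · simp
    · exact ((hd 0).a_pos θ hθ).ne'
  | succ k ih =>
    have ha := (hd k).a_pos θ hθ
    have hq := (hd k).q_pos θ hθ
    have hA := (hd (k + 1)).a_pos θ hθ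
    have e : (borderState (k + 1)).2.2 θ =
      (borderState k).2.2 θ + (borderState k).1 θ * (borderState (k + 1)).1 θ := rfl
    rw [radii, radii, radii, ih, e, borderRadius, borderRadius]
    generalize (borderState k).1 θ = a at *
    generalize (borderState k).2.2 θ = q at *
    generalize (borderState (k + 1)).1 θ = A at *
    have hden : 0 < (k + 2) * (a * A) + q := by positivity
    have e1 : (1 - (k + 1) * relDiff (((k + 1 : ℕ) + 1) * A) (q / a)) / (k + 2 * (0 : ℕ) + 2) =
        (q - k * (a * A)) / ((k + 2) * (a * A) + q) := by
      have : ((k : ℝ) + 2) ≠ 0 := by positivity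
      have : (((k + 1 : ℕ) + 1) * A + q / a : ℝ) = ((k + 2) * (a * A) + q) / a := by
        field_simp; push_cast; ring
      rw [relDiff, this]
      field_simp
      push_cast
      ring
    rw [e1]
    have e2 : 1 + (q - k * (a * A)) / ((k + 2) * (a * A) + q) =
      2 * (q + a * A) / ((k + 2) * (a * A) + q) := by
      field_simp; ring
    have e3 : 1 - (q - k * (a * A)) / ((k + 2) * (a * A) + q) =
      2 * ((k + 1) * (a * A)) / ((k + 2) * (a * A) + q) := by
      field_simp; ring
    have : (k : ℝ) + 1 ≠ 0 := by positivity
    rw [e2, e3]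
    field_simp

theorem borderSequence {θ : ℝ} (hθ : θ ∈ Ioo 0 Real.pi) : BorderSequence θ (borderRadius θ) where
  zero := rfl
  one := by simp [borderRadius, borderState]
  pos n := by
    rw [borderRadius]
    have := (borderData_state n).a_pos θ hθ
    positivity
  border n := by
    rw [radii_borderRadius hθ, borderRadius_succ_succ, ← borderState_prev θ n]
    exact (borderData_state n).borderEq hθ
  coeff n := by
    rw [radii_borderRadius hθ, ← borderState_prev θ n]
    exact (borderData_state n).borderCoeff_ne (by simp) hθ

theorem exists_radiusPattern {α₁ α₂ α₃ : ℝ} (hα₁ : 0 < α₁) (hα₂ : 0 < α₂) (hα₃ : 0 < α₃)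
    (hsum : α₁ + α₂ + α₃ = Real.pi) : ∃ ρ, RadiusPattern α₁ α₂ α₃ ρ :=
  have h := borderSequence (θ := α₃) ⟨hα₃, by linarith⟩
  have h' := borderSequence (θ := α₂) ⟨hα₂, by linarith⟩
  (spaceData hα₁ hα₂ hα₃ hsum h h').radiusPattern h h'


/-! ### Uniqueness in nonnegative coordinates. -/

/-- The equation is affine in `w`, with coefficient tx - sz - uy. If this vanished, eliminating x
would make su(y-z)² + (s+u-t)(s+u+t)yz zero, although it is positive. -/
theorem tri_unique_of_lt {s t u x y z w w' : ℝ} (hs : 0 < s) (hu : 0 < u) (ht : 0 < t)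
    (hstu : t < s + u) (hy : 0 < y) (hz : 0 < z)
    (h : s * (x * y - w * z) + t * (x * w - y * z) + u * (x * z - y * w) = 0)
    (h' : s * (x * y - w' * z) + t * (x * w' - y * z) + u * (x * z - y * w') = 0) : w' = w := by
  have e : (w' - w) * (t * x - s * z - u * y) = 0 := by linear_combination h' - h
  rcases mul_eq_zero.1 e with e | e
  · linarith
  · exfalso
    have h1 : s * u * (y ^ 2 + z ^ 2) + (s ^ 2 + u ^ 2 - t ^ 2) * (y * z) = 0 := by
      linear_combination t * h - (t * w + s * y + u * z) * e
    have h2 : s * u * (y ^ 2 + z ^ 2) + (s ^ 2 + u ^ 2 - t ^ 2) * (y * z) =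
      s * u * (y - z) ^ 2 + (s + u - t) * (s + u + t) * (y * z) := by ring
    have h3 : 0 < s + u - t := by linarith
    have : 0 < s * u * (y - z) ^ 2 + (s + u - t) * (s + u + t) * (y * z) := by positivity
    linarith

theorem border_unique {α r r₁ r₁' r₂ r₃ : ℝ} (hc : borderCoeff α r r₂ r₃ ≠ 0)
    (h : BorderEq α r r₁ r₂ r₃) (h' : BorderEq α r r₁' r₂ r₃) : r₁' = r₁ := by
  unfold BorderEq at h h'
  refine mul_left_cancel₀ hc ?_
  unfold borderCoeff
  linear_combination h' - h

theorem tri_unique {α₁ α₂ α₃ r r' r₁ r₂ r₃ : ℝ}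
    (hd : 0 < r₁ * Real.sin α₃ + r₂ * Real.sin α₁ + r₃ * Real.sin α₂)
    (h : TriEq α₁ α₂ α₃ r r₁ r₂ r₃) (h' : TriEq α₁ α₂ α₃ r' r₁ r₂ r₃) : r' = r := by
  unfold TriEq at h h'
  exact mul_right_cancel₀ hd.ne' (h'.trans h.symm)

theorem sin_lt_add {α β γ : ℝ} (hα : 0 < α) (hβ : 0 < β) (hγ : 0 < γ)
    (hsum : α + β + γ = Real.pi) : Real.sin α < Real.sin β + Real.sin γ := by
  have h1 := Real.sin_pos_of_pos_of_lt_pi hβ (by linarith)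
  have h2 := Real.sin_pos_of_pos_of_lt_pi hγ (by linarith)
  have e : Real.sin α = Real.sin (β + γ) := by
    rw [← Real.sin_pi_sub]; congr 1; linarith
  rw [e, Real.sin_add]
  have c1 : Real.cos β < 1 := by
    rw [← Real.cos_zero]
    exact Real.cos_lt_cos_of_nonneg_of_le_pi le_rfl (by linarith) hβ
  have c2 : Real.cos γ < 1 := by
    rw [← Real.cos_zero]
    exact Real.cos_lt_cos_of_nonneg_of_le_pi le_rfl (by linarith) hγ
  nlinarith

/-- The six-radii equation in nonnegative coordinates, with nonvanishing denominators. -/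
def HexAt (F : ℕ → ℕ → ℕ → ℝ) (a b c : ℕ) : Prop :=
  (a ≠ 0 → F (a + 1) b c + F (a - 1) b c ≠ 0) ∧ (b ≠ 0 → F a (b + 1) c + F a (b - 1) c ≠ 0) ∧
  (c ≠ 0 → F a b (c + 1) + F a b (c - 1) ≠ 0) ∧
  (a : ℝ) * relDiff (F (a + 1) b c) (F (a - 1) b c) +
    b * relDiff (F a (b + 1) c) (F a (b - 1) c) + c * relDiff (F a b (c + 1)) (F a b (c - 1)) = 1

theorem relDiff_left_inj {x x' y : ℝ} (hy : y ≠ 0) (hx : x + y ≠ 0) (hx' : x' + y ≠ 0)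
    (h : relDiff x' y = relDiff x y) : x' = x := by
  rw [relDiff, relDiff, div_eq_div_iff hx' hx] at h
  refine mul_left_cancel₀ hy ?_
  linear_combination h / 2

theorem natCast_mul_congr {k : ℕ} {x y : ℝ} (h : k ≠ 0 → x = y) : (k : ℝ) * x = k * y := by
  rcases eq_or_ne k 0 with rfl | hk
  · simp
  · rw [h hk]

variable {α₁ α₂ α₃ : ℝ} {ρ F : ℕ → ℕ → ℕ → ℝ}

theorem RadiusPattern.hexAt (h : RadiusPattern α₁ α₂ α₃ ρ) {a b c : ℕ}
    (he : ¬ Even (a + b + c)) : HexAt ρ a b c := by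
  have nonneg : ∀ a b c, Even (a + b + c) → 0 ≤ ρ a b c := fun a b c he => by
    by_cases h0 : a + b + c = 0
    · obtain ⟨rfl, rfl, rfl⟩ : a = 0 ∧ b = 0 ∧ c = 0 := by omega
      exact h.origin.ge
    · exact (h.pos a b c he h0).le
  refine ⟨fun h0 => ?_, fun h0 => ?_, fun h0 => ?_, h.hex a b c he⟩
  · have := h.pos (a + 1) b c (by grind) (by omega)
    have := nonneg (a - 1) b c (by grind)
    positivity
  · have := h.pos a (b + 1) c (by grind) (by omega)
    have := nonneg a (b - 1) c (by grind)
    positivity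
  · have := h.pos a b (c + 1) (by grind) (by omega)
    have := nonneg a b (c - 1) (by grind)
    positivity

theorem HexAt.eq_right {a b c : ℕ} (h : HexAt ρ a b c) (h' : HexAt F a b c) (hc : c ≠ 0)
    (h0 : ρ a b (c - 1) ≠ 0) (ha : a ≠ 0 → F (a + 1) b c = ρ (a + 1) b c ∧
      F (a - 1) b c = ρ (a - 1) b c) (hb : b ≠ 0 → F a (b + 1) c = ρ a (b + 1) c ∧
      F a (b - 1) c = ρ a (b - 1) c) (hc' : F a b (c - 1) = ρ a b (c - 1)) :
    F a b (c + 1) = ρ a b (c + 1) := by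
  have d := h.2.2.1 hc
  have d' := h'.2.2.1 hc
  have e := h.2.2.2
  have e' := h'.2.2.2
  rw [hc'] at d' e'
  have ea : (a : ℝ) * relDiff (F (a + 1) b c) (F (a - 1) b c) = a * relDiff (ρ (a + 1) b c)
      (ρ (a - 1) b c) := natCast_mul_congr fun h => by rw [(ha h).1, (ha h).2]
  have eb : (b : ℝ) * relDiff (F a (b + 1) c) (F a (b - 1) c) = b * relDiff (ρ a (b + 1) c)
      (ρ a (b - 1) c) := natCast_mul_congr fun h => by rw [(hb h).1, (hb h).2]
  refine relDiff_left_inj h0 d d' (mul_left_cancel₀ (Nat.cast_ne_zero.2 hc) ?_)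
  linear_combination e' - e - ea - eb

/-- Cyclic relabelling, so that `HexAt.eq_right` can solve in any direction. -/
theorem HexAt.rotate {a b c : ℕ} (h : HexAt F a b c) : HexAt (fun x y z => F z x y) b c a :=
  ⟨h.2.1, h.2.2.1, h.1, by linear_combination h.2.2.2⟩

/-- The equations on the two layers `c = a + b` and `c = a + b + 2`. -/
structure LayerSolution (α₁ α₂ α₃ : ℝ) (F : ℕ → ℕ → ℕ → ℝ) : Prop where
  origin : F 0 0 0 = 0
  hex : ∀ a b, HexAt F a b (a + b + 1)
  tri : ∀ a b, TriEq α₁ α₂ α₃ (F a b (a + b + 2)) (F (a + 1) b (a + b + 1))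
    (F (a + 1) (b + 1) (a + b + 2)) (F a (b + 1) (a + b + 1))
  border₁ : ∀ n, BorderEq α₃ (F (n + 1) 0 (n + 1)) (F (n + 2) 0 (n + 2)) (F n 0 (n + 2)) (F n 0 n)
  border₂ : ∀ n, BorderEq α₂ (F 0 (n + 1) (n + 1)) (F 0 (n + 2) (n + 2)) (F 0 n (n + 2)) (F 0 n n)
  init₁ : F 1 0 1 = Real.sin α₃ / α₃
  init₂ : F 0 1 1 = Real.sin α₂ / α₂
  init₃ : F 0 0 2 = 1

/-- Diagonal by diagonal: on the layer c = a+b the border equations give the two ends and the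
four-radii equation the interior points; the six-radii equation then gives the next diagonal of the
layer c = a+b+2. -/
theorem LayerSolution.unique (hα₁ : 0 < α₁) (hα₂ : 0 < α₂) (hα₃ : 0 < α₃)
    (hsum : α₁ + α₂ + α₃ = Real.pi) (h : RadiusPattern α₁ α₂ α₃ ρ) (hF : LayerSolution α₁ α₂ α₃ F)
    (n : ℕ) : (∀ a b, a + b = n → F a b (a + b) = ρ a b (a + b)) ∧
      (∀ a b, a + b = n → F a b (a + b + 2) = ρ a b (a + b + 2)) ∧
      (∀ a b, a + b = n + 1 → F a b (a + b) = ρ a b (a + b)) := by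
  have s₁ := Real.sin_pos_of_pos_of_lt_pi hα₁ (by linarith)
  have s₂ := Real.sin_pos_of_pos_of_lt_pi hα₂ (by linarith)
  have s₃ := Real.sin_pos_of_pos_of_lt_pi hα₃ (by linarith)
  induction n with
  | zero =>
    refine ⟨fun a b e => ?_, fun a b e => ?_, fun a b e => ?_⟩
    · obtain ⟨rfl, rfl⟩ : a = 0 ∧ b = 0 := by omega
      exact hF.origin.trans h.origin.symm
    · obtain ⟨rfl, rfl⟩ : a = 0 ∧ b = 0 := by omega
      exact hF.init₃.trans h.init₃.symm
    · obtain ⟨rfl, rfl⟩ | ⟨rfl, rfl⟩ : (a = 0 ∧ b = 1) ∨ (a = 1 ∧ b = 0) := by omega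
      · exact hF.init₂.trans h.init₂.symm
      · exact hF.init₁.trans h.init₁.symm
  | succ n ih =>
    obtain ⟨hT, hV, hT'⟩ := ih
    have hT'' : ∀ a b, a + b = n + 2 → F a b (a + b) = ρ a b (a + b) := by
      rintro (_ | a) (_ | b) e
      · omega
      · obtain rfl : b = n + 1 := by omega
        have e₂ := hT 0 n (by omega)
        have e₃ := hV 0 n (by omega)
        have e₄ := hT' 0 (n + 1) (by omega)
        have hb := hF.border₂ n
        simp only [zero_add] at e₂ e₃ e₄ ⊢
        rw [e₂, e₃, e₄] at hb
        exact border_unique (h.coeff₂ n) (h.border₂ n) hb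
      · obtain rfl : a = n + 1 := by omega
        have e₂ := hT n 0 (by omega)
        have e₃ := hV n 0 (by omega)
        have e₄ := hT' (n + 1) 0 (by omega)
        have hb := hF.border₁ n
        simp only [add_zero] at e₂ e₃ e₄ ⊢
        rw [e₂, e₃, e₄] at hb
        exact border_unique (h.coeff₁ n) (h.border₁ n) hb
      · have e₁ := hV a b (by omega)
        have e₂ := hT' (a + 1) b (by omega)
        have e₃ := hT' a (b + 1) (by omega)
        have ht := hF.tri a b
        rw [show a + 1 + b = a + b + 1 by ring] at e₂
        rw [show a + (b + 1) = a + b + 1 by ring] at e₃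
        rw [show a + 1 + (b + 1) = a + b + 2 by ring]
        rw [e₁, e₂, e₃] at ht
        have ht' := h.upper a b (a + b + 1) (by grind)
        unfold TriEq at ht ht'
        exact tri_unique_of_lt s₃ s₂ s₁ (by linarith [sin_lt_add hα₁ hα₂ hα₃ hsum])
          (h.pos (a + 1) b (a + b + 1) (by grind) (by omega))
          (h.pos a (b + 1) (a + b + 1) (by grind) (by omega))
          (x := ρ a b (a + b + 2)) (by linear_combination ht') (by linear_combination ht)
    refine ⟨hT', fun a b e => ?_, hT''⟩
    refine (h.hexAt (a := a) (b := b) (c := a + b + 1) (by grind)).eq_right (hF.hex a b)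
      (by omega) (h.pos _ _ _ (by grind) (by omega)).ne' (fun h0 => ?_) (fun h0 => ?_) ?_
    · obtain ⟨a, rfl⟩ := Nat.exists_eq_succ_of_ne_zero h0
      have e₁ := hT'' (a + 1 + 1) b (by omega)
      have e₂ := hV a b (by omega)
      rw [show a + 1 + 1 + b = a + 1 + b + 1 by ring] at e₁
      rw [show a + b + 2 = a + 1 + b + 1 by ring] at e₂
      exact ⟨e₁, e₂⟩
    · obtain ⟨b, rfl⟩ := Nat.exists_eq_succ_of_ne_zero h0
      have e₁ := hT'' a (b + 1 + 1) (by omega)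
      have e₂ := hV a b (by omega)
      rw [show a + (b + 1 + 1) = a + (b + 1) + 1 by ring] at e₁
      rw [show a + b + 2 = a + (b + 1) + 1 by ring] at e₂
      exact ⟨e₁, e₂⟩
    · exact hT' a b (by omega)

/-- The remaining equations on the whole lattice. -/
structure FullSolution (α₁ α₂ α₃ : ℝ) (F : ℕ → ℕ → ℕ → ℝ) : Prop
    extends LayerSolution α₁ α₂ α₃ F where
  hexAt : ∀ a b c, ¬ Even (a + b + c) → HexAt F a b c
  lower : ∀ a b c, Even (a + b + c) → TriEq α₁ α₂ α₃ (F (a + 1) (b + 1) c)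
    (F a (b + 1) (c + 1)) (F a b c) (F (a + 1) b (c + 1))
  upper : ∀ a b c, ¬ Even (a + b + c) → TriEq α₁ α₂ α₃ (F a b (c + 1))
    (F (a + 1) b c) (F (a + 1) (b + 1) (c + 1)) (F a (b + 1) c)

theorem FullSolution.unique_above (hα₁ : 0 < α₁) (hα₂ : 0 < α₂) (hα₃ : 0 < α₃)
    (hsum : α₁ + α₂ + α₃ = Real.pi) (h : RadiusPattern α₁ α₂ α₃ ρ) (hF : FullSolution α₁ α₂ α₃ F)
    (k : ℕ) : ∀ a b, F a b (a + b + 2 * k) = ρ a b (a + b + 2 * k) := by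
  have s₁ := Real.sin_pos_of_pos_of_lt_pi hα₁ (by linarith)
  have s₂ := Real.sin_pos_of_pos_of_lt_pi hα₂ (by linarith)
  have s₃ := Real.sin_pos_of_pos_of_lt_pi hα₃ (by linarith)
  induction k with
  | zero =>
    intro a b
    exact (hF.toLayerSolution.unique hα₁ hα₂ hα₃ hsum h _).1 a b rfl
  | succ k ih =>
    intro a b
    have e₁ := ih (a + 1) b
    have e₂ := ih (a + 1) (b + 1)
    have e₃ := ih a (b + 1)
    rw [show a + 1 + b + 2 * k = a + b + 2 * k + 1 by ring] at e₁
    rw [show a + 1 + (b + 1) + 2 * k = a + b + 2 * k + 1 + 1 by ring] at e₂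
    rw [show a + (b + 1) + 2 * k = a + b + 2 * k + 1 by ring] at e₃
    have ht := hF.upper a b (a + b + 2 * k + 1) (by grind)
    rw [e₁, e₂, e₃] at ht
    refine tri_unique ?_ (h.upper a b (a + b + 2 * k + 1) (by grind)) ht
    have := h.pos (a + 1) b (a + b + 2 * k + 1) (by grind) (by omega)
    have := h.pos (a + 1) (b + 1) (a + b + 2 * k + 1 + 1) (by grind) (by omega)
    have := h.pos a (b + 1) (a + b + 2 * k + 1) (by grind) (by omega)
    positivity

/-- Interior points follow from the lower four-radii equation. On the faces a = 0 and b = 0 that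
equation is unavailable, and the six-radii equation is propagated along the face instead. -/
theorem FullSolution.unique_below (hα₁ : 0 < α₁) (hα₂ : 0 < α₂) (hα₃ : 0 < α₃)
    (hsum : α₁ + α₂ + α₃ = Real.pi) (h : RadiusPattern α₁ α₂ α₃ ρ) (hF : FullSolution α₁ α₂ α₃ F)
    (k : ℕ) : ∀ a b c, a + b = c + 2 * k → F a b c = ρ a b c := by
  have s₁ := Real.sin_pos_of_pos_of_lt_pi hα₁ (by linarith)
  have s₂ := Real.sin_pos_of_pos_of_lt_pi hα₂ (by linarith)
  have s₃ := Real.sin_pos_of_pos_of_lt_pi hα₃ (by linarith)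
  induction k with
  | zero =>
    rintro a b c e
    obtain rfl : c = a + b := by omega
    exact (hF.toLayerSolution.unique hα₁ hα₂ hα₃ hsum h _).1 a b rfl
  | succ k ih =>
    have inner : ∀ a b c, a + b = c + 2 * k → F (a + 1) (b + 1) c = ρ (a + 1) (b + 1) c := by
      intro a b c e
      have ht := hF.lower a b c (by grind)
      rw [ih a (b + 1) (c + 1) (by omega), ih a b c e, ih (a + 1) b (c + 1) (by omega)] at ht
      refine tri_unique ?_ (h.lower a b c (by grind)) ht
      have := h.pos a (b + 1) (c + 1) (by grind) (by omega)
      have := h.pos (a + 1) b (c + 1) (by grind) (by omega)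
      have : 0 ≤ ρ a b c := by
        by_cases h0 : a + b + c = 0
        · obtain ⟨rfl, rfl, rfl⟩ : a = 0 ∧ b = 0 ∧ c = 0 := by omega
          exact h.origin.ge
        · exact (h.pos a b c (by grind) h0).le
      positivity
    have left : ∀ c, F (c + 2 * k + 2) 0 c = ρ (c + 2 * k + 2) 0 c := by
      intro c
      induction c with
      | zero =>
        rcases Nat.eq_zero_or_pos k with rfl | hk
        -- At (1, 0, 0) the six-radii equation is empty: the radius at the origin is 0, and the
        -- relative difference of any nonzero x and 0 is 1. A four-radii equation determines the
        -- value at (2, 0, 0).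
        · have ht := hF.upper 1 0 0 (by decide)
          have ht' := h.upper 1 0 0 (by decide)
          rw [ih 1 0 1 rfl, inner 1 0 1 rfl, inner 0 0 0 rfl] at ht
          unfold TriEq at ht ht'
          exact tri_unique_of_lt s₁ s₂ s₃ (by linarith [sin_lt_add hα₃ hα₁ hα₂ (by linarith)])
            (h.pos 2 1 1 (by decide) (by omega)) (h.pos 1 1 0 (by decide) (by omega))
            (x := ρ 1 0 1) (by linear_combination ht') (by linear_combination ht)
        · have := (h.hexAt (a := 2 * k + 1) (b := 0) (c := 0) (by grind)).rotate.eq_right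
            (hF.hexAt (2 * k + 1) 0 0 (by grind)).rotate (by omega)
            (h.pos (2 * k) 0 0 (by grind) (by omega)).ne' (by simp) (by simp)
            (ih (2 * k) 0 0 (by omega))
          rw [show 0 + 2 * k + 2 = 2 * k + 1 + 1 by ring]
          exact this
      | succ c ihc =>
        have := (h.hexAt (a := c + 2 * k + 2) (b := 0) (c := c + 1) (by grind)).rotate.eq_right
          (hF.hexAt (c + 2 * k + 2) 0 (c + 1) (by grind)).rotate (by omega)
          (h.pos (c + 2 * k + 1) 0 (c + 1) (by grind) (by omega)).ne' (by simp)
          (fun _ => ⟨ih _ _ _ (by omega), ihc⟩) (ih (c + 2 * k + 1) 0 (c + 1) (by omega))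
        rw [show c + 1 + 2 * k + 2 = c + 2 * k + 2 + 1 by ring]
        exact this
    have right : ∀ c, F 0 (c + 2 * k + 2) c = ρ 0 (c + 2 * k + 2) c := by
      intro c
      induction c with
      | zero =>
        rcases Nat.eq_zero_or_pos k with rfl | hk
        · have ht := hF.upper 0 1 0 (by decide)
          have ht' := h.upper 0 1 0 (by decide)
          rw [ih 0 1 1 rfl, inner 0 1 1 rfl, inner 0 0 0 rfl] at ht
          unfold TriEq at ht ht'
          exact tri_unique_of_lt s₁ s₃ s₂ (by linarith [sin_lt_add hα₂ hα₃ hα₁ (by linarith)])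
            (h.pos 1 2 1 (by decide) (by omega)) (h.pos 1 1 0 (by decide) (by omega))
            (x := ρ 0 1 1) (by linear_combination ht') (by linear_combination ht)
        · have := (h.hexAt (a := 0) (b := 2 * k + 1) (c := 0) (by grind)).rotate.rotate.eq_right
            (hF.hexAt 0 (2 * k + 1) 0 (by grind)).rotate.rotate (by omega)
            (h.pos 0 (2 * k) 0 (by grind) (by omega)).ne' (by simp) (by simp)
            (ih 0 (2 * k) 0 (by omega))
          rw [show 0 + 2 * k + 2 = 2 * k + 1 + 1 by ring]
          exact this
      | succ c ihc =>
        have := (h.hexAt (a := 0) (b := c + 2 * k + 2) (c := c + 1) (by grind)).rotate.rotate.eq_right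
          (hF.hexAt 0 (c + 2 * k + 2) (c + 1) (by grind)).rotate.rotate (by omega)
          (h.pos 0 (c + 2 * k + 1) (c + 1) (by grind) (by omega)).ne'
          (fun _ => ⟨ih _ _ _ (by omega), ihc⟩) (by simp) (ih 0 (c + 2 * k + 1) (c + 1) (by omega))
        rw [show c + 1 + 2 * k + 2 = c + 2 * k + 2 + 1 by ring]
        exact this
    rintro (_ | a) (_ | b) c e
    · omega
    · obtain rfl : b = c + 2 * k + 1 := by omega
      exact right c
    · obtain rfl : a = c + 2 * k + 1 := by omega
      exact left c
    · exact inner a b c (by omega)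

theorem FullSolution.unique (hα₁ : 0 < α₁) (hα₂ : 0 < α₂) (hα₃ : 0 < α₃)
    (hsum : α₁ + α₂ + α₃ = Real.pi) (h : RadiusPattern α₁ α₂ α₃ ρ) (hF : FullSolution α₁ α₂ α₃ F)
    {a b c : ℕ} (he : Even (a + b + c)) : F a b c = ρ a b c := by
  rcases le_total (a + b) c with hle | hle
  · obtain ⟨d, rfl⟩ := Nat.exists_eq_add_of_le hle
    obtain ⟨k, rfl⟩ : ∃ k, d = 2 * k := ⟨d / 2, by grind⟩
    exact hF.unique_above hα₁ hα₂ hα₃ hsum h k a b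
  · obtain ⟨d, hd⟩ := Nat.exists_eq_add_of_le hle
    obtain ⟨k, rfl⟩ : ∃ k, d = 2 * k := ⟨d / 2, by grind⟩
    exact hF.unique_below hα₁ hα₂ hα₃ hsum h k a b c hd


/-! ### Translation between the two coordinate systems. -/

/-- `F` is the function `r` in nonnegative coordinates. -/
def Represents (F : ℕ → ℕ → ℕ → ℝ) (r : ℤ → ℤ → ℤ → ℝ) : Prop :=
  ∀ (K L M : ℤ) (a b c : ℕ), L + M = -a → M + K = -b → K + L = c → r K L M = F a b c

theorem represents_toNat (F : ℕ → ℕ → ℕ → ℝ) :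
    Represents F fun K L M => F (-(L + M)).toNat (-(M + K)).toNat (K + L).toNat := by
  intro K L M a b c h₁ h₂ h₃
  simp only [h₁, h₂, h₃, neg_neg, Int.toNat_natCast]

theorem exists_represents (r : ℤ → ℤ → ℤ → ℝ) : ∃ F, Represents F r := by
  -- The divisions are exact whenever a, b, c come from a lattice point; the other values of F are
  -- irrelevant.
  refine ⟨fun a b c => r (((c : ℤ) + a - b) / 2) (((c : ℤ) + b - a) / 2) (-(((a : ℤ) + b + c) / 2)),
    fun K L M a b c h₁ h₂ h₃ => ?_⟩
  congr 1 <;> omega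

theorem InQ.exists_nat {K L M : ℤ} (h : InQ K L M) : ∃ a b c : ℕ, L + M = -a ∧ M + K = -b ∧
    K + L = c ∧ Even (a + b + c) := by
  obtain ⟨h₁, h₂, h₃⟩ := h
  refine ⟨(-(L + M)).toNat, (-(M + K)).toNat, (K + L).toNat, by omega, by omega, by omega, ?_⟩
  rw [Nat.even_iff]
  omega

/-- The three coefficients have odd sum, so some term occurs, and membership of its two vertices
already forces all three sign conditions. -/
theorem HexPatternIn.exists_nat {K L M : ℤ} (h : HexPatternIn InQ K L M) :
    ∃ a b c : ℕ, L + M + 1 = -a ∧ M + K + 1 = -b ∧ K + L + 1 = c ∧ ¬ Even (a + b + c) := by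
  simp only [HexPatternIn, InQ] at h
  have h' : L + M + 1 ≤ 0 ∧ M + K + 1 ≤ 0 ∧ 0 ≤ K + L + 1 := by
    obtain ⟨h₁, h₂, h₃⟩ := h
    by_cases e₁ : L + M + 1 = 0
    · by_cases e₂ : M + K + 1 = 0
      · have := h₃ (by omega)
        omega
      · have := h₂ e₂
        omega
    · have := h₁ e₁
      omega
  obtain ⟨h₁, h₂, h₃⟩ := h'
  refine ⟨(-(L + M + 1)).toNat, (-(M + K + 1)).toNat, (K + L + 1).toNat, by omega, by omega,
    by omega, ?_⟩
  rw [Nat.even_iff]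
  omega

/-- The guards matter: for a = 0 the truncated a-1 is 0, while the vertex it would stand for lies
outside the lattice. The same holds for b and c. -/
theorem Represents.hexEq_iff {F : ℕ → ℕ → ℕ → ℝ} {r : ℤ → ℤ → ℤ → ℝ} (hr : Represents F r)
    {K L M : ℤ} {a b c : ℕ} (h₁ : L + M + 1 = -a) (h₂ : M + K + 1 = -b) (h₃ : K + L + 1 = c) :
    HexEq 2 r K L M ↔ HexAt F a b c := by
  have ea : a ≠ 0 → r K (L + 1) (M + 1) = F (a - 1) b c ∧ r (K + 1) L M = F (a + 1) b c :=
    fun h => ⟨hr _ _ _ _ _ _ (by omega) (by omega) (by omega),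
      hr _ _ _ _ _ _ (by omega) (by omega) (by omega)⟩
  have eb : b ≠ 0 → r (K + 1) L (M + 1) = F a (b - 1) c ∧ r K (L + 1) M = F a (b + 1) c :=
    fun h => ⟨hr _ _ _ _ _ _ (by omega) (by omega) (by omega),
      hr _ _ _ _ _ _ (by omega) (by omega) (by omega)⟩
  have ec : c ≠ 0 → r K L (M + 1) = F a b (c - 1) ∧ r (K + 1) (L + 1) M = F a b (c + 1) :=
    fun h => ⟨hr _ _ _ _ _ _ (by omega) (by omega) (by omega),
      hr _ _ _ _ _ _ (by omega) (by omega) (by omega)⟩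
  have ta : (a : ℝ) * ((r K (L + 1) (M + 1) - r (K + 1) L M) /
      (r K (L + 1) (M + 1) + r (K + 1) L M)) = a * -relDiff (F (a + 1) b c) (F (a - 1) b c) :=
    natCast_mul_congr fun h => by
      rw [(ea h).1, (ea h).2, relDiff, ← neg_div, neg_sub, add_comm (F (a + 1) b c)]
  have tb : (b : ℝ) * ((r (K + 1) L (M + 1) - r K (L + 1) M) /
      (r (K + 1) L (M + 1) + r K (L + 1) M)) = b * -relDiff (F a (b + 1) c) (F a (b - 1) c) :=
    natCast_mul_congr fun h => by
      rw [(eb h).1, (eb h).2, relDiff, ← neg_div, neg_sub, add_comm (F a (b + 1) c)]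
  have tc : (c : ℝ) * ((r (K + 1) (L + 1) M - r K L (M + 1)) /
      (r (K + 1) (L + 1) M + r K L (M + 1))) = c * relDiff (F a b (c + 1)) (F a b (c - 1)) :=
    natCast_mul_congr fun h => by rw [(ec h).1, (ec h).2, relDiff]
  rw [HexEq, HexAt, h₁, h₂, h₃]
  push_cast
  rw [neg_mul, neg_mul, ta, tb, tc]
  refine and_congr ?_ (and_congr ?_ (and_congr ?_ ?_))
  · rw [neg_ne_zero, Nat.cast_ne_zero]
    exact forall_congr' fun h => by rw [(ea h).1, (ea h).2, add_comm]
  · rw [neg_ne_zero, Nat.cast_ne_zero]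
    exact forall_congr' fun h => by rw [(eb h).1, (eb h).2, add_comm]
  · rw [Nat.cast_ne_zero]
    exact forall_congr' fun h => by rw [(ec h).1, (ec h).2]
  · norm_num

theorem IsRadiusSolution.mono {α₁ α₂ α₃ c : ℝ} {D D' : ℤ → ℤ → ℤ → Prop} {r : ℤ → ℤ → ℤ → ℝ}
    (h : IsRadiusSolution α₁ α₂ α₃ c D r) (hD : ∀ K L M, D' K L M → D K L M) :
    IsRadiusSolution α₁ α₂ α₃ c D' r where
  border_I K h₁ h₂ h₃ h₄ := h.border_I K (hD _ _ _ h₁) (hD _ _ _ h₂) (hD _ _ _ h₃) (hD _ _ _ h₄)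
  border_II K h₁ h₂ h₃ h₄ := h.border_II K (hD _ _ _ h₁) (hD _ _ _ h₂) (hD _ _ _ h₃) (hD _ _ _ h₄)
  hex K L M hp := h.hex K L M
    ⟨fun e => ⟨hD _ _ _ (hp.1 e).1, hD _ _ _ (hp.1 e).2⟩,
      fun e => ⟨hD _ _ _ (hp.2.1 e).1, hD _ _ _ (hp.2.1 e).2⟩,
      fun e => ⟨hD _ _ _ (hp.2.2 e).1, hD _ _ _ (hp.2.2 e).2⟩⟩
  tri K L M h₁ h₂ h₃ h₄ := h.tri K L M (hD _ _ _ h₁) (hD _ _ _ h₂) (hD _ _ _ h₃) (hD _ _ _ h₄)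

variable {α₁ α₂ α₃ : ℝ} {ρ F : ℕ → ℕ → ℕ → ℝ} {r : ℤ → ℤ → ℤ → ℝ}

theorem RadiusPattern.isRadiusSolution (h : RadiusPattern α₁ α₂ α₃ ρ) (hr : Represents ρ r) :
    IsRadiusSolution α₁ α₂ α₃ 2 InQ r where
  border_I K _ _ h₃ _ := by
    -- The vertex (K, 1, -K) belongs to the lattice only if K ≥ 1.
    obtain ⟨n, hn⟩ : ∃ n : ℕ, K = n + 1 := ⟨(K - 1).toNat, by have := h₃.1; omega⟩
    rw [hr K 0 (-K) (n + 1) 0 (n + 1) (by omega) (by omega) (by omega),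
      hr (K + 1) 0 (-K - 1) (n + 2) 0 (n + 2) (by omega) (by omega) (by omega),
      hr K 1 (-K) n 0 (n + 2) (by omega) (by omega) (by omega),
      hr (K - 1) 0 (-K + 1) n 0 n (by omega) (by omega) (by omega)]
    exact h.border₁ n
  border_II L _ _ h₃ _ := by
    obtain ⟨n, hn⟩ : ∃ n : ℕ, L = n + 1 := ⟨(L - 1).toNat, by have := h₃.2.1; omega⟩
    rw [hr 0 L (-L) 0 (n + 1) (n + 1) (by omega) (by omega) (by omega),
      hr 0 (L + 1) (-L - 1) 0 (n + 2) (n + 2) (by omega) (by omega) (by omega),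
      hr 1 L (-L) 0 n (n + 2) (by omega) (by omega) (by omega),
      hr 0 (L - 1) (-L + 1) 0 n n (by omega) (by omega) (by omega)]
    exact h.border₂ n
  hex K L M hp := by
    obtain ⟨a, b, c, h₁, h₂, h₃, he⟩ := hp.exists_nat
    exact (hr.hexEq_iff h₁ h₂ h₃).2 (h.hexAt he)
  tri K L M h₁ h₂ h₃ h₄ := by
    obtain ⟨a, b, c, e₁, e₂, e₃, he⟩ := h₁.exists_nat
    obtain ⟨c, rfl⟩ : ∃ d, c = d + 1 := ⟨c - 1, by have := h₂.2.2; omega⟩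
    push_cast at e₃
    rw [hr K L M a b (c + 1) (by omega) (by omega) (by omega),
      hr K (L - 1) M (a + 1) b c (by omega) (by omega) (by omega),
      hr K L (M - 1) (a + 1) (b + 1) (c + 1) (by omega) (by omega) (by omega),
      hr (K - 1) L M a (b + 1) c (by omega) (by omega) (by omega)]
    exact h.upper a b c (by grind)

theorem RadiusPattern.satisfiesOppositeTri (h : RadiusPattern α₁ α₂ α₃ ρ)
    (hr : Represents ρ r) : SatisfiesOppositeTri α₁ α₂ α₃ InQ r := by
  intro K L M h₁ h₂ h₃ h₄
  obtain ⟨a, b, c, e₁, e₂, e₃, he⟩ := h₁.exists_nat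
  obtain ⟨a, rfl⟩ : ∃ d, a = d + 1 := ⟨a - 1, by have := h₂.1; omega⟩
  obtain ⟨b, rfl⟩ : ∃ d, b = d + 1 := ⟨b - 1, by have := h₃.2.1; omega⟩
  push_cast at e₁ e₂
  rw [hr K L M (a + 1) (b + 1) c (by omega) (by omega) (by omega),
    hr K (L + 1) M a (b + 1) (c + 1) (by omega) (by omega) (by omega),
    hr K L (M + 1) a b c (by omega) (by omega) (by omega),
    hr (K + 1) L M (a + 1) b (c + 1) (by omega) (by omega) (by omega)]
  exact h.lower a b c (by grind)

theorem RadiusPattern.hasInitialData (h : RadiusPattern α₁ α₂ α₃ ρ) (hr : Represents ρ r) :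
    HasInitialData α₂ α₃ r := by
  refine ⟨?_, ?_, ?_, ?_⟩
  · rw [hr 0 0 0 0 0 0 rfl rfl rfl, h.origin]
  · rw [hr 1 0 (-1) 1 0 1 rfl rfl rfl, h.init₁]
  · rw [hr 0 1 (-1) 0 1 1 rfl rfl rfl, h.init₂]
  · rw [hr 1 1 (-1) 0 0 2 rfl rfl rfl, h.init₃]

theorem IsRadiusSolution.layerSolution (h : IsRadiusSolution α₁ α₂ α₃ 2 InQH r)
    (hi : HasInitialData α₂ α₃ r) (hr : Represents F r) : LayerSolution α₁ α₂ α₃ F where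
  origin := by rw [← hr 0 0 0 0 0 0 rfl rfl rfl]; exact hi.1
  init₁ := by rw [← hr 1 0 (-1) 1 0 1 rfl rfl rfl]; exact hi.2.1
  init₂ := by rw [← hr 0 1 (-1) 0 1 1 rfl rfl rfl]; exact hi.2.2.1
  init₃ := by rw [← hr 1 1 (-1) 0 0 2 rfl rfl rfl]; exact hi.2.2.2
  hex a b := by
    refine (hr.hexEq_iff (K := a) (L := b) (M := -a - b - 1) (by omega) (by omega)
      (by push_cast; omega)).1 (h.hex _ _ _ ?_)
    simp only [HexPatternIn, InQH, InQ]
    omega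
  tri a b := by
    rw [← hr (a + 1) (b + 1) (-a - b - 1) a b (a + b + 2) (by omega) (by omega)
        (by push_cast; omega),
      ← hr (a + 1) b (-a - b - 1) (a + 1) b (a + b + 1) (by omega) (by omega)
        (by push_cast; omega),
      ← hr (a + 1) (b + 1) (-a - b - 2) (a + 1) (b + 1) (a + b + 2) (by omega) (by omega)
        (by push_cast; omega),
      ← hr a (b + 1) (-a - b - 1) a (b + 1) (a + b + 1) (by omega) (by omega)
        (by push_cast; omega)]
    have := h.tri (a + 1) (b + 1) (-a - b - 1)
    simp only [InQH, InQ, add_sub_cancel_right] at this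
    rw [show (-a - b - 1 - 1 : ℤ) = -a - b - 2 by ring] at this
    exact this (by omega) (by omega) (by omega) (by omega)
  border₁ n := by
    rw [← hr (n + 1) 0 (-(n + 1)) (n + 1) 0 (n + 1) (by omega) (by omega) (by omega),
      ← hr (n + 1 + 1) 0 (-(n + 1) - 1) (n + 2) 0 (n + 2) (by omega) (by omega) (by omega),
      ← hr (n + 1) 1 (-(n + 1)) n 0 (n + 2) (by omega) (by omega) (by omega),
      ← hr (n + 1 - 1) 0 (-(n + 1) + 1) n 0 n (by omega) (by omega) (by omega)]
    refine h.border_I (n + 1) ?_ ?_ ?_ ?_ <;> simp only [InQH, InQ] <;> omega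
  border₂ n := by
    rw [← hr 0 (n + 1) (-(n + 1)) 0 (n + 1) (n + 1) (by omega) (by omega) (by omega),
      ← hr 0 (n + 1 + 1) (-(n + 1) - 1) 0 (n + 2) (n + 2) (by omega) (by omega) (by omega),
      ← hr 1 (n + 1) (-(n + 1)) 0 n (n + 2) (by omega) (by omega) (by omega),
      ← hr 0 (n + 1 - 1) (-(n + 1) + 1) 0 n n (by omega) (by omega) (by omega)]
    refine h.border_II (n + 1) ?_ ?_ ?_ ?_ <;> simp only [InQH, InQ] <;> omega

theorem IsRadiusSolution.fullSolution (h : IsRadiusSolution α₁ α₂ α₃ 2 InQ r)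
    (ho : SatisfiesOppositeTri α₁ α₂ α₃ InQ r) (hi : HasInitialData α₂ α₃ r)
    (hr : Represents F r) : FullSolution α₁ α₂ α₃ F where
  toLayerSolution := (h.mono fun _ _ _ hD => hD.1).layerSolution hi hr
  hexAt a b c he := by
    obtain ⟨k, hk⟩ := Nat.not_even_iff_odd.1 he
    refine (hr.hexEq_iff (K := c + a - k - 1) (L := c + b - k - 1) (M := -k - 1) (by omega)
      (by omega) (by omega)).1 (h.hex _ _ _ ?_)
    simp only [HexPatternIn, InQ]
    omega
  lower a b c he := by
    obtain ⟨k, hk⟩ := he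
    have := ho (c + a - k) (c + b - k) (-k - 1)
    rw [hr _ _ _ (a + 1) (b + 1) c (by omega) (by omega) (by omega),
      hr _ _ _ a (b + 1) (c + 1) (by omega) (by omega) (by omega),
      hr _ _ _ a b c (by omega) (by omega) (by omega),
      hr _ _ _ (a + 1) b (c + 1) (by omega) (by omega) (by omega)] at this
    simp only [InQ] at this
    exact this (by omega) (by omega) (by omega) (by omega)
  upper a b c he := by
    obtain ⟨k, hk⟩ := Nat.not_even_iff_odd.1 he
    have := h.tri (c + a - k) (c + b - k) (-k - 1)
    rw [hr _ _ _ a b (c + 1) (by omega) (by omega) (by omega),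
      hr _ _ _ (a + 1) b c (by omega) (by omega) (by omega),
      hr _ _ _ (a + 1) (b + 1) (c + 1) (by omega) (by omega) (by omega),
      hr _ _ _ a (b + 1) c (by omega) (by omega) (by omega)] at this
    simp only [InQ] at this
    exact this (by omega) (by omega) (by omega) (by omega)

end HexCirclePattern
theorem proposition5 (α₁ α₂ α₃ : ℝ) (hα₁ : 0 < α₁) (hα₂ : 0 < α₂) (hα₃ : 0 < α₃)
    (hsum : α₁ + α₂ + α₃ = Real.pi) :
    ∃ r : ℤ → ℤ → ℤ → ℝ,
      -- `r` is a solution with the given initial data on the whole lattice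
      (HexCirclePattern.IsRadiusSolution α₁ α₂ α₃ 2 HexCirclePattern.InQ r ∧
        HexCirclePattern.SatisfiesOppositeTri α₁ α₂ α₃ HexCirclePattern.InQ r ∧
        HexCirclePattern.HasInitialData α₂ α₃ r) ∧
      -- it is positive away from the origin
      (∀ K L M : ℤ, HexCirclePattern.InQ K L M → (K, L, M) ≠ (0, 0, 0) → 0 < r K L M) ∧
      -- it is the only solution on the hexagonal part
      (∀ r' : ℤ → ℤ → ℤ → ℝ,
        HexCirclePattern.IsRadiusSolution α₁ α₂ α₃ 2 HexCirclePattern.InQH r' →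
        HexCirclePattern.HasInitialData α₂ α₃ r' →
        ∀ K L M : ℤ, HexCirclePattern.InQH K L M → r' K L M = r K L M) ∧
      -- it is the only solution on the whole lattice
      (∀ r' : ℤ → ℤ → ℤ → ℝ,
        HexCirclePattern.IsRadiusSolution α₁ α₂ α₃ 2 HexCirclePattern.InQ r' →
        HexCirclePattern.SatisfiesOppositeTri α₁ α₂ α₃ HexCirclePattern.InQ r' →
        HexCirclePattern.HasInitialData α₂ α₃ r' →
        ∀ K L M : ℤ, HexCirclePattern.InQ K L M → r' K L M = r K L M) := by
  obtain ⟨ρ, h⟩ := HexCirclePattern.exists_radiusPattern hα₁ hα₂ hα₃ hsum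
  obtain ⟨r, hr⟩ : ∃ r, HexCirclePattern.Represents ρ r :=
    ⟨_, HexCirclePattern.represents_toNat ρ⟩
  refine ⟨r, ⟨h.isRadiusSolution hr, h.satisfiesOppositeTri hr, h.hasInitialData hr⟩, ?_, ?_, ?_⟩
  · intro K L M hQ h0
    obtain ⟨a, b, c, e₁, e₂, e₃, he⟩ := hQ.exists_nat
    rw [hr K L M a b c e₁ e₂ e₃]
    refine h.pos a b c he fun h1 => h0 ?_
    obtain ⟨rfl, rfl, rfl⟩ : K = 0 ∧ L = 0 ∧ M = 0 := by omega
    rfl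
  · intro r' h' hi K L M hQ
    obtain ⟨F, hF⟩ := HexCirclePattern.exists_represents r'
    have hu := (h'.layerSolution hi hF).unique hα₁ hα₂ hα₃ hsum h
    obtain ⟨a, b, c, e₁, e₂, e₃, he⟩ := hQ.1.exists_nat
    rw [hr K L M a b c e₁ e₂ e₃, hF K L M a b c e₁ e₂ e₃]
    rcases hQ.2 with e | e
    · obtain rfl : c = a + b := by omega
      exact (hu _).1 a b rfl
    · obtain rfl : c = a + b + 2 := by omega
      exact (hu _).2.1 a b rfl
  · intro r' h' ho hi K L M hQ
    obtain ⟨F, hF⟩ := HexCirclePattern.exists_represents r'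
    obtain ⟨a, b, c, e₁, e₂, e₃, he⟩ := hQ.exists_nat
    rw [hr K L M a b c e₁ e₂ e₃, hF K L M a b c e₁ e₂ e₃]
    exact (h'.fullSolution ho hi hF).unique hα₁ hα₂ hα₃ hsum h he
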